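/- Let $\Bbbk$ be a field of characteristic $\neq 2$ and let $n\ge 0$, $m\ge 1$ be integers. Let $\mathrm{ONH}_m$ be the odd nilHecke algebra: the $\Bbbk$-superalgebra with odd generators $x_1,\dots,x_m,\tau_1,\dots,\tau_{m-1}$ and relations $\tau_i^2=0$, $\tau_i\tau_{i+1}\tau_i=\tau_{i+1}\tau_i\tau_{i+1}$, $x_i\tau_i+\tau_ix_{i+1}=1=\tau_ix_i+x_{i+1}\tau_i$, $x_ix_j+x_jx_i=0$ $(i\ne j)$, $\tau_i\tau_j+\tau_j\tau_i=0$ $(|i-j|>1)$, $x_i\tau_j+\tau_jx_i=0$ $(i\neq j,j+1)$. Let $A_n$ be the supercommutative superalgebra generated by even elements $\chi_1,\dots,\chi_{\lfloor n/2\rfloor}$ and an odd element $d$ with relations $d^2=0$ and, if $n$ is even, $d\chi_{n/2}=0$, where $\chi_0=1$. Put $c_i=\chi_{i/2}$ for even $i$ and $c_i=d\chi_{(i-1)/2}$ for odd $i$. The deformed cyclotomic quotient $\mathrm{ONH}_m^n$ is the quotient of the tensor product of superalgebras $\mathrm{ONH}_m\otimes A_n$ by the two-sided ideal generated by $a^n(x_1)=\sum_{l=0}^n(-1)^l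 x_1^l\otimes c_{n-l}$. It is an $A_n$-supermodule by multiplication by $1\otimes A_n$ (on the right, or equivalently on the left). For $1\le \ell\le m$ put $N=m-\ell+1$, $\tau_{\omega_0[\ell,m]}=(\tau_\ell\cdots\tau_{m-1})(\tau_\ell\cdots\tau_{m-2})\cdots\tau_\ell$ and $$e_{[\ell,m]}=(-1)^{\binom N3}\,\tau_{\omega_0[\ell,m]}\,x_m^0x_{m-1}^1\cdots x_\ell^{m-\ell},\qquad e'_{[\ell,m]}=(-1)^{\binom N3}\,x_\ell^0x_{\ell+1}^1\cdots x_m^{m-\ell}\,\tau_{\omega_0[\ell,m]}.$$ For every $w\in\mathfrak S_m$ fix a reduced expression $w=s_{i_1}\cdots s_{i_r}$ and put $\tau_w=\tau_{i_1}\cdots\tau_{i_r}$. For $1\le k\le m$ let $\mathfrak S_{[k,m]}\subset\mathfrak S_m$ be the subgroup fixing $1,\dots,k-1$; for a left coset $\omega\in\mathfrak S_m/\mathfrak S_{[k,m]}$ let $\tau_\omega=\tau_w$, where $w$ is the element of minimal length of $\omega$. Let $X_m=\{a\in\mathbb Z_{\ge0}^m: a_i\le n-i \text{ for all } i\}$,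 $Y_{\ell,m}=\{a\in X_m: a_\ell>a_{\ell+1}>\dots>a_m\}$ and $x^a=x_1^{a_1}\cdots x_m^{a_m}$. **Theorem.** For all $1\le k,\ell\le m$, the elements $$b_m(a,\omega)=e'_{[\ell,m]}\,x^a\,\tau_\omega\,e_{[k,m]}\otimes 1,\qquad a\in Y_{\ell,m},\ \omega\in\mathfrak S_m/\mathfrak S_{[k,m]},$$ form a basis, consisting of homogeneous elements, of $e'_{[\ell,m]}\,\mathrm{ONH}_m^n\,e_{[k,m]}$ as a free $A_n$-supermodule. In particular (for $k=\ell=m$), the elements $x^a\tau_w\otimes 1$ with $a\in X_m$, $w\in\mathfrak S_m$ form a basis of $\mathrm{ONH}_m^n$ as a free $A_n$-supermodule. -/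

import Mathlib

open scoped TensorProduct

noncomputable section

namespace OddNilHecke

/-! ## Superalgebras in characteristic different from two -/

section Parity

variable {k H : Type*} [Field k] [Ring H] [Algebra k H]

/-- The parity components of a superalgebra, given by its parity involution `φ`
(`φ y = (-1)^|y| y` on homogeneous elements): the even part is the `1`-eigenspace and the odd
part is the `(-1)`-eigenspace of `φ`. -/
def parityPart (φ : H →ₐ[k] H) (i : ZMod 2) : Submodule k H where
  carrier := {y | φ y = (-1 : k) ^ i.val • y}
  zero_mem' := by simp
  add_mem' := by
    intro a b ha hb
    simp only [Set.mem_ofPred_eq] at *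
    rw [map_add, ha, hb, smul_add]
  smul_mem' := by
    intro c a ha
    simp only [Set.mem_ofPred_eq] at *
    rw [map_smul, ha, smul_comm]

theorem mem_parityPart_zero (φ : H →ₐ[k] H) (y : H) :
    y ∈ parityPart φ 0 ↔ φ y = y := by
  change φ y = (-1 : k) ^ (0 : ZMod 2).val • y ↔ _
  simp

theorem mem_parityPart_one (φ : H →ₐ[k] H) (y : H) :
    y ∈ parityPart φ 1 ↔ φ y = -y := by
  change φ y = (-1 : k) ^ (1 : ZMod 2).val • y ↔ _
  simp [ZMod.val_one]

/-- An algebra over a field of characteristic different from two with an involutive automorphism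
is a superalgebra. -/
@[reducible]
def gradedAlgebraOfInvolution [NeZero (2 : k)] (φ : H →ₐ[k] H) (hφ : ∀ y, φ (φ y) = y) :
    GradedAlgebra (parityPart φ) := by
  have h2 : (2 : k) ≠ 0 := NeZero.ne _
  have hz : ∀ i : ZMod 2, i = 0 ∨ i = 1 := by decide
  have h11 : (1 : ZMod 2) + 1 = 0 := by decide
  have half : ∀ y : H, (2 : k)⁻¹ • y + (2 : k)⁻¹ • y = y := fun y => by
    rw [← add_smul, ← two_mul, mul_inv_cancel₀ h2, one_smul]
  let p0 : H →ₗ[k] parityPart φ 0 :=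
    LinearMap.codRestrict _ ((2 : k)⁻¹ • (LinearMap.id + φ.toLinearMap)) (fun y => by
      rw [mem_parityPart_zero]
      simp [hφ, add_comm])
  let p1 : H →ₗ[k] parityPart φ 1 :=
    LinearMap.codRestrict _ ((2 : k)⁻¹ • (LinearMap.id - φ.toLinearMap)) (fun y => by
      rw [mem_parityPart_one]
      simp [hφ, ← smul_neg])
  have e0 : ∀ y, ((p0 y : parityPart φ 0) : H) = (2 : k)⁻¹ • (y + φ y) := fun y => rfl
  have e1 : ∀ y, ((p1 y : parityPart φ 1) : H) = (2 : k)⁻¹ • (y - φ y) := fun y => rfl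
  exact
  { one_mem := by rw [mem_parityPart_zero]; exact map_one φ
    mul_mem := by
      intro i j a b ha hb
      rcases hz i with rfl | rfl <;> rcases hz j with rfl | rfl <;>
        simp only [h11, add_zero, zero_add, mem_parityPart_zero, mem_parityPart_one] at * <;>
        simp [ha, hb]
    toDecomposition := DirectSum.Decomposition.ofLinearMap (parityPart φ)
      (DirectSum.lof k (ZMod 2) (fun i => parityPart φ i) 0 ∘ₗ p0
        + DirectSum.lof k (ZMod 2) (fun i => parityPart φ i) 1 ∘ₗ p1)
      (by
        ext y
        simp only [LinearMap.comp_apply, LinearMap.add_apply, map_add, DirectSum.coeLinearMap_lof,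
          LinearMap.id_apply, e0, e1]
        rw [← smul_add, add_add_sub_cancel, smul_add, half])
      (by
        ext i y : 2
        simp only [LinearMap.comp_apply, LinearMap.add_apply, DirectSum.coeLinearMap_lof,
          LinearMap.id_apply]
        rcases hz i with rfl | rfl
        · have hy := (mem_parityPart_zero φ y).1 y.2
          have a0 : p0 y = y := Subtype.ext (by rw [e0, hy, smul_add, half])
          have a1 : p1 (y : H) = 0 := Subtype.ext (by rw [e1, hy, sub_self, smul_zero]; rfl)
          rw [a0, a1, map_zero, add_zero]
        · have hy := (mem_parityPart_one φ y).1 y.2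
          have a0 : p0 (y : H) = 0 :=
            Subtype.ext (by rw [e0, hy, add_neg_cancel, smul_zero]; rfl)
          have a1 : p1 y = y := Subtype.ext (by rw [e1, hy, sub_neg_eq_add, smul_add, half])
          rw [a0, a1, map_zero, zero_add]) }

end Parity

/-! ## The odd nilHecke algebra -/

/-- The generators `x_1, …, x_m` and `τ_1, …, τ_{m-1}`. -/
inductive Gen (m : ℕ) : Type
  | x (i : ℕ) (h : 1 ≤ i ∧ i ≤ m) : Gen m
  | t (i : ℕ) (h : 1 ≤ i ∧ i < m) : Gen m

/-- The letter `x_i` in the free algebra (zero if `i` is not in `[1, m]`). -/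
def freeX (k : Type*) [Field k] (m i : ℕ) : FreeAlgebra k (Gen m) :=
  if h : 1 ≤ i ∧ i ≤ m then FreeAlgebra.ι k (Gen.x i h) else 0

/-- The letter `τ_i` in the free algebra (zero if `i` is not in `[1, m-1]`). -/
def freeT (k : Type*) [Field k] (m i : ℕ) : FreeAlgebra k (Gen m) :=
  if h : 1 ≤ i ∧ i < m then FreeAlgebra.ι k (Gen.t i h) else 0

/-- The defining relations of the odd nilHecke algebra. -/
inductive Rel (k : Type*) [Field k] (m : ℕ) :
    FreeAlgebra k (Gen m) → FreeAlgebra k (Gen m) → Prop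
  | t_sq (i : ℕ) (hi : 1 ≤ i ∧ i < m) : Rel k m (freeT k m i * freeT k m i) 0
  | braid (i : ℕ) (hi : 1 ≤ i ∧ i + 1 < m) :
      Rel k m (freeT k m i * freeT k m (i + 1) * freeT k m i)
        (freeT k m (i + 1) * freeT k m i * freeT k m (i + 1))
  | x_t (i : ℕ) (hi : 1 ≤ i ∧ i < m) :
      Rel k m (freeX k m i * freeT k m i + freeT k m i * freeX k m (i + 1)) 1
  | t_x (i : ℕ) (hi : 1 ≤ i ∧ i < m) :
      Rel k m (freeT k m i * freeX k m i + freeX k m (i + 1) * freeT k m i) 1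
  | x_x (i j : ℕ) (hi : 1 ≤ i ∧ i ≤ m) (hj : 1 ≤ j ∧ j ≤ m) (hij : i ≠ j) :
      Rel k m (freeX k m i * freeX k m j + freeX k m j * freeX k m i) 0
  | t_t (i j : ℕ) (hi : 1 ≤ i ∧ i < m) (hj : 1 ≤ j ∧ j < m) (hij : i + 1 < j ∨ j + 1 < i) :
      Rel k m (freeT k m i * freeT k m j + freeT k m j * freeT k m i) 0
  | x_t_far (i j : ℕ) (hi : 1 ≤ i ∧ i ≤ m) (hj : 1 ≤ j ∧ j < m) (h0 : i ≠ j) (h1 : i ≠ j + 1) :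
      Rel k m (freeX k m i * freeT k m j + freeT k m j * freeX k m i) 0

/-- The odd nilHecke algebra `ONH_m` over `k`. -/
def ONH (k : Type*) [Field k] (m : ℕ) : Type _ := RingQuot (Rel k m)

instance (k : Type*) [Field k] (m : ℕ) : Ring (ONH k m) :=
  inferInstanceAs (Ring (RingQuot (Rel k m)))

instance (k : Type*) [Field k] (m : ℕ) : Algebra k (ONH k m) :=
  inferInstanceAs (Algebra k (RingQuot (Rel k m)))

/-- The quotient map from the free algebra. -/
def ONH.mk (k : Type*) [Field k] (m : ℕ) : FreeAlgebra k (Gen m) →ₐ[k] ONH k m :=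
  RingQuot.mkAlgHom k (Rel k m)

/-- The element `x_i`, for `1 ≤ i ≤ m`. -/
def ONH.x (k : Type*) [Field k] (m i : ℕ) : ONH k m := ONH.mk k m (freeX k m i)

/-- The element `τ_i`, for `1 ≤ i < m`. -/
def ONH.t (k : Type*) [Field k] (m i : ℕ) : ONH k m := ONH.mk k m (freeT k m i)

/-- The sign change of all generators on the free algebra. -/
def freeParity (k : Type*) [Field k] (m : ℕ) :
    FreeAlgebra k (Gen m) →ₐ[k] FreeAlgebra k (Gen m) :=
  FreeAlgebra.lift k (fun g => -FreeAlgebra.ι k g)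

theorem freeParity_freeX (k : Type*) [Field k] (m i : ℕ) :
    freeParity k m (freeX k m i) = -freeX k m i := by
  unfold freeX freeParity
  split_ifs <;> simp

theorem freeParity_freeT (k : Type*) [Field k] (m i : ℕ) :
    freeParity k m (freeT k m i) = -freeT k m i := by
  unfold freeT freeParity
  split_ifs <;> simp

theorem mk_freeParity_of_rel (k : Type*) [Field k] (m : ℕ) {a b : FreeAlgebra k (Gen m)}
    (h : Rel k m a b) :
    ((ONH.mk k m).comp (freeParity k m)) a = ((ONH.mk k m).comp (freeParity k m)) b := by
  have key := RingQuot.mkAlgHom_rel k h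
  change ONH.mk k m a = ONH.mk k m b at key
  cases h <;>
    simp only [AlgHom.comp_apply, map_mul, map_add, map_neg, map_zero, map_one, freeParity_freeX,
      freeParity_freeT, mul_neg, neg_mul, neg_neg] at key ⊢ <;>
    first
      | exact key
      | rw [key]

/-- The parity involution of `ONH_m`: all the generators are odd. -/
def ONH.parity (k : Type*) [Field k] (m : ℕ) : ONH k m →ₐ[k] ONH k m :=
  RingQuot.liftAlgHom k ⟨(ONH.mk k m).comp (freeParity k m),
    fun _ _ h => mk_freeParity_of_rel k m h⟩

theorem ONH.parity_mk (k : Type*) [Field k] (m : ℕ) (y : FreeAlgebra k (Gen m)) :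
    ONH.parity k m (ONH.mk k m y) = ONH.mk k m (freeParity k m y) :=
  RingQuot.liftAlgHom_mkAlgHom_apply _ _ _ _

theorem ONH.parity_parity (k : Type*) [Field k] (m : ℕ) (y : ONH k m) :
    ONH.parity k m (ONH.parity k m y) = y := by
  obtain ⟨z, rfl⟩ := RingQuot.mkAlgHom_surjective k (Rel k m) y
  change ONH.parity k m (ONH.parity k m (ONH.mk k m z)) = ONH.mk k m z
  rw [ONH.parity_mk, ONH.parity_mk]
  have : (freeParity k m).comp (freeParity k m) = AlgHom.id k _ := by
    ext g
    simp [freeParity]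
  exact congrArg _ (DFunLike.congr_fun this z)

/-- The even (`i = 0`) and the odd (`i = 1`) part of `ONH_m`. -/
def ONH.part (k : Type*) [Field k] (m : ℕ) : ZMod 2 → Submodule k (ONH k m) :=
  parityPart (ONH.parity k m)

instance (k : Type*) [Field k] [NeZero (2 : k)] (m : ℕ) : GradedAlgebra (ONH.part k m) :=
  gradedAlgebraOfInvolution (ONH.parity k m) (ONH.parity_parity k m)

/-! ## The coefficient superalgebra -/

/-- The generators `d` and `χ_1, …, χ_{⌊n/2⌋}`. -/
inductive CoeffGen (n : ℕ) : Type
  | d : CoeffGen n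
  | chi (j : ℕ) (h : 1 ≤ j ∧ j ≤ n / 2) : CoeffGen n

/-- The element `χ_j` before dividing out the relations, with `χ_0 = 1`. -/
def polyChi (k : Type*) [Field k] (n j : ℕ) : MvPolynomial (CoeffGen n) k :=
  if j = 0 then 1
  else if h : 1 ≤ j ∧ j ≤ n / 2 then MvPolynomial.X (CoeffGen.chi j h) else 0

/-- The element `d` before dividing out the relations. -/
def polyD (k : Type*) [Field k] (n : ℕ) : MvPolynomial (CoeffGen n) k :=
  MvPolynomial.X CoeffGen.d

/-- The relations `d² = 0` and, for even `n`, `d χ_{n/2} = 0`. -/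
def coeffIdeal (k : Type*) [Field k] (n : ℕ) : Ideal (MvPolynomial (CoeffGen n) k) :=
  Ideal.span ({polyD k n ^ 2} ∪ {y | Even n ∧ y = polyD k n * polyChi k n (n / 2)})

/-- The superalgebra `A_n`, generated by even elements `χ_j` and one odd element `d`. As the
product of any two odd elements is zero, it is supercommutative and also commutative. -/
def A (k : Type*) [Field k] (n : ℕ) : Type _ := MvPolynomial (CoeffGen n) k ⧸ coeffIdeal k n

instance (k : Type*) [Field k] (n : ℕ) : CommRing (A k n) :=
  inferInstanceAs (CommRing (MvPolynomial (CoeffGen n) k ⧸ coeffIdeal k n))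

instance (k : Type*) [Field k] (n : ℕ) : Algebra k (A k n) :=
  inferInstanceAs (Algebra k (MvPolynomial (CoeffGen n) k ⧸ coeffIdeal k n))

/-- The quotient map from the polynomial algebra. -/
def A.mk (k : Type*) [Field k] (n : ℕ) : MvPolynomial (CoeffGen n) k →ₐ[k] A k n :=
  Ideal.Quotient.mkₐ k (coeffIdeal k n)

/-- The odd generator `d`. -/
def A.d (k : Type*) [Field k] (n : ℕ) : A k n := A.mk k n (polyD k n)

/-- The even elements `χ_j`, for `0 ≤ j ≤ ⌊n/2⌋`, with `χ_0 = 1`. -/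
def A.chi (k : Type*) [Field k] (n j : ℕ) : A k n := A.mk k n (polyChi k n j)

/-- The elements `c_i`: `c_i = χ_{i/2}` for even `i` and `c_i = d χ_{(i-1)/2}` for odd `i`. -/
def A.c (k : Type*) [Field k] (n i : ℕ) : A k n :=
  if Even i then A.chi k n (i / 2) else A.d k n * A.chi k n ((i - 1) / 2)

/-- The automorphism `d ↦ -d`, `χ_j ↦ χ_j` of the polynomial algebra. -/
def polyParity (k : Type*) [Field k] (n : ℕ) :
    MvPolynomial (CoeffGen n) k →ₐ[k] MvPolynomial (CoeffGen n) k :=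
  MvPolynomial.aeval (fun g => match g with
    | CoeffGen.d => -MvPolynomial.X CoeffGen.d
    | CoeffGen.chi j h => MvPolynomial.X (CoeffGen.chi j h))

theorem polyParity_polyD (k : Type*) [Field k] (n : ℕ) :
    polyParity k n (polyD k n) = -polyD k n := by
  simp [polyParity, polyD]

theorem polyParity_polyChi (k : Type*) [Field k] (n j : ℕ) :
    polyParity k n (polyChi k n j) = polyChi k n j := by
  unfold polyChi polyParity
  split_ifs <;> simp

theorem mk_polyParity_of_mem (k : Type*) [Field k] (n : ℕ) (y : MvPolynomial (CoeffGen n) k)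
    (hy : y ∈ coeffIdeal k n) : ((A.mk k n).comp (polyParity k n)) y = 0 := by
  have hle : coeffIdeal k n ≤ RingHom.ker ((A.mk k n).comp (polyParity k n)) := by
    refine Ideal.span_le.2 ?_
    have hm : ∀ z, z ∈ coeffIdeal k n → A.mk k n z = 0 :=
      fun z hz => Ideal.Quotient.eq_zero_iff_mem.2 hz
    rintro z (rfl | ⟨hn, rfl⟩)
    · change A.mk k n (polyParity k n _) = 0
      rw [map_pow, polyParity_polyD, neg_sq]
      exact hm _ (Ideal.subset_span (Or.inl rfl))
    · change A.mk k n (polyParity k n _) = 0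
      rw [map_mul, polyParity_polyD, polyParity_polyChi, neg_mul, map_neg, neg_eq_zero]
      exact hm _ (Ideal.subset_span (Or.inr ⟨hn, rfl⟩))
  exact hle hy

/-- The parity involution of `A_n`. -/
def A.parity (k : Type*) [Field k] (n : ℕ) : A k n →ₐ[k] A k n :=
  Ideal.Quotient.liftₐ (coeffIdeal k n) ((A.mk k n).comp (polyParity k n))
    (mk_polyParity_of_mem k n)

theorem A.parity_mk (k : Type*) [Field k] (n : ℕ) (y : MvPolynomial (CoeffGen n) k) :
    A.parity k n (A.mk k n y) = A.mk k n (polyParity k n y) := rfl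

theorem A.parity_parity (k : Type*) [Field k] (n : ℕ) (y : A k n) :
    A.parity k n (A.parity k n y) = y := by
  obtain ⟨z, rfl⟩ := Ideal.Quotient.mk_surjective y
  change A.parity k n (A.parity k n (A.mk k n z)) = A.mk k n z
  rw [A.parity_mk, A.parity_mk]
  have : (polyParity k n).comp (polyParity k n) = AlgHom.id k _ := by
    ext1 g
    cases g <;> simp [polyParity]
  exact congrArg _ (DFunLike.congr_fun this z)

/-- The even (`i = 0`) and the odd (`i = 1`) part of `A_n`. -/
def A.part (k : Type*) [Field k] (n : ℕ) : ZMod 2 → Submodule k (A k n) :=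
  parityPart (A.parity k n)

instance (k : Type*) [Field k] [NeZero (2 : k)] (n : ℕ) : GradedAlgebra (A.part k n) :=
  gradedAlgebraOfInvolution (A.parity k n) (A.parity_parity k n)

/-! ## The deformed cyclotomic quotient -/

section Quotient

variable (k : Type*) [Field k] [NeZero (2 : k)] (n m : ℕ)

/-- The tensor product of superalgebras `ONH_m ⊗ A_n`, with the multiplication
`(a₁ ⊗ b₁) (a₂ ⊗ b₂) = (-1)^(|a₂| |b₁|) (a₁ a₂) ⊗ (b₁ b₂)`. -/
abbrev SuperTensor : Type _ := (ONH.part k m) ᵍ⊗[k] (A.part k n)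

/-- The element `a^n(x_1) = ∑_{0 ≤ l ≤ n} (-1)^l x_1^l ⊗ c_{n-l}`. -/
def cycElement : SuperTensor k n m :=
  ∑ l ∈ Finset.range (n + 1),
    (-1 : k) ^ l • GradedTensorProduct.tmul k (ONH.x k m 1 ^ l) (A.c k n (n - l))

/-- The relation `a^n(x_1) = 0`. It is void for `m = 0`, where there is no `x_1`. -/
def CycRel (u v : SuperTensor k n m) : Prop := 1 ≤ m ∧ u = cycElement k n m ∧ v = 0

/-- The deformed cyclotomic quotient `ONH_m^n`: the quotient of `ONH_m ⊗ A_n` by the two-sided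
ideal generated by `a^n(x_1)`. -/
def CycQuot : Type _ := RingQuot (CycRel k n m)

instance : Ring (CycQuot k n m) := inferInstanceAs (Ring (RingQuot (CycRel k n m)))

instance : Algebra k (CycQuot k n m) := inferInstanceAs (Algebra k (RingQuot (CycRel k n m)))

/-- The quotient map. -/
def CycQuot.mk : SuperTensor k n m →ₐ[k] CycQuot k n m := RingQuot.mkAlgHom k (CycRel k n m)

/-- The map `ONH_m → ONH_m^n`, `h ↦ h ⊗ 1`. -/
def CycQuot.ofONH : ONH k m →ₐ[k] CycQuot k n m :=
  (CycQuot.mk k n m).comp (GradedTensorProduct.includeLeft (ONH.part k m) (A.part k n))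

/-- The map `A_n → ONH_m^n`, `c ↦ 1 ⊗ c`. -/
def CycQuot.ofA : A k n →ₐ[k] CycQuot k n m :=
  (CycQuot.mk k n m).comp (GradedTensorProduct.includeRight (ONH.part k m) (A.part k n))

/-- The left `A_n`-module structure of `ONH_m^n`. -/
instance : Module (A k n) (CycQuot k n m) :=
  Module.compHom (CycQuot k n m) (CycQuot.ofA k n m).toRingHom

/-- The right `A_n`-module structure of `ONH_m^n`. -/
instance : Module (A k n)ᵐᵒᵖ (CycQuot k n m) :=
  Module.compHom (CycQuot k n m) (CycQuot.ofA k n m).toRingHom.op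

/-- The even (`p = 0`) and the odd (`p = 1`) part of `ONH_m^n`: the image of the corresponding
part of `ONH_m ⊗ A_n`. -/
def CycQuot.part (p : ZMod 2) : Submodule k (CycQuot k n m) :=
  Submodule.span k {y | ∃ i j : ZMod 2, i + j = p ∧ ∃ h ∈ ONH.part k m i, ∃ c ∈ A.part k n j,
    y = CycQuot.mk k n m (GradedTensorProduct.tmul k h c)}

variable {k n m}

/-- The family `b` is a basis, consisting of homogeneous elements, of the subset `S` of `ONH_m^n`
as a supermodule over `A_n`, for the right and for the left action of `A_n`. -/
structure IsSuperBasis {I : Type*} (b : I → CycQuot k n m) (S : Set (CycQuot k n m)) : Prop where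
  homogeneous : ∀ i, ∃ p : ZMod 2, b i ∈ CycQuot.part k n m p
  right_independent : LinearIndependent (A k n)ᵐᵒᵖ b
  right_span : (Submodule.span (A k n)ᵐᵒᵖ (Set.range b) : Set (CycQuot k n m)) = S
  left_independent : LinearIndependent (A k n) b
  left_span : (Submodule.span (A k n) (Set.range b) : Set (CycQuot k n m)) = S

end Quotient

/-! ## Idempotents -/

section Idempotents

variable (k : Type*) [Field k] (m : ℕ)

/-- `τ_{ω₀[l,r]} = (τ_l ⋯ τ_{r-1}) (τ_l ⋯ τ_{r-2}) ⋯ (τ_l)`. -/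
def tauLongest (l r : ℕ) : ONH k m :=
  ((List.range (r - l)).map fun j =>
    ((List.range (r - l - j)).map fun i => ONH.t k m (l + i)).prod).prod

/-- `x_{[l,r]} = ± x_r^0 x_{r-1}^1 ⋯ x_l^{r-l}`, with sign `(-1)^(r-l+1 choose 3)`. -/
def xInt (l r : ℕ) : ONH k m :=
  (-1) ^ (r - l + 1).choose 3 *
    ((List.range (r - l + 1)).map fun j => ONH.x k m (r - j) ^ j).prod

/-- `x'_{[l,r]} = ± x_l^0 x_{l+1}^1 ⋯ x_r^{r-l}`, with sign `(-1)^(r-l+1 choose 3)`, the one for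
which `e'_{[l,r]}` is idempotent. -/
def xInt' (l r : ℕ) : ONH k m :=
  (-1) ^ (r - l + 1).choose 3 *
    ((List.range (r - l + 1)).map fun j => ONH.x k m (l + j) ^ j).prod

/-- The idempotent `e_{[l,r]} = τ_{ω₀[l,r]} x_{[l,r]}`. -/
def idem (l r : ℕ) : ONH k m := tauLongest k m l r * xInt k m l r

/-- The idempotent `e'_{[l,r]} = x'_{[l,r]} τ_{ω₀[l,r]}`. -/
def idem' (l r : ℕ) : ONH k m := xInt' k m l r * tauLongest k m l r

end Idempotents

/-! ## Index sets -/

/-- The indices `1, …, m-1` of the simple transpositions. -/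
abbrev Letter (m : ℕ) : Type := {i : ℕ // 1 ≤ i ∧ i < m}

/-- The simple transposition `s_i` exchanging the `i`-th and the `(i+1)`-st of the `m` points; the
`j`-th point is the element `j - 1` of `Fin m`. -/
def simple {m : ℕ} (i : Letter m) : Equiv.Perm (Fin m) :=
  Equiv.swap ⟨i.1 - 1, by omega⟩ ⟨i.1, i.2.2⟩

/-- The permutation `s_{i_1} ⋯ s_{i_r}`. -/
def wordPerm {m : ℕ} (L : List (Letter m)) : Equiv.Perm (Fin m) := (L.map simple).prod

/-- `L` is a reduced expression of `w`. -/
def IsReduced {m : ℕ} (w : Equiv.Perm (Fin m)) (L : List (Letter m)) : Prop :=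
  wordPerm L = w ∧ ∀ L' : List (Letter m), wordPerm L' = w → L.length ≤ L'.length

/-- The length of a permutation with respect to the simple transpositions. -/
def len {m : ℕ} (w : Equiv.Perm (Fin m)) : ℕ :=
  sInf {r | ∃ L : List (Letter m), wordPerm L = w ∧ L.length = r}

/-- The element `τ_{i_1} ⋯ τ_{i_r}` of `ONH_m`. -/
def tauWord (k : Type*) [Field k] {m : ℕ} (L : List (Letter m)) : ONH k m :=
  (L.map fun i => ONH.t k m i.1).prod

/-- The subgroup `𝔖_{[l,m]}` of `𝔖_m`: the permutations that fix `1, …, l-1`. -/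
def intervalSubgroup (l m : ℕ) : Subgroup (Equiv.Perm (Fin m)) :=
  fixingSubgroup (Equiv.Perm (Fin m)) {i : Fin m | i.1 + 1 < l}

/-- `rep` chooses a representative of minimal length in each left coset of `𝔖_{[l,m]}`. -/
def IsMinimalSection (l m : ℕ)
    (rep : Equiv.Perm (Fin m) ⧸ intervalSubgroup l m → Equiv.Perm (Fin m)) : Prop :=
  ∀ ω, (QuotientGroup.mk (rep ω) : Equiv.Perm (Fin m) ⧸ intervalSubgroup l m) = ω ∧
    ∀ w : Equiv.Perm (Fin m),
      (QuotientGroup.mk w : Equiv.Perm (Fin m) ⧸ intervalSubgroup l m) = ω → len (rep ω) ≤ len w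

/-- `X_m`: the tuples `(a_1, …, a_m)` of natural numbers with `a_i ≤ n - i`. -/
def X (n m : ℕ) : Set (Fin m → ℕ) := {a | ∀ i : Fin m, (a i : ℤ) ≤ (n : ℤ) - ((i.1 : ℤ) + 1)}

/-- `Y_{l,m}`: the tuples in `X_m` with `a_l > a_{l+1} > ⋯ > a_m`. -/
def Y (n l m : ℕ) : Set (Fin m → ℕ) :=
  {a | a ∈ X n m ∧ ∀ i j : Fin m, l ≤ i.1 + 1 → i < j → a j < a i}

/-- The monomial `x^a = x_1^{a_1} ⋯ x_m^{a_m}`. -/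
def monomial (k : Type*) [Field k] {m : ℕ} (a : Fin m → ℕ) : ONH k m :=
  (List.ofFn fun i : Fin m => ONH.x k m (i.1 + 1) ^ a i).prod

end OddNilHecke

end

open scoped TensorProduct

noncomputable section

namespace OddNilHecke

/-! ## Odd polynomials with coefficients in `A_n` -/

/-! The special case of all monomials `x^a τ_w` comes first, and the idempotent version is deduced
from it by counting.

Let `ONH_m ⊗ A_n` act on odd polynomials over `A_n`: `x_i` by left multiplication, `τ_i` by the odd
divided difference `∂_i`. Put `a_1 = a^n(x_1)` and `a_{j+1} = ∂_j a_j`. The relations `d² = 0` and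
`d χ_{n/2} = 0` are what makes the left ideal of `a_1` two-sided (`cyc_mul_x_one`,
`exists_cyc_mul`). Hence the left ideal `flagIdeal` generated by `a_1, …, a_m` contains `a_1 f` for
every `f`; it is also stable under `∂_1, …, ∂_{m-1}`, so the cyclotomic quotient acts on polynomials
modulo `flagIdeal`. Since `a_j` has degree `n-j+1` in `x_j` with leading coefficient `±1`, division
with remainder shows that the `x^a` with `a ∈ X_m` span the polynomials in `x_1, …, x_m` modulo this
ideal (`vars_le_monoSpan_sup`) and are independent there (`mono_independent_mod`).

Spanning by `x^a τ_w`: in the quotient algebra `a_j τ_w` is a combination of terms with longer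
permutations (`flag_mul_tauWord_mem`), so polynomials can be reduced modulo `flagIdeal` by
descending induction on length (`polySpan_le_basisSpan`). Independence: right multiplication by `τ_u
x^δ`, with `u = w⁻¹ω₀` and `∂_{ω₀} x^δ = ±1`, isolates the coefficients of a shortest `w`
(`mono_tauWord_independent`).

For the idempotents, `τ_{ω₀[l,m]} ∂_i(f)` vanishes modulo longer permutations when `l ≤ i`, because
`τ_{ω₀[l,m]} τ_i = 0`. This straightens exponents into strictly decreasing ones, so the `e' x^a τ_w`
with `a ∈ Y_{l,m}` generate `e' ONH_m^n` (`idem'_mul_mem`). Moreover `1` is a sum of `N!` terms `u_b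
τ_{ω₀[l,m]} v_b`, where `N = m-l+1`, so `N! · |Y_{l,m}| · m!` elements generate the whole algebra.
As `N! · |Y_{l,m}| ≤ |X_m|`, these are no more than the rank, and a generating family of at most
that size is independent. On the right, `τ_w e_{[k,m]} = 0` unless `w` is minimal in its coset, and
multiplication by `τ_{ω₀[k,m]}` carries the remaining elements, up to sign, to distinct members of
an independent family.

Apart from the commutation rules, signs are mostly left untracked: `EqSign` suffices, since bases do
not see them. -/

/-- The relations between odd variables and coefficients. -/
inductive OddPolyRel (k : Type*) [Field k] (n : ℕ) :
    FreeAlgebra k (A k n ⊕ ℕ) → FreeAlgebra k (A k n ⊕ ℕ) → Prop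
  | add (c c' : A k n) : OddPolyRel k n (FreeAlgebra.ι k (Sum.inl (c + c')))
      (FreeAlgebra.ι k (Sum.inl c) + FreeAlgebra.ι k (Sum.inl c'))
  | mul (c c' : A k n) : OddPolyRel k n (FreeAlgebra.ι k (Sum.inl (c * c')))
      (FreeAlgebra.ι k (Sum.inl c) * FreeAlgebra.ι k (Sum.inl c'))
  | scalar (r : k) : OddPolyRel k n (FreeAlgebra.ι k (Sum.inl (algebraMap k (A k n) r)))
      (algebraMap k _ r)
  | comm (j : ℕ) (c : A k n) : OddPolyRel k n
      (FreeAlgebra.ι k (Sum.inr j) * FreeAlgebra.ι k (Sum.inl c))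
      (FreeAlgebra.ι k (Sum.inl (A.parity k n c)) * FreeAlgebra.ι k (Sum.inr j))
  | anti (i j : ℕ) (hij : i ≠ j) : OddPolyRel k n
      (FreeAlgebra.ι k (Sum.inr i) * FreeAlgebra.ι k (Sum.inr j) +
        FreeAlgebra.ι k (Sum.inr j) * FreeAlgebra.ι k (Sum.inr i)) 0

/-- Polynomials in odd variables `x_0, x_1, …` with coefficients in the superalgebra `A_n`. -/
def OddPoly (k : Type*) [Field k] (n : ℕ) : Type _ := RingQuot (OddPolyRel k n)

namespace OddPoly

instance (k : Type*) [Field k] (n : ℕ) : Ring (OddPoly k n) :=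
  inferInstanceAs (Ring (RingQuot (OddPolyRel k n)))

instance (k : Type*) [Field k] (n : ℕ) : Algebra k (OddPoly k n) :=
  inferInstanceAs (Algebra k (RingQuot (OddPolyRel k n)))

variable {k : Type*} [Field k] {n : ℕ}

/-- The quotient map from the free algebra. -/
def mk : FreeAlgebra k (A k n ⊕ ℕ) →ₐ[k] OddPoly k n := RingQuot.mkAlgHom k (OddPolyRel k n)

theorem mk_rel {a b : FreeAlgebra k (A k n ⊕ ℕ)} (h : OddPolyRel k n a b) :
    (mk a : OddPoly k n) = mk b := RingQuot.mkAlgHom_rel k h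

/-- The variable `x_j`. -/
def x (j : ℕ) : OddPoly k n := mk (FreeAlgebra.ι k (Sum.inr j))

/-- The inclusion of the coefficients. -/
def C : A k n →ₐ[k] OddPoly k n where
  toFun c := mk (FreeAlgebra.ι k (Sum.inl c))
  map_one' := by
    have := mk_rel (OddPolyRel.scalar (k := k) (n := n) 1)
    rwa [map_one, map_one, map_one] at this
  map_zero' := by
    have := mk_rel (OddPolyRel.scalar (k := k) (n := n) 0)
    rwa [map_zero, map_zero, map_zero] at this
  map_add' c c' := by rw [mk_rel (OddPolyRel.add c c'), map_add]
  map_mul' c c' := by rw [mk_rel (OddPolyRel.mul c c'), map_mul]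
  commutes' r := by rw [mk_rel (OddPolyRel.scalar r), AlgHom.commutes]

theorem x_mul_C (j : ℕ) (c : A k n) :
    (x j : OddPoly k n) * C c = C (A.parity k n c) * x j := by
  have := mk_rel (OddPolyRel.comm j c)
  rwa [map_mul, map_mul] at this

theorem C_mul_x (j : ℕ) (c : A k n) :
    C c * (x j : OddPoly k n) = x j * C (A.parity k n c) := by
  rw [x_mul_C, A.parity_parity]

theorem x_mul_x {i j : ℕ} (h : i ≠ j) : (x i : OddPoly k n) * x j = -(x j * x i) := by
  have := mk_rel (OddPolyRel.anti (k := k) (n := n) i j h)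
  rw [map_add, map_mul, map_mul, map_zero] at this
  exact eq_neg_of_add_eq_zero_left this

section Lift

variable {S : Type*} [Ring S] [Algebra k S] (f : A k n →ₐ[k] S) (g : ℕ → S)
  (hc : ∀ j c, g j * f c = f (A.parity k n c) * g j)
  (hx : ∀ i j, i ≠ j → g i * g j + g j * g i = 0)

/-- The universal property of odd polynomials. -/
def lift : OddPoly k n →ₐ[k] S :=
  RingQuot.liftAlgHom k ⟨FreeAlgebra.lift k (Sum.elim f g), fun a b h => by
    cases h with
    | add c c' => simp
    | mul c c' => simp
    | scalar r => simp
    | comm j c => simpa using hc j c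
    | anti i j hij => simpa using hx i j hij⟩

@[simp]
theorem lift_x (j : ℕ) : lift f g hc hx (x j) = g j := by
  refine (RingQuot.liftAlgHom_mkAlgHom_apply _ _ _ _).trans ?_
  simp

@[simp]
theorem lift_C (c : A k n) : lift f g hc hx (C c) = f c := by
  refine (RingQuot.liftAlgHom_mkAlgHom_apply _ _ _ _).trans ?_
  simp

end Lift

@[elab_as_elim]
theorem induction {p : OddPoly k n → Prop} (C : ∀ c, p (C c)) (x : ∀ j, p (x j))
    (add : ∀ f g, p f → p g → p (f + g)) (mul : ∀ f g, p f → p g → p (f * g)) (f : OddPoly k n) :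
    p f := by
  obtain ⟨z, rfl⟩ := RingQuot.mkAlgHom_surjective k (OddPolyRel k n) f
  change p (mk z)
  induction z using FreeAlgebra.induction with
  | grade0 r => rw [AlgHom.commutes, ← AlgHom.commutes OddPoly.C]; exact C _
  | grade1 y =>
    rcases y with c | j
    · exact C c
    · exact x j
  | mul a b ha hb => rw [map_mul]; exact mul _ _ ha hb
  | add a b ha hb => rw [map_add]; exact add _ _ ha hb

-- The twisted Leibniz rule gives the effect of an operator on `x j * f` in terms of its effect on
-- `f`, so identities between such operators propagate through left multiplication by generators.
@[elab_as_elim]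
theorem induction_left {p : OddPoly k n → Prop} (one : p 1)
    (add : ∀ f g, p f → p g → p (f + g)) (C_mul : ∀ c f, p f → p (C c * f))
    (x_mul : ∀ j f, p f → p (x j * f)) (f : OddPoly k n) : p f := by
  have key : ∀ g : OddPoly k n, ∀ f, p f → p (g * f) := by
    intro g
    induction g using induction with
    | C c => exact C_mul c
    | x j => exact x_mul j
    | add a b ha hb => intro f hf; rw [add_mul]; exact add _ _ (ha f hf) (hb f hf)
    | mul a b ha hb => intro f hf; rw [mul_assoc]; exact ha _ (hb f hf)
  simpa using key f 1 one

theorem algHom_ext' {S : Type*} [Ring S] [Algebra k S] {F G : OddPoly k n →ₐ[k] S}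
    (hC : ∀ c, F (C c) = G (C c)) (hx : ∀ j, F (x j) = G (x j)) : F = G := by
  ext f
  induction f using induction with
  | C c => exact hC c
  | x j => exact hx j
  | add a b ha hb => simp [ha, hb]
  | mul a b ha hb => simp [ha, hb]

/-- The constant term. -/
def constTerm : OddPoly k n →ₐ[k] A k n :=
  lift (AlgHom.id k _) (fun _ => 0) (by simp) (by simp)

@[simp]
theorem constTerm_C (c : A k n) : constTerm (C c : OddPoly k n) = c := by simp [constTerm]

/-! ## Twisted derivations -/

/-- The values on the variables of an endomorphism `σ` and of a `σ`-derivation. -/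
structure TwistData (k : Type*) [Field k] (n : ℕ) where
  s : ℕ → OddPoly k n
  δ : ℕ → OddPoly k n
  s_C : ∀ j c, s j * C c = C (A.parity k n c) * s j
  -- This and `s_δ` are the twisted Leibniz rule applied to the two defining relations of `OddPoly`;
  -- they are exactly what makes the derivation well defined.
  δ_C : ∀ j c, δ j * C c = C c * δ j
  s_s : ∀ i j, i ≠ j → s i * s j + s j * s i = 0
  s_δ : ∀ i j, i ≠ j → s i * δ j + δ i * x j + (s j * δ i + δ j * x i) = 0

namespace TwistData

variable (T : TwistData k n)

/-- The endomorphism of a twist. -/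
def σ : OddPoly k n →ₐ[k] OddPoly k n :=
  lift (C.comp (A.parity k n)) T.s (fun j c => by simp [T.s_C]) T.s_s

@[simp] theorem σ_x (j : ℕ) : T.σ (x j) = T.s j := lift_x _ _ _ _ j

@[simp] theorem σ_C (c : A k n) : T.σ (C c) = C (A.parity k n c) :=
  lift_C _ _ _ _ c

/-- The upper triangular representation with diagonal `σ`, `1` that encodes a `σ`-derivation. -/
def tri : OddPoly k n →ₐ[k] Matrix (Fin 2) (Fin 2) (OddPoly k n) :=
  lift ((Matrix.diagonalAlgHom k).comp (AlgHom.pi ![C.comp (A.parity k n), C]))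
    (fun j => !![T.s j, T.δ j; 0, x j])
    (fun j c => by
      ext a b
      fin_cases a <;> fin_cases b <;>
        simp [Matrix.mul_apply, Fin.sum_univ_two, T.s_C, T.δ_C, x_mul_C, A.parity_parity])
    (fun i j h => by
      ext a b
      fin_cases a <;> fin_cases b <;>
        simp [T.s_s i j h, T.s_δ i j h, x_mul_x h])

theorem tri_x (j : ℕ) : T.tri (x j) = !![T.s j, T.δ j; 0, x j] := by simp [tri]

theorem tri_C (c : A k n) : T.tri (C c) = !![C (A.parity k n c), 0; 0, C c] := by
  ext a b
  fin_cases a <;> fin_cases b <;> simp [tri]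

/-- The `σ`-derivation of a twist. -/
def D : OddPoly k n →ₗ[k] OddPoly k n where
  toFun f := T.tri f 0 1
  map_add' := by simp
  map_smul' := by simp

/-- The off-diagonal entry of a product of upper triangular matrices is the twisted Leibniz rule;
obtaining `D` from an algebra homomorphism spares a separate check of well-definedness. -/
theorem tri_eq (f : OddPoly k n) : T.tri f = !![T.σ f, T.D f; 0, f] := by
  have h01 : ∀ f, T.tri f 0 1 = T.D f := fun f => rfl
  have : T.tri f 0 0 = T.σ f ∧ T.tri f 1 0 = 0 ∧ T.tri f 1 1 = f := by
    induction f using induction with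
    | C c => simp [tri_C]
    | x j => simp [tri_x]
    | add a b ha hb => simp [ha, hb]
    | mul a b ha hb => simp [Matrix.mul_apply, Fin.sum_univ_two, ha, hb]
  ext a b
  fin_cases a <;> fin_cases b <;> simp [this, h01]

@[simp] theorem D_x (j : ℕ) : T.D (x j) = T.δ j := by
  change T.tri (x j) 0 1 = _
  simp [tri_x]

@[simp] theorem D_C (c : A k n) : T.D (C c) = 0 := by
  change T.tri (C c) 0 1 = _
  simp [tri_C]

theorem D_mul (f g : OddPoly k n) : T.D (f * g) = T.D f * g + T.σ f * T.D g := by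
  change T.tri (f * g) 0 1 = _
  rw [map_mul, tri_eq, tri_eq]
  simp [Matrix.mul_apply, Fin.sum_univ_two, add_comm]

@[simp] theorem D_one : T.D 1 = 0 := by
  rw [← map_one C]
  exact T.D_C 1

theorem D_mul_C (f : OddPoly k n) (c : A k n) : T.D (f * C c) = T.D f * C c := by
  simp [D_mul]

end TwistData

/-- The odd divided difference operator exchanging `x_i` and `x_{i+1}`, as a twist. -/
def ddTwist (k : Type*) [Field k] (n i : ℕ) : TwistData k n where
  s j := -x (Equiv.swap i (i + 1) j)
  δ j := if j = i ∨ j = i + 1 then 1 else 0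
  s_C j c := by simp [x_mul_C]
  δ_C j c := by split_ifs <;> simp
  s_s a b h := by
    have : Equiv.swap i (i + 1) a ≠ Equiv.swap i (i + 1) b := by simpa using h
    simp [x_mul_x this]
  s_δ a b h := by
    simp only [Equiv.swap_apply_def]
    split_ifs <;> first | omega | (simp; try abel_nf; try subst_vars; try simp)

/-- Left division by `x_i`, as a twist. -/
def divTwist (k : Type*) [Field k] (n i : ℕ) : TwistData k n where
  -- Sending `x_i` itself to zero is what makes `dq i (x i * f) = f` hold without a correction term.
  s j := if j = i then 0 else -x j
  δ j := if j = i then 1 else 0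
  s_C j c := by split_ifs <;> simp [x_mul_C]
  δ_C j c := by split_ifs <;> simp
  s_s a b h := by split_ifs <;> simp [x_mul_x h]
  s_δ a b h := by split_ifs <;> simp_all

end OddPoly


namespace OddPoly

variable {k : Type*} [Field k] {n : ℕ}

/-! ## Odd divided differences -/

/-- The odd divided difference operator `∂_i`. -/
def dd (i : ℕ) : OddPoly k n →ₗ[k] OddPoly k n := (ddTwist k n i).D

/-- The endomorphism `σ_i` for which `∂_i` is a derivation. -/
def sg (i : ℕ) : OddPoly k n →ₐ[k] OddPoly k n := (ddTwist k n i).σ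

theorem dd_mul (i : ℕ) (f g : OddPoly k n) : dd i (f * g) = dd i f * g + sg i f * dd i g :=
  (ddTwist k n i).D_mul f g

theorem dd_x (i j : ℕ) : dd i (x j : OddPoly k n) = if j = i ∨ j = i + 1 then 1 else 0 :=
  (ddTwist k n i).D_x j

@[simp] theorem dd_C (i : ℕ) (c : A k n) : dd i (C c : OddPoly k n) = 0 := (ddTwist k n i).D_C c

@[simp] theorem dd_one (i : ℕ) : dd i (1 : OddPoly k n) = 0 := (ddTwist k n i).D_one

@[simp] theorem sg_x (i j : ℕ) : sg i (x j : OddPoly k n) = -x (Equiv.swap i (i + 1) j) :=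
  (ddTwist k n i).σ_x j

@[simp] theorem sg_C (i : ℕ) (c : A k n) : sg i (C c : OddPoly k n) = C (A.parity k n c) :=
  (ddTwist k n i).σ_C c

theorem dd_mul_C (i : ℕ) (f : OddPoly k n) (c : A k n) : dd i (f * C c) = dd i f * C c :=
  (ddTwist k n i).D_mul_C f c

theorem dd_C_mul (i : ℕ) (c : A k n) (f : OddPoly k n) :
    dd i (C c * f) = C (A.parity k n c) * dd i f := by simp [dd_mul]

theorem dd_x_mul (i : ℕ) (f : OddPoly k n) : dd i (x i * f) = f - x (i + 1) * dd i f := by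
  simp [dd_mul, dd_x, sub_eq_add_neg]

theorem dd_x_succ_mul (i : ℕ) (f : OddPoly k n) : dd i (x (i + 1) * f) = f - x i * dd i f := by
  simp [dd_mul, dd_x, sub_eq_add_neg]

theorem dd_x_mul_of_ne {i j : ℕ} (h : j ≠ i) (h' : j ≠ i + 1) (f : OddPoly k n) :
    dd i (x j * f) = -(x j * dd i f) := by
  simp [dd_mul, dd_x, h, h', Equiv.swap_apply_of_ne_of_ne]

theorem dd_dd (i : ℕ) (f : OddPoly k n) : dd i (dd i f) = 0 := by
  induction f using induction_left with
  | one => simp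
  | add f g hf hg => simp [hf, hg]
  | C_mul c f hf => simp [dd_C_mul, hf]
  | x_mul j f hf =>
    by_cases h : j = i
    · subst h; simp [dd_x_mul, dd_x_succ_mul, hf]
    by_cases h' : j = i + 1
    · subst h'; simp [dd_x_mul, dd_x_succ_mul, hf]
    simp [dd_x_mul_of_ne h h', hf]

theorem dd_dd_far {i j : ℕ} (h : i + 1 < j) (f : OddPoly k n) :
    dd i (dd j f) = -dd j (dd i f) := by
  induction f using induction_left with
  | one => simp
  | add f g hf hg => simp [hf, hg, add_comm]
  | C_mul c f hf => simp [dd_C_mul, hf]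
  | x_mul l f hf =>
    by_cases h1 : l = i
    · subst h1
      simp [dd_x_mul, dd_x_mul_of_ne (show l ≠ j by omega) (by omega),
        dd_x_mul_of_ne (show l + 1 ≠ j by omega) (by omega), hf]
    by_cases h2 : l = i + 1
    · subst h2
      simp [dd_x_succ_mul, dd_x_mul_of_ne (show i + 1 ≠ j by omega) (by omega),
        dd_x_mul_of_ne (show i ≠ j by omega) (by omega), hf]
    by_cases h3 : l = j
    · subst h3
      simp [dd_x_mul, dd_x_mul_of_ne h1 h2,
        dd_x_mul_of_ne (show l + 1 ≠ i by omega) (by omega), hf]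
    by_cases h4 : l = j + 1
    · subst h4
      simp [dd_x_succ_mul, dd_x_mul_of_ne h1 h2,
        dd_x_mul_of_ne (show j ≠ i by omega) (by omega), hf]
    simp [dd_x_mul_of_ne h1 h2, dd_x_mul_of_ne h3 h4, hf]

theorem dd_braid (i : ℕ) (f : OddPoly k n) :
    dd i (dd (i + 1) (dd i f)) = dd (i + 1) (dd i (dd (i + 1) f)) := by
  induction f using induction_left with
  | one => simp
  | add f g hf hg => simp [hf, hg]
  | C_mul c f hf => simp [dd_C_mul, hf]
  | x_mul l f hf =>
    have e1 : ∀ g : OddPoly k n, dd (i + 1) (x i * g) = -(x i * dd (i + 1) g) :=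
      dd_x_mul_of_ne (by omega) (by omega)
    have e2 : ∀ g : OddPoly k n, dd i (x (i + 1 + 1) * g) = -(x (i + 1 + 1) * dd i g) :=
      dd_x_mul_of_ne (by omega) (by omega)
    by_cases h1 : l = i
    · subst h1
      simp [dd_x_mul, e1, e2, hf, dd_dd]
    by_cases h2 : l = i + 1
    · subst h2
      simp [dd_x_mul, dd_x_succ_mul, e1, e2, hf]
      abel
    by_cases h3 : l = i + 2
    · subst h3
      simp [dd_x_succ_mul, e1, e2, hf, dd_dd]
    simp [dd_x_mul_of_ne h1 h2, dd_x_mul_of_ne h2 h3, hf]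

/-! ## Left division by a variable -/

/-- The operator that divides the terms starting with `x_i` by `x_i` from the left. -/
def dq (i : ℕ) : OddPoly k n →ₗ[k] OddPoly k n := (divTwist k n i).D

/-- The endomorphism for which `dq i` is a derivation. -/
def ep (i : ℕ) : OddPoly k n →ₐ[k] OddPoly k n := (divTwist k n i).σ

/-- The endomorphism that sets `x_i` to zero. -/
def ev (i : ℕ) : OddPoly k n →ₐ[k] OddPoly k n :=
  lift C (fun j => if j = i then 0 else x j) (fun j c => by split_ifs <;> simp [x_mul_C])
    (fun a b h => by split_ifs <;> simp [x_mul_x h])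

/-- The parity involution of odd polynomials. -/
def par : OddPoly k n →ₐ[k] OddPoly k n :=
  lift (C.comp (A.parity k n)) (fun j => -x j) (fun j c => by simp [x_mul_C])
    (fun a b h => by simp [x_mul_x h])

theorem dq_mul (i : ℕ) (f g : OddPoly k n) : dq i (f * g) = dq i f * g + ep i f * dq i g :=
  (divTwist k n i).D_mul f g

theorem dq_x (i j : ℕ) : dq i (x j : OddPoly k n) = if j = i then 1 else 0 :=
  (divTwist k n i).D_x j

@[simp] theorem dq_C (i : ℕ) (c : A k n) : dq i (C c : OddPoly k n) = 0 := (divTwist k n i).D_C c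

@[simp] theorem dq_one (i : ℕ) : dq i (1 : OddPoly k n) = 0 := (divTwist k n i).D_one

theorem ep_x (i j : ℕ) : ep i (x j : OddPoly k n) = if j = i then 0 else -x j :=
  (divTwist k n i).σ_x j

@[simp] theorem ep_C (i : ℕ) (c : A k n) : ep i (C c : OddPoly k n) = C (A.parity k n c) :=
  (divTwist k n i).σ_C c

theorem ev_x (i j : ℕ) : ev i (x j : OddPoly k n) = if j = i then 0 else x j := lift_x _ _ _ _ j

@[simp] theorem ev_C (i : ℕ) (c : A k n) : ev i (C c : OddPoly k n) = C c := lift_C _ _ _ _ c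

@[simp] theorem par_x (j : ℕ) : par (x j : OddPoly k n) = -x j := lift_x _ _ _ _ j

@[simp] theorem par_C (c : A k n) : par (C c : OddPoly k n) = C (A.parity k n c) :=
  lift_C _ _ _ _ c

theorem dq_mul_C (i : ℕ) (f : OddPoly k n) (c : A k n) : dq i (f * C c) = dq i f * C c :=
  (divTwist k n i).D_mul_C f c

theorem dq_C_mul (i : ℕ) (c : A k n) (f : OddPoly k n) :
    dq i (C c * f) = C (A.parity k n c) * dq i f := by simp [dq_mul]

@[simp] theorem dq_x_mul (i : ℕ) (f : OddPoly k n) : dq i (x i * f) = f := by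
  simp [dq_mul, dq_x, ep_x]

theorem dq_x_mul_of_ne {i j : ℕ} (h : j ≠ i) (f : OddPoly k n) :
    dq i (x j * f) = -(x j * dq i f) := by
  simp [dq_mul, dq_x, ep_x, h]

/-- Iterating this splitting expands `f` in powers of `x_i` written on the left, with coefficients
free of `x_i`; thus `dq i ^ L` reads off coefficients and its vanishing bounds the degree in `x_i`.
-/
theorem ev_add_dq (i : ℕ) (f : OddPoly k n) : ev i f + x i * dq i f = f := by
  induction f using induction_left with
  | one => simp
  | add f g hf hg => nth_rw 3 [← hf, ← hg]; simp only [map_add, mul_add]; abel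
  | C_mul c f hf =>
    nth_rw 3 [← hf]
    rw [dq_C_mul, map_mul, ev_C, ← mul_assoc, ← C_mul_x, mul_add, mul_assoc]
  | x_mul j f hf =>
    by_cases h : j = i
    · subst h; simp [ev_x]
    · nth_rw 3 [← hf]
      rw [dq_x_mul_of_ne h, map_mul, ev_x, if_neg h, mul_neg, ← mul_assoc,
        x_mul_x (Ne.symm h), neg_mul, neg_neg, mul_add, mul_assoc]

/-- On polynomials free of `x_i` the twist `ep i` is therefore an involution, which allows the signs
created by moving a coefficient past powers of `x_i` to be undone. -/
theorem ep_ep (i : ℕ) (f : OddPoly k n) : ep i (ep i f) = ev i f := by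
  have : (ep i).comp (ep i) = (ev i : OddPoly k n →ₐ[k] OddPoly k n) := by
    refine algHom_ext' (fun c => ?_) (fun j => ?_)
    · simp [A.parity_parity]
    · by_cases h : j = i <;> simp [ep_x, ev_x, h]
  exact DFunLike.congr_fun this f

theorem dq_ep (i : ℕ) (f : OddPoly k n) : dq i (ep i f) = 0 := by
  induction f using induction with
  | C c => simp
  | x j => by_cases h : j = i <;> simp [ep_x, dq_x, h]
  | add f g hf hg => simp [hf, hg]
  | mul f g hf hg => simp [dq_mul, hf, hg]

theorem eq_ev_of_dq_eq_zero {i : ℕ} {f : OddPoly k n} (h : dq i f = 0) : ev i f = f := by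
  have := ev_add_dq i f
  rwa [h, mul_zero, add_zero] at this

theorem dq_ev (i : ℕ) (f : OddPoly k n) : dq i (ev i f) = 0 := by rw [← ep_ep, dq_ep]

theorem ep_pow_ep_pow {i : ℕ} {f : OddPoly k n} (h : dq i f = 0) (r : ℕ) :
    (ep i ^ r) ((ep i ^ r) f) = f := by
  induction r generalizing f with
  | zero => simp
  | succ r ih =>
    have := congrArg (ep i) (ih (dq_ep i f))
    rw [ep_ep, eq_ev_of_dq_eq_zero h] at this
    nth_rw 1 [pow_succ']
    rwa [pow_succ, AlgHom.mul_apply, AlgHom.mul_apply]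

theorem dq_pow_x_mul_of_ne {i j : ℕ} (h : j ≠ i) (L : ℕ) (f : OddPoly k n) :
    (dq i ^ L) (x j * f) = (-1 : k) ^ L • (x j * (dq i ^ L) f) := by
  induction L with
  | zero => simp
  | succ L ih =>
    rw [pow_succ', Module.End.mul_apply, ih, map_smul, dq_x_mul_of_ne h, pow_succ',
      Module.End.mul_apply, neg_one_mul, neg_smul, smul_neg]

theorem exists_dq_pow_C_mul (i L : ℕ) (c : A k n) (f : OddPoly k n) :
    ∃ c', (dq i ^ L) (C c * f) = C c' * (dq i ^ L) f := by
  induction L with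
  | zero => exact ⟨c, by simp⟩
  | succ L ih =>
    obtain ⟨c', h'⟩ := ih
    exact ⟨A.parity k n c', by
      rw [pow_succ', Module.End.mul_apply, h', dq_C_mul, Module.End.mul_apply]⟩

theorem dq_pow_mul_C (i L : ℕ) (f : OddPoly k n) (c : A k n) :
    (dq i ^ L) (f * C c) = (dq i ^ L) f * C c := by
  induction L with
  | zero => simp
  | succ L ih => rw [pow_succ', Module.End.mul_apply, ih, dq_mul_C, Module.End.mul_apply]

theorem dq_pow_eq_zero_of_le {i L L' : ℕ} (h : L ≤ L') {f : OddPoly k n} (hf : (dq i ^ L) f = 0) :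
    (dq i ^ L') f = 0 := by
  rw [← Nat.sub_add_cancel h, pow_add, Module.End.mul_apply, hf, map_zero]

theorem exists_dq_pow_eq_zero (i : ℕ) (f : OddPoly k n) : ∃ L, (dq i ^ L) f = 0 := by
  induction f using induction_left with
  | one => exact ⟨1, by simp⟩
  | add f g hf hg =>
    obtain ⟨L, hL⟩ := hf
    obtain ⟨L', hL'⟩ := hg
    exact ⟨L + L', by
      rw [map_add, dq_pow_eq_zero_of_le (by omega) hL, dq_pow_eq_zero_of_le (by omega) hL',
        add_zero]⟩
  | C_mul c f hf =>
    obtain ⟨L, hL⟩ := hf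
    obtain ⟨c', h'⟩ := exists_dq_pow_C_mul i L c f
    exact ⟨L, by rw [h', hL, mul_zero]⟩
  | x_mul j f hf =>
    obtain ⟨L, hL⟩ := hf
    by_cases h : j = i
    · subst h; exact ⟨L + 1, by rw [pow_succ, Module.End.mul_apply, dq_x_mul, hL]⟩
    · exact ⟨L, by rw [dq_pow_x_mul_of_ne h, hL, mul_zero, smul_zero]⟩

/-- The coefficient of the highest power of `x_i` in a product. -/
theorem dq_pow_mul {i r : ℕ} {a : OddPoly k n} (ha : (dq i ^ (r + 1)) a = 0) (L : ℕ)
    (p : OddPoly k n) (hp : (dq i ^ (L + 1)) p = 0) :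
    (dq i ^ (L + r)) (p * a) = (ep i ^ r) ((dq i ^ L) p) * (dq i ^ r) a := by
  -- For `u` free of `x_i` the Leibniz rule has only its second term, so dividing `u * b` divides
  -- `b` and twists `u`.
  have hfree : ∀ (u b : OddPoly k n) (t : ℕ), dq i u = 0 →
      (dq i ^ t) (u * b) = (ep i ^ t) u * (dq i ^ t) b := by
    intro u b t
    induction t generalizing u b with
    | zero => intro; simp
    | succ t ih =>
      intro hu
      rw [pow_succ, Module.End.mul_apply, dq_mul, hu, zero_mul, zero_add, ih _ _ (dq_ep i u),
        pow_succ, AlgHom.mul_apply, Module.End.mul_apply]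
  induction L generalizing p with
  | zero =>
    rw [zero_add] at hp ⊢
    rw [pow_one] at hp
    rw [hfree p a r hp, pow_zero, Module.End.one_apply]
  | succ L ih =>
    have h1 : (dq i ^ (L + 1 + r)) (ev i p * a) = 0 := by
      rw [hfree _ _ _ (dq_ev i p), dq_pow_eq_zero_of_le (by omega) ha, mul_zero]
    have h2 : (dq i ^ (L + 1 + r)) (x i * dq i p * a) = (dq i ^ (L + r)) (dq i p * a) := by
      rw [show L + 1 + r = L + r + 1 by ring, pow_succ, Module.End.mul_apply, mul_assoc, dq_x_mul]
    nth_rw 1 [← ev_add_dq i p]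
    rw [add_mul, map_add, h1, h2, zero_add, ih _ (by rwa [pow_succ, Module.End.mul_apply] at hp),
      pow_succ _ L, Module.End.mul_apply]

end OddPoly


/-! ## The deformation parameters `c_i` -/

theorem A.mk_eq_zero_of_mem {k : Type*} [Field k] {n : ℕ} {y : MvPolynomial (CoeffGen n) k}
    (h : y ∈ coeffIdeal k n) : A.mk k n y = 0 := Ideal.Quotient.eq_zero_iff_mem.2 h

theorem A.d_mul_d (k : Type*) [Field k] (n : ℕ) : A.d k n * A.d k n = 0 := by
  have := A.mk_eq_zero_of_mem (k := k) (n := n) (Ideal.subset_span (Or.inl rfl))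
  rwa [pow_two, map_mul] at this

theorem A.d_mul_chi_half (k : Type*) [Field k] {n : ℕ} (h : Even n) :
    A.d k n * A.chi k n (n / 2) = 0 := by
  have := A.mk_eq_zero_of_mem (k := k) (n := n) (Ideal.subset_span (Or.inr ⟨h, rfl⟩))
  rwa [map_mul] at this

@[simp] theorem A.parity_d (k : Type*) [Field k] (n : ℕ) : A.parity k n (A.d k n) = -A.d k n := by
  rw [A.d, A.parity_mk, polyParity_polyD, map_neg]

@[simp] theorem A.parity_chi (k : Type*) [Field k] (n j : ℕ) :
    A.parity k n (A.chi k n j) = A.chi k n j := by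
  rw [A.chi, A.parity_mk, polyParity_polyChi]

theorem A.parity_c (k : Type*) [Field k] (n i : ℕ) :
    A.parity k n (A.c k n i) = (-1 : k) ^ i • A.c k n i := by
  unfold A.c
  split_ifs with h
  · simp [h.neg_one_pow]
  · simp [(Nat.not_even_iff_odd.1 h).neg_one_pow]

theorem A.c_zero (k : Type*) [Field k] (n : ℕ) : A.c k n 0 = 1 := by
  simp [A.c, A.chi, polyChi]

theorem A.d_mul_c_of_odd (k : Type*) [Field k] (n : ℕ) {i : ℕ} (h : ¬Even i) :
    A.d k n * A.c k n i = 0 := by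
  rw [A.c, if_neg h, ← mul_assoc, A.d_mul_d, zero_mul]

theorem A.d_mul_c_of_even (k : Type*) [Field k] (n : ℕ) {i : ℕ} (h : Even i) :
    A.d k n * A.c k n i = A.c k n (i + 1) := by
  rw [A.c, if_pos h, A.c, if_neg (by rwa [Nat.even_add_one, not_not]), Nat.add_sub_cancel]

/-- For odd `n` the factor `d` already occurs in `c_n`; for even `n` this is the relation `d χ_{n/2}
= 0`. It removes the constant term of `d a^n(x_1)` in `cyc_mul_x_one`. -/
theorem A.d_mul_c_self (k : Type*) [Field k] (n : ℕ) : A.d k n * A.c k n n = 0 := by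
  by_cases h : Even n
  · rw [A.c, if_pos h, A.d_mul_chi_half k h]
  · exact A.d_mul_c_of_odd k n h

theorem A.induction {k : Type*} [Field k] {n : ℕ} {p : A k n → Prop}
    (scalar : ∀ r, p (algebraMap k (A k n) r)) (d : p (A.d k n)) (chi : ∀ j, p (A.chi k n j))
    (add : ∀ a b, p a → p b → p (a + b)) (mul : ∀ a b, p a → p b → p (a * b)) (c : A k n) :
    p c := by
  obtain ⟨y, rfl⟩ := Ideal.Quotient.mk_surjective c
  change p (A.mk k n y)
  have hX : ∀ g, p (A.mk k n (MvPolynomial.X g)) := by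
    rintro (_ | ⟨j, h⟩)
    · exact d
    · have := chi j
      rwa [A.chi, polyChi, if_neg (by omega), dif_pos h] at this
  induction y using MvPolynomial.induction_on with
  | C r => exact scalar r
  | add a b ha hb => rw [map_add]; exact add _ _ ha hb
  | mul_X a g ha => rw [map_mul]; exact mul _ _ ha (hX g)

/-! ### The cyclotomic polynomial `a^n(x_1)` and two-sidedness of its left ideal -/

namespace OddPoly

variable {k : Type*} [Field k] {n : ℕ}

theorem C_mul_x_pow (j l : ℕ) (c : A k n) {e : k} (hc : A.parity k n c = e • c) :
    C c * (x j : OddPoly k n) ^ l = e ^ l • (x j ^ l * C c) := by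
  induction l with
  | zero => simp
  | succ l ih =>
    rw [pow_succ, ← mul_assoc, ih, smul_mul_assoc, mul_assoc, C_mul_x, hc, map_smul, mul_smul_comm,
      mul_smul_comm, smul_smul, mul_assoc, pow_succ]

theorem x_mul_x_pow {i j : ℕ} (h : i ≠ j) (l : ℕ) :
    (x i : OddPoly k n) * x j ^ l = (-1 : k) ^ l • (x j ^ l * x i) := by
  induction l with
  | zero => simp
  | succ l ih =>
    rw [pow_succ, ← mul_assoc, ih, smul_mul_assoc, mul_assoc, x_mul_x h, pow_succ, mul_neg,
      mul_neg_one, neg_smul, smul_neg, mul_assoc]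

/-- The generator `a^n(x_1)` of the cyclotomic ideal, as an odd polynomial. -/
def cyc (k : Type*) [Field k] (n : ℕ) : OddPoly k n :=
  ∑ l ∈ Finset.range (n + 1), (-1 : k) ^ l • (x 1 ^ l * C (A.c k n (n - l)))

theorem neg_one_pow_eq_mul {l : ℕ} (h : l ≤ n) : (-1 : k) ^ n = (-1) ^ l * (-1) ^ (n - l) := by
  rw [← pow_add]; congr 1; omega

theorem neg_one_pow_mul_self (l : ℕ) : (-1 : k) ^ l * (-1) ^ l = 1 := by
  rw [← mul_pow]; simp

theorem neg_x_pow (j l : ℕ) : (-x j : OddPoly k n) ^ l = (-1 : k) ^ l • x j ^ l := by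
  rw [← smul_pow, neg_one_smul]

theorem par_cyc : par (cyc k n) = (-1 : k) ^ n • cyc k n := by
  rw [cyc, map_sum, Finset.smul_sum]
  refine Finset.sum_congr rfl fun l hl => ?_
  have hl : l ≤ n := by simpa [Nat.lt_succ_iff] using hl
  rw [map_smul, map_mul, map_pow, par_C, A.parity_c, par_x, neg_x_pow, map_smul,
    neg_one_pow_eq_mul hl]
  simp only [smul_smul, smul_mul_assoc, mul_smul_comm]
  congr 1
  ring

theorem x_mul_cyc_of_ne {j : ℕ} (h : j ≠ 1) :
    x j * cyc k n = (-1 : k) ^ n • (cyc k n * x j) := by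
  rw [cyc, Finset.mul_sum, Finset.sum_mul, Finset.smul_sum]
  refine Finset.sum_congr rfl fun l hl => ?_
  have hl : l ≤ n := by simpa [Nat.lt_succ_iff] using hl
  rw [mul_smul_comm, ← mul_assoc, x_mul_x_pow h, smul_mul_assoc, mul_assoc, x_mul_C, A.parity_c,
    neg_one_pow_eq_mul hl, map_smul]
  simp only [smul_smul, smul_mul_assoc, mul_smul_comm, mul_assoc]
  congr 1
  ring

theorem C_d_mul_cyc_eq_sum : C (A.d k n) * cyc k n =
    ∑ l ∈ Finset.range (n + 1), x 1 ^ l * C (A.d k n * A.c k n (n - l)) := by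
  rw [cyc, Finset.mul_sum]
  refine Finset.sum_congr rfl fun l hl => ?_
  rw [mul_smul_comm, ← mul_assoc, C_mul_x_pow (e := -1) 1 l (A.d k n) (by simp), smul_mul_assoc,
    smul_smul, neg_one_pow_mul_self, one_smul, mul_assoc, map_mul]

theorem cyc_mul_C_d : cyc k n * C (A.d k n) = (-1 : k) ^ n • (C (A.d k n) * cyc k n) := by
  rw [C_d_mul_cyc_eq_sum, cyc, Finset.sum_mul, Finset.smul_sum]
  refine Finset.sum_congr rfl fun l hl => ?_
  have hl : l ≤ n := by simpa [Nat.lt_succ_iff] using hl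
  rw [smul_mul_assoc, mul_assoc, ← map_mul, mul_comm (A.c k n _)]
  by_cases h : Even (n - l)
  · rw [neg_one_pow_eq_mul hl, h.neg_one_pow, mul_one]
  · rw [A.d_mul_c_of_odd k n h]; simp

theorem cyc_mul_C_chi (j : ℕ) : cyc k n * C (A.chi k n j) = C (A.chi k n j) * cyc k n := by
  rw [cyc, Finset.sum_mul, Finset.mul_sum]
  refine Finset.sum_congr rfl fun l _ => ?_
  rw [smul_mul_assoc, mul_smul_comm, ← mul_assoc, C_mul_x_pow (e := 1) 1 l _ (by simp), one_pow,
    one_smul, mul_assoc, mul_assoc, ← map_mul, ← map_mul, mul_comm]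

/-- Moving `x_1` left past `c_{n-l}` costs `(-1)^(n-l)`, so `cyc * x 1` and `x 1 * cyc` differ only
in the terms with `n - l` odd. There `c_{n-l} = d c_{n-l-1}`, and the surplus `2 (-1)^n x_1^{l+1} d
c_{n-(l+1)}` is the term of degree `l + 1` of `2 (-1)^n d a^n(x_1)`. The other terms of that product
vanish: `d² = 0` in the intermediate degrees, `d c_n = 0` in degree zero. -/
theorem cyc_mul_x_one :
    cyc k n * x 1 = (x 1 + (2 * (-1) ^ n : k) • C (A.d k n)) * cyc k n := by
  rw [add_mul, smul_mul_assoc, C_d_mul_cyc_eq_sum, Finset.sum_range_succ', cyc, Finset.sum_mul,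
    Finset.mul_sum, Finset.sum_range_succ, Finset.sum_range_succ, Nat.sub_zero, A.d_mul_c_self,
    map_zero, mul_zero, add_zero, Finset.smul_sum, add_right_comm, ← Finset.sum_add_distrib,
    Nat.sub_self, A.c_zero, map_one, mul_one, smul_mul_assoc, mul_smul_comm, ← pow_succ,
    ← pow_succ']
  congr 1
  refine Finset.sum_congr rfl fun l hl => ?_
  have hl : l < n := by simpa using hl
  rw [smul_mul_assoc, mul_assoc, C_mul_x, A.parity_c, map_smul, mul_smul_comm, mul_smul_comm,
    smul_smul, ← neg_one_pow_eq_mul hl.le, mul_smul_comm, ← mul_assoc, ← mul_assoc, ← pow_succ,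
    ← pow_succ']
  by_cases h : Even (n - l)
  · rw [A.d_mul_c_of_odd k n (i := n - (l + 1)), neg_one_pow_eq_mul hl.le, h.neg_one_pow]
    · simp
    · intro h'
      rw [show n - l = n - (l + 1) + 1 by omega, Nat.even_add_one] at h
      exact h h'
  · have h' : Even (n - (l + 1)) := by
      by_contra h'
      rw [← Nat.even_add_one, show n - (l + 1) + 1 = n - l by omega] at h'
      exact h h'
    rw [A.d_mul_c_of_even k n h', show n - (l + 1) + 1 = n - l by omega, ← add_smul,
      neg_one_pow_eq_mul hl.le, (Nat.not_even_iff_odd.1 h).neg_one_pow]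
    congr 1
    ring

/-- The left ideal generated by `a^n(x_1)` is two-sided. -/
theorem exists_cyc_mul (f : OddPoly k n) : ∃ g, cyc k n * f = g * cyc k n := by
  have hmul : ∀ f g : OddPoly k n, (∃ g, cyc k n * f = g * cyc k n) →
      (∃ g', cyc k n * g = g' * cyc k n) → ∃ g', cyc k n * (f * g) = g' * cyc k n := by
    rintro f g ⟨f', hf⟩ ⟨g', hg⟩
    exact ⟨f' * g', by rw [← mul_assoc, hf, mul_assoc, hg, mul_assoc]⟩
  have hadd : ∀ f g : OddPoly k n, (∃ g, cyc k n * f = g * cyc k n) →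
      (∃ g', cyc k n * g = g' * cyc k n) → ∃ g', cyc k n * (f + g) = g' * cyc k n := by
    rintro f g ⟨f', hf⟩ ⟨g', hg⟩
    exact ⟨f' + g', by rw [mul_add, hf, hg, add_mul]⟩
  induction f using induction with
  | C c =>
    induction c using A.induction with
    | scalar r => exact ⟨algebraMap k _ r, by rw [AlgHom.commutes, Algebra.commutes]⟩
    | d => exact ⟨_, by rw [cyc_mul_C_d, ← smul_mul_assoc]⟩
    | chi j => exact ⟨_, cyc_mul_C_chi j⟩
    | add a b ha hb => rw [map_add]; exact hadd _ _ ha hb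
    | mul a b ha hb => rw [map_mul]; exact hmul _ _ ha hb
  | x j =>
    by_cases h : j = 1
    · subst h; exact ⟨_, cyc_mul_x_one⟩
    · exact ⟨(-1 : k) ^ n • x j, by
        rw [smul_mul_assoc, x_mul_cyc_of_ne h, smul_smul, neg_one_pow_mul_self, one_smul]⟩
  | add f g hf hg => exact hadd f g hf hg
  | mul f g hf hg => exact hmul f g hf hg

end OddPoly


/-! ### Polynomials in finitely many variables -/

namespace OddPoly

variable {k : Type*} [Field k] {n : ℕ}

/-- The odd polynomials in `x_1, …, x_i`. -/
def vars (k : Type*) [Field k] (n i : ℕ) : Subalgebra k (OddPoly k n) :=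
  Algebra.adjoin k (Set.range C ∪ {y | ∃ j, 1 ≤ j ∧ j ≤ i ∧ y = x j})

theorem C_mem_vars (i : ℕ) (c : A k n) : C c ∈ vars k n i :=
  Algebra.subset_adjoin (Or.inl ⟨c, rfl⟩)

theorem x_mem_vars {i j : ℕ} (h : 1 ≤ j) (h' : j ≤ i) : x j ∈ vars k n i :=
  Algebra.subset_adjoin (Or.inr ⟨j, h, h', rfl⟩)

theorem vars_mono {i j : ℕ} (h : i ≤ j) : vars k n i ≤ vars k n j :=
  Algebra.adjoin_mono (Set.union_subset_union le_rfl
    (by rintro _ ⟨l, h1, h2, rfl⟩; exact ⟨l, h1, h2.trans h, rfl⟩))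

@[elab_as_elim]
theorem vars_induction {i : ℕ} {p : (f : OddPoly k n) → f ∈ vars k n i → Prop}
    (C : ∀ c, p (C c) (C_mem_vars i c))
    (x : ∀ j (h : 1 ≤ j) (h' : j ≤ i), p (x j) (x_mem_vars h h'))
    (add : ∀ f g hf hg, p f hf → p g hg → p (f + g) (add_mem hf hg))
    (mul : ∀ f g hf hg, p f hf → p g hg → p (f * g) (mul_mem hf hg))
    {f : OddPoly k n} (hf : f ∈ vars k n i) : p f hf := by
  induction hf using Algebra.adjoin_induction with
  | mem y hy =>
    rcases hy with ⟨c, rfl⟩ | ⟨j, h, h', rfl⟩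
    · exact C c
    · exact x j h h'
  | algebraMap r =>
    have key : ∀ (y : OddPoly k n) (hy : y ∈ vars k n i),
        y = OddPoly.C (algebraMap k _ r) → p y hy := by
      rintro _ _ rfl
      exact C _
    exact key _ _ (AlgHom.commutes _ r).symm
  | add f g hf hg hpf hpg => exact add f g hf hg hpf hpg
  | mul f g hf hg hpf hpg => exact mul f g hf hg hpf hpg

theorem algHom_mem_vars {F : OddPoly k n →ₐ[k] OddPoly k n} {i i' : ℕ}
    (hC : ∀ c, F (C c) ∈ vars k n i') (hx : ∀ j, 1 ≤ j → j ≤ i → F (x j) ∈ vars k n i')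
    {f : OddPoly k n} (hf : f ∈ vars k n i) : F f ∈ vars k n i' := by
  induction hf using vars_induction with
  | C c => exact hC c
  | x j h h' => exact hx j h h'
  | add f g _ _ hf hg => rw [map_add]; exact add_mem hf hg
  | mul f g _ _ hf hg => rw [map_mul]; exact mul_mem hf hg

theorem sg_mem_vars {i j : ℕ} (hi : 1 ≤ i) (hij : i < j) {f : OddPoly k n}
    (hf : f ∈ vars k n j) : sg i f ∈ vars k n j :=
  algHom_mem_vars (fun c => by rw [sg_C]; exact C_mem_vars _ _) (fun l h h' => by
    rw [sg_x, Equiv.swap_apply_def]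
    refine neg_mem (x_mem_vars ?_ ?_) <;> split_ifs <;> omega) hf

theorem dd_mem_vars {i j : ℕ} (hi : 1 ≤ i) (hij : i < j) {f : OddPoly k n}
    (hf : f ∈ vars k n j) : dd i f ∈ vars k n j := by
  induction hf using vars_induction with
  | C c => simp
  | x l h h' => rw [dd_x]; split_ifs <;> simp [one_mem]
  | add f g _ _ hf hg => rw [map_add]; exact add_mem hf hg
  | mul f g h h' hf hg =>
    rw [dd_mul]; exact add_mem (mul_mem hf h') (mul_mem (sg_mem_vars hi hij h) hg)

theorem dd_eq_zero_of_mem_vars {i j : ℕ} (hij : i < j) {f : OddPoly k n}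
    (hf : f ∈ vars k n i) : dd j f = 0 := by
  induction hf using vars_induction with
  | C c => simp
  | x l h h' => rw [dd_x, if_neg (by omega)]
  | add f g _ _ hf hg => rw [map_add, hf, hg, add_zero]
  | mul f g h h' hf hg => rw [dd_mul, hf, hg, zero_mul, mul_zero, add_zero]

theorem dq_eq_zero_of_mem_vars {i j : ℕ} (hij : i < j) {f : OddPoly k n}
    (hf : f ∈ vars k n i) : dq j f = 0 := by
  induction hf using vars_induction with
  | C c => simp
  | x l h h' => rw [dq_x, if_neg (by omega)]
  | add f g _ _ hf hg => rw [map_add, hf, hg, add_zero]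
  | mul f g h h' hf hg => rw [dq_mul, hf, hg, zero_mul, mul_zero, add_zero]

theorem ep_mem_vars {i j : ℕ} {f : OddPoly k n} (hf : f ∈ vars k n j) : ep i f ∈ vars k n j :=
  algHom_mem_vars (fun c => by rw [ep_C]; exact C_mem_vars _ _) (fun l h h' => by
    rw [ep_x]
    split_ifs
    · exact zero_mem _
    · exact neg_mem (x_mem_vars h h')) hf

theorem ep_pow_mem_vars {i j : ℕ} (r : ℕ) {f : OddPoly k n} (hf : f ∈ vars k n j) :
    (ep i ^ r) f ∈ vars k n j := by
  induction r with
  | zero => simpa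
  | succ r ih => rw [pow_succ', AlgHom.mul_apply]; exact ep_mem_vars ih

theorem dq_mem_vars {i j : ℕ} {f : OddPoly k n} (hf : f ∈ vars k n j) : dq i f ∈ vars k n j := by
  induction hf using vars_induction with
  | C c => simp
  | x l h h' => rw [dq_x]; split_ifs <;> simp [one_mem]
  | add f g _ _ hf hg => rw [map_add]; exact add_mem hf hg
  | mul f g h h' hf hg =>
    rw [dq_mul]; exact add_mem (mul_mem hf h') (mul_mem (ep_mem_vars h) hg)

theorem dq_pow_mem_vars {i j : ℕ} (r : ℕ) {f : OddPoly k n} (hf : f ∈ vars k n j) :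
    (dq i ^ r) f ∈ vars k n j := by
  induction r with
  | zero => simpa
  | succ r ih => rw [pow_succ', Module.End.mul_apply]; exact dq_mem_vars ih

theorem ev_mem_vars {i : ℕ} {f : OddPoly k n} (hf : f ∈ vars k n (i + 1)) :
    ev (i + 1) f ∈ vars k n i :=
  algHom_mem_vars (fun c => by rw [ev_C]; exact C_mem_vars _ _) (fun l h h' => by
    rw [ev_x]
    split_ifs with h
    · exact zero_mem _
    · exact x_mem_vars (by omega) (by omega)) hf

theorem ep_eq_par {i j : ℕ} (hij : i < j) {f : OddPoly k n} (hf : f ∈ vars k n i) :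
    ep j f = par f := by
  induction hf using vars_induction with
  | C c => simp
  | x l h h' => rw [ep_x, if_neg (by omega), par_x]
  | add f g _ _ hf hg => rw [map_add, hf, hg, map_add]
  | mul f g h h' hf hg => rw [map_mul, hf, hg, map_mul]

theorem par_dd (i : ℕ) (f : OddPoly k n) : par (dd i f) = -dd i (par f) := by
  induction f using induction_left with
  | one => simp
  | add f g hf hg => simp [hf, hg, add_comm]
  | C_mul c f hf => simp [dd_C_mul, hf]
  | x_mul j f hf =>
    by_cases h : j = i
    · subst h; simp [dd_x_mul, hf]
    by_cases h' : j = i + 1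
    · subst h'; simp [dd_x_succ_mul, hf]
    simp [dd_x_mul_of_ne h h', hf]

/-- Write `f = g + x_i h` with `h = dq i f` and `g` in the variables before `x_i`. Then `∂_i g = 0`
and `∂_i(x_i h) = h - x_{i+1} ∂_i h`, where `h` is free of `x_{i+1}`. This carries information on
the degree of `a_i` in `x_i` over to the degree of `a_{i+1}` in `x_{i+1}`. -/
theorem dq_succ_dd {i : ℕ} (hi : 1 ≤ i) {f : OddPoly k n} (hf : f ∈ vars k n i) :
    dq (i + 1) (dd i f) = -dd i (dq i f) := by
  obtain ⟨i, rfl⟩ := Nat.exists_eq_add_of_le' hi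
  nth_rw 1 [← ev_add_dq (i + 1) f]
  rw [map_add, dd_eq_zero_of_mem_vars (Nat.lt_succ_self i) (ev_mem_vars hf), zero_add, dd_x_mul,
    map_sub, dq_eq_zero_of_mem_vars (Nat.lt_succ_self _) (dq_mem_vars hf), zero_sub, dq_x_mul]

theorem dq_succ_pow_dd {i : ℕ} (hi : 1 ≤ i) (t : ℕ) {f : OddPoly k n} (hf : f ∈ vars k n i) :
    (dq (i + 1) ^ t) (dd i f) = (-1 : k) ^ t • dd i ((dq i ^ t) f) := by
  induction t with
  | zero => simp
  | succ t ih =>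
    rw [pow_succ' (dq (i + 1)), Module.End.mul_apply, ih, map_smul, dq_succ_dd hi (dq_pow_mem_vars t hf),
      pow_succ' (dq i), Module.End.mul_apply, pow_succ', neg_one_mul, neg_smul, smul_neg]

/-! ## The ideals of relations of the odd partial flag variety -/

/-- The odd polynomials `a_1 = a^n(x_1)` and `a_{j+1} = ∂_j a_j`, with `flag n j = a_{j+1}`. -/
def flag (k : Type*) [Field k] (n : ℕ) : ℕ → OddPoly k n
  | 0 => cyc k n
  | j + 1 => dd (j + 1) (flag k n j)

theorem flag_mem_vars (j : ℕ) : flag k n j ∈ vars k n (j + 1) := by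
  induction j with
  | zero =>
    rw [flag, cyc]
    exact Subalgebra.sum_mem _ fun l _ => Subalgebra.smul_mem _
      (mul_mem (pow_mem (x_mem_vars le_rfl le_rfl) l) (C_mem_vars _ _)) _
  | succ j ih => exact dd_mem_vars (by omega) (by omega) (vars_mono (by omega) ih)

/-- Only one divided difference acts nontrivially on `a_{j+1}`, the one defining its successor. For
larger `i` the variables do not occur; for smaller `i` one uses `∂_i² = 0`, the braid relation or
anticommutation to reach an earlier `a`. -/
theorem dd_flag {i j : ℕ} (hi : 1 ≤ i) (hij : i ≠ j + 1) : dd i (flag k n j) = 0 := by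
  induction j using Nat.strong_induction_on generalizing i with
  | _ j ih =>
    rcases lt_or_gt_of_ne hij with h | h
    · obtain ⟨j, rfl⟩ : ∃ j', j = j' + 1 := ⟨j - 1, by omega⟩
      rw [flag]
      by_cases h1 : i = j + 1
      · subst h1; exact dd_dd _ _
      by_cases h2 : i = j
      · subst h2
        obtain ⟨i, rfl⟩ : ∃ i', i = i' + 1 := ⟨i - 1, by omega⟩
        rw [flag, dd_braid, ih i (by omega) (by omega) (by omega), map_zero, map_zero]
      · rw [dd_dd_far (by omega), ih j (by omega) hi (by omega), map_zero, neg_zero]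
    · exact dd_eq_zero_of_mem_vars h (flag_mem_vars j)

theorem par_flag (j : ℕ) : ∃ t : ℕ, par (flag k n j) = (-1 : k) ^ t • flag k n j := by
  induction j with
  | zero => exact ⟨n, par_cyc⟩
  | succ j ih =>
    obtain ⟨t, h⟩ := ih
    exact ⟨t + 1, by rw [flag, par_dd, h, map_smul, pow_succ, mul_neg_one, neg_smul]⟩

theorem dq_pow_cyc (t : ℕ) (ht : t ≤ n) : (dq 1 ^ t) (cyc k n) = (-1 : k) ^ t •
    ∑ l ∈ Finset.range (n - t + 1), (-1 : k) ^ l • (x 1 ^ l * C (A.c k n (n - t - l))) := by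
  induction t with
  | zero => simp [cyc]
  | succ t ih =>
    rw [pow_succ', Module.End.mul_apply, ih (by omega), map_smul, Finset.sum_range_succ',
      map_add, map_sum, pow_zero, pow_zero, one_mul, one_smul, dq_C, add_zero, pow_succ, mul_smul,
      Finset.smul_sum (s := Finset.range (n - (t + 1) + 1)),
      show n - t = n - (t + 1) + 1 by omega]
    congr 1
    refine Finset.sum_congr rfl fun l _ => ?_
    rw [map_smul, pow_succ' (x 1), mul_assoc, dq_x_mul, pow_succ, smul_smul, mul_comm,
      show n - (t + 1) + 1 - (l + 1) = n - (t + 1) - l by omega]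

/-- The polynomial `a_{j+1}` has degree `n - j` in `x_{j+1}`, with highest coefficient `± 1`. -/
theorem dq_pow_flag (j : ℕ) (hj : j ≤ n) :
    ∃ t : ℕ, (dq (j + 1) ^ (n - j)) (flag k n j) = (-1 : k) ^ t • 1 := by
  induction j with
  | zero => exact ⟨n, by rw [flag]; simp [dq_pow_cyc n le_rfl, A.c_zero]⟩
  | succ j ih =>
    obtain ⟨t, h⟩ := ih (by omega)
    rw [show n - j = n - (j + 1) + 1 by omega, pow_succ', Module.End.mul_apply] at h
    rw [flag, dq_succ_pow_dd (by omega) _ (flag_mem_vars j)]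
    set u := (dq (j + 1) ^ (n - (j + 1))) (flag k n j) with hu
    have hu' : u ∈ vars k n (j + 1) := dq_pow_mem_vars _ (flag_mem_vars j)
    refine ⟨n - (j + 1) + t, ?_⟩
    -- Here `u` has degree one in `x_{j+1}` with leading coefficient `±1`; `∂_{j+1}` kills its part
    -- free of `x_{j+1}` and sends `x_{j+1}` to `1`.
    rw [← ev_add_dq (j + 1) u, map_add,
      dd_eq_zero_of_mem_vars (Nat.lt_succ_self j) (ev_mem_vars hu'), zero_add, h, mul_smul_comm,
      mul_one, map_smul, dd_x, if_pos (Or.inl rfl), smul_smul, pow_add]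

theorem dq_pow_succ_flag (j : ℕ) (hj : j ≤ n) :
    (dq (j + 1) ^ (n - j + 1)) (flag k n j) = 0 := by
  obtain ⟨t, h⟩ := dq_pow_flag (k := k) j hj
  rw [pow_succ', Module.End.mul_apply, h, map_smul, dq_one, smul_zero]

/-- The left ideal generated by `a_1, …, a_m`. -/
def flagIdeal (k : Type*) [Field k] (n m : ℕ) : Submodule (OddPoly k n) (OddPoly k n) :=
  Submodule.span _ (flag k n '' Set.Iio m)

theorem flag_mem_flagIdeal {j m : ℕ} (h : j < m) : flag k n j ∈ flagIdeal k n m :=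
  Submodule.subset_span ⟨j, h, rfl⟩

theorem flagIdeal_mul_mem {m : ℕ} (p : OddPoly k n) {f : OddPoly k n} (h : f ∈ flagIdeal k n m) :
    p * f ∈ flagIdeal k n m := Submodule.smul_mem _ p h

theorem flagIdeal_smul_mem {m : ℕ} (r : k) {f : OddPoly k n} (h : f ∈ flagIdeal k n m) :
    r • f ∈ flagIdeal k n m := by
  rw [Algebra.smul_def]; exact flagIdeal_mul_mem _ h

@[elab_as_elim]
theorem flagIdeal_induction {m : ℕ} {p : (f : OddPoly k n) → f ∈ flagIdeal k n m → Prop}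
    (zero : p 0 (zero_mem _)) (add : ∀ f g hf hg, p f hf → p g hg → p (f + g) (add_mem hf hg))
    (gen : ∀ q j (hj : j < m), p (q * flag k n j) (flagIdeal_mul_mem q (flag_mem_flagIdeal hj)))
    {f : OddPoly k n} (hf : f ∈ flagIdeal k n m) : p f hf := by
  induction hf using Submodule.closure_induction with
  | zero => exact zero
  | add f g h h' hf hg => exact add f g h h' hf hg
  | smul_mem q f hf => obtain ⟨j, hj, rfl⟩ := hf; exact gen q j hj

/-- By the Leibniz rule only `∂_i a_{j+1}` matters; it is zero or the next generator, which is still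
among the first `m` because `i < m`. -/
theorem dd_mem_flagIdeal {i m : ℕ} (hi : 1 ≤ i) (him : i < m) {f : OddPoly k n}
    (hf : f ∈ flagIdeal k n m) : dd i f ∈ flagIdeal k n m := by
  induction hf using flagIdeal_induction with
  | zero => simp
  | add f g _ _ hf hg => rw [map_add]; exact add_mem hf hg
  | gen q j hj =>
    rw [dd_mul]
    refine add_mem (flagIdeal_mul_mem _ (flag_mem_flagIdeal hj)) (flagIdeal_mul_mem _ ?_)
    by_cases h : i = j + 1
    · subst h; exact flag_mem_flagIdeal (j := j + 1) him
    · rw [dd_flag hi h]; exact zero_mem _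

/-- This is where two-sidedness of the ideal of `a_1` enters: it makes the cyclotomic relation act
by zero on the quotient by `flagIdeal`. -/
theorem cyc_mul_mem_flagIdeal {m : ℕ} (hm : 1 ≤ m) (f : OddPoly k n) :
    cyc k n * f ∈ flagIdeal k n m := by
  obtain ⟨g, hg⟩ := exists_cyc_mul f
  rw [hg]
  exact flagIdeal_mul_mem _ (flag_mem_flagIdeal (j := 0) hm)

/-- Starting from `a_1 g`, which lies in the ideal by two-sidedness, apply `∂_1, ∂_2, …`; as they
all kill `g`, each turns `a_j g` into `a_{j+1} g`. -/
theorem flag_mul_mem_flagIdeal {m : ℕ} {g : OddPoly k n} (hg : ∀ i, 1 ≤ i → i < m → dd i g = 0)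
    (j : ℕ) (hj : j < m) : flag k n j * g ∈ flagIdeal k n m := by
  induction j with
  | zero => exact cyc_mul_mem_flagIdeal hj g
  | succ j ih =>
    have := dd_mem_flagIdeal (i := j + 1) (by omega) hj (ih (by omega))
    rwa [dd_mul, hg _ (by omega) hj, mul_zero, add_zero] at this

/-- `flagIdeal` is only given as a left ideal; stability under right multiplication by the next
generator is what cancelling leading terms requires. -/
theorem mul_flag_mem_flagIdeal {m : ℕ} {f : OddPoly k n} (hf : f ∈ flagIdeal k n m) :
    f * flag k n m ∈ flagIdeal k n m := by
  induction hf using flagIdeal_induction with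
  | zero => simp
  | add f g _ _ hf hg => rw [add_mul]; exact add_mem hf hg
  | gen q j hj =>
    rw [mul_assoc]
    exact flagIdeal_mul_mem _
      (flag_mul_mem_flagIdeal (fun i hi him => dd_flag hi (by omega)) j hj)

theorem dq_mem_flagIdeal {m : ℕ} {f : OddPoly k n} (hf : f ∈ flagIdeal k n m) :
    dq (m + 1) f ∈ flagIdeal k n m := by
  induction hf using flagIdeal_induction with
  | zero => simp
  | add f g _ _ hf hg => rw [map_add]; exact add_mem hf hg
  | gen q j hj =>
    rw [dq_mul, dq_eq_zero_of_mem_vars (show j + 1 < m + 1 by omega) (flag_mem_vars j), mul_zero,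
      add_zero]
    exact flagIdeal_mul_mem _ (flag_mem_flagIdeal hj)

theorem dq_pow_mem_flagIdeal {m : ℕ} (r : ℕ) {f : OddPoly k n} (hf : f ∈ flagIdeal k n m) :
    (dq (m + 1) ^ r) f ∈ flagIdeal k n m := by
  induction r with
  | zero => simpa
  | succ r ih => rw [pow_succ', Module.End.mul_apply]; exact dq_mem_flagIdeal ih

theorem ep_mem_flagIdeal {m : ℕ} {f : OddPoly k n} (hf : f ∈ flagIdeal k n m) :
    ep (m + 1) f ∈ flagIdeal k n m := by
  induction hf using flagIdeal_induction with
  | zero => simp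
  | add f g _ _ hf hg => rw [map_add]; exact add_mem hf hg
  | gen q j hj =>
    obtain ⟨t, ht⟩ := par_flag (k := k) (n := n) j
    rw [map_mul, ep_eq_par (show j + 1 < m + 1 by omega) (flag_mem_vars j), ht, mul_smul_comm]
    exact flagIdeal_smul_mem _ (flagIdeal_mul_mem _ (flag_mem_flagIdeal hj))

theorem ep_pow_mem_flagIdeal {m : ℕ} (r : ℕ) {f : OddPoly k n} (hf : f ∈ flagIdeal k n m) :
    (ep (m + 1) ^ r) f ∈ flagIdeal k n m := by
  induction r with
  | zero => simpa
  | succ r ih => rw [pow_succ', AlgHom.mul_apply]; exact ep_mem_flagIdeal ih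

theorem mem_flagIdeal_of_smul {m t : ℕ} {f : OddPoly k n}
    (hf : (-1 : k) ^ t • f ∈ flagIdeal k n m) : f ∈ flagIdeal k n m := by
  have := flagIdeal_smul_mem ((-1 : k) ^ t) hf
  rwa [smul_smul, neg_one_pow_mul_self, one_smul] at this

theorem dq_pow_x_pow_mul (i L : ℕ) (f : OddPoly k n) : (dq i ^ L) (x i ^ L * f) = f := by
  induction L with
  | zero => simp
  | succ L ih => rw [pow_succ, Module.End.mul_apply, pow_succ', mul_assoc, dq_x_mul, ih]

/-- An element of the flag ideal of low degree in the last variable lies in the previous ideal. -/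
theorem mem_flagIdeal_of_dq_pow {m : ℕ} (hm : m ≤ n) {f : OddPoly k n}
    (hf : f ∈ flagIdeal k n (m + 1)) (hd : (dq (m + 1) ^ (n - m)) f = 0) :
    f ∈ flagIdeal k n m := by
  obtain ⟨t, ht⟩ := dq_pow_flag (k := k) m hm
  have hflag := dq_pow_succ_flag (k := k) m hm
  -- Induction on the degree of `p` in `x_{m+1}`. Since `f` has degree less than `n - m`, comparing
  -- coefficients in degree `L + (n - m)` forces the leading coefficient `u` of `p`, up to a twist,
  -- into the smaller ideal; then `x_{m+1}^L u a_{m+1}` lies there too and can be absorbed into `g`.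
  have key : ∀ (L : ℕ) (p g : OddPoly k n), (dq (m + 1) ^ L) p = 0 → g ∈ flagIdeal k n m →
      f = p * flag k n m + g → f ∈ flagIdeal k n m := by
    intro L
    induction L with
    | zero =>
      intro p g hp hg hfg
      rw [pow_zero, Module.End.one_apply] at hp
      rwa [hfg, hp, zero_mul, zero_add]
    | succ L ih =>
      intro p g hp hg hfg
      set u := (dq (m + 1) ^ L) p with hu
      have hdu : dq (m + 1) u = 0 := by rwa [pow_succ', Module.End.mul_apply] at hp
      have h1 := congrArg (dq (m + 1) ^ (L + (n - m))) hfg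
      rw [dq_pow_eq_zero_of_le (by omega) hd, map_add, dq_pow_mul hflag L p hp, ht, mul_smul_comm,
        mul_one, eq_comm, add_eq_zero_iff_eq_neg] at h1
      have h2 : (-1 : k) ^ t • (ep (m + 1) ^ (n - m)) u ∈ flagIdeal k n m := by
        rw [h1]; exact neg_mem (dq_pow_mem_flagIdeal _ hg)
      have hu' := ep_pow_mem_flagIdeal (n - m) (mem_flagIdeal_of_smul h2)
      rw [ep_pow_ep_pow hdu] at hu'
      refine ih (p - x (m + 1) ^ L * u) (x (m + 1) ^ L * (u * flag k n m) + g) ?_ ?_ ?_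
      · rw [map_sub, dq_pow_x_pow_mul, sub_self]
      · exact add_mem (flagIdeal_mul_mem _ (mul_flag_mem_flagIdeal hu')) hg
      · rw [hfg, sub_mul, mul_assoc]; abel
  rw [flagIdeal, show Set.Iio (m + 1) = insert m (Set.Iio m) by ext; simp [Nat.le_iff_lt_or_eq, or_comm],
    Set.image_insert_eq, Submodule.mem_span_insert] at hf
  obtain ⟨p, g, hg, hfg⟩ := hf
  obtain ⟨L, hL⟩ := exists_dq_pow_eq_zero (m + 1) p
  exact key L p g hL hg hfg

/-- Division with remainder by `a_{m+1}`. -/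
theorem exists_sub_mul_flag {m : ℕ} (hm : m ≤ n) {f : OddPoly k n} (hf : f ∈ vars k n (m + 1)) :
    ∃ q, f - q * flag k n m ∈ vars k n (m + 1) ∧
      (dq (m + 1) ^ (n - m)) (f - q * flag k n m) = 0 := by
  obtain ⟨t, ht⟩ := dq_pow_flag (k := k) m hm
  have hflag := dq_pow_succ_flag (k := k) m hm
  have key : ∀ (L : ℕ) (f : OddPoly k n), f ∈ vars k n (m + 1) →
      (dq (m + 1) ^ (L + (n - m))) f = 0 → ∃ q, f - q * flag k n m ∈ vars k n (m + 1) ∧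
      (dq (m + 1) ^ (n - m)) (f - q * flag k n m) = 0 := by
    intro L
    induction L with
    | zero =>
      intro f hf hd
      exact ⟨0, by simpa using hf, by simpa using hd⟩
    | succ L ih =>
      intro f hf hd
      set u := (dq (m + 1) ^ (L + (n - m))) f with hu
      have hdu : dq (m + 1) u = 0 := by
        rwa [show L + 1 + (n - m) = L + (n - m) + 1 by omega, pow_succ', Module.End.mul_apply,
          ← hu] at hd
      have hdv : dq (m + 1) ((ep (m + 1) ^ (n - m)) u) = 0 := by
        cases h : n - m with
        | zero => simpa using hdu
        | succ r => rw [pow_succ', AlgHom.mul_apply, dq_ep]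
      -- The twist is put in beforehand: multiplication by `a_{m+1}` applies `ep (m + 1) ^ (n - m)`
      -- once more, and the two cancel because `u` is free of `x_{m+1}`.
      set q := x (m + 1) ^ L * ((-1 : k) ^ t • (ep (m + 1) ^ (n - m)) u) with hq
      have hqL : (dq (m + 1) ^ L) q = (-1 : k) ^ t • (ep (m + 1) ^ (n - m)) u :=
        dq_pow_x_pow_mul _ _ _
      have hqm : q ∈ vars k n (m + 1) :=
        mul_mem (pow_mem (x_mem_vars (by omega) le_rfl) _)
          (Subalgebra.smul_mem _ (ep_pow_mem_vars _ (dq_pow_mem_vars _ hf)) _)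
      obtain ⟨q', h1, h2⟩ := ih (f - q * flag k n m)
        (sub_mem hf (mul_mem hqm (flag_mem_vars m))) (by
          rw [map_sub, dq_pow_mul hflag L q (by
            rw [pow_succ', Module.End.mul_apply, hqL, map_smul, hdv, smul_zero]), hqL, ht,
            map_smul, ep_pow_ep_pow hdu, mul_smul_comm, mul_one, smul_smul, neg_one_pow_mul_self,
            one_smul, ← hu, sub_self])
      have : f - (q + q') * flag k n m = f - q * flag k n m - q' * flag k n m := by
        rw [add_mul]; abel
      exact ⟨q + q', by rwa [this], by rwa [this]⟩
  obtain ⟨L, hL⟩ := exists_dq_pow_eq_zero (m + 1) f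
  exact key L f hf (dq_pow_eq_zero_of_le (by omega) hL)

end OddPoly


namespace OddPoly

variable {k : Type*} [Field k] {n : ℕ}

/-! ## Monomials -/

/-- The odd monomial `x_1^{a_1} ⋯ x_m^{a_m}`. -/
def mono (k : Type*) [Field k] (n : ℕ) {m : ℕ} (a : Fin m → ℕ) : OddPoly k n :=
  (List.ofFn fun i : Fin m => (x (i.1 + 1) : OddPoly k n) ^ a i).prod

theorem mono_zero (a : Fin 0 → ℕ) : mono k n a = 1 := by simp [mono]

theorem mono_succ {m : ℕ} (a : Fin (m + 1) → ℕ) :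
    mono k n a = mono k n (fun i => a i.castSucc) * x (m + 1) ^ a (Fin.last m) := by
  rw [mono, List.ofFn_succ', List.prod_concat]
  rfl

theorem mono_mem_vars {m : ℕ} (a : Fin m → ℕ) : mono k n a ∈ vars k n m := by
  induction m with
  | zero => rw [mono_zero]; exact one_mem _
  | succ m ih =>
    rw [mono_succ]
    exact mul_mem (vars_mono (Nat.le_succ m) (ih _)) (pow_mem (x_mem_vars (by omega) le_rfl) _)

theorem dq_pow_mul_of_dq_right {i : ℕ} {g : OddPoly k n} (hg : dq i g = 0) (t : ℕ)
    (f : OddPoly k n) : (dq i ^ t) (f * g) = (dq i ^ t) f * g := by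
  induction t with
  | zero => simp
  | succ t ih =>
    rw [pow_succ', Module.End.mul_apply, ih, dq_mul, hg, mul_zero, add_zero, Module.End.mul_apply]

theorem dq_pow_mul_of_dq_left {i : ℕ} {u : OddPoly k n} (hu : dq i u = 0) (t : ℕ)
    (b : OddPoly k n) : (dq i ^ t) (u * b) = (ep i ^ t) u * (dq i ^ t) b := by
  induction t generalizing u b with
  | zero => simp
  | succ t ih =>
    rw [pow_succ, Module.End.mul_apply, dq_mul, hu, zero_mul, zero_add, ih (dq_ep i u),
      pow_succ, AlgHom.mul_apply, Module.End.mul_apply]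

theorem dq_x_pow_of_ne {i j : ℕ} (h : j ≠ i) (t : ℕ) : dq i (x j ^ t : OddPoly k n) = 0 := by
  induction t with
  | zero => simp
  | succ t ih => rw [pow_succ, dq_mul, ih, dq_x, if_neg h, zero_mul, mul_zero, add_zero]

theorem dq_pow_x_pow (i t l : ℕ) : (dq i ^ t) (x i ^ l : OddPoly k n) =
    if t ≤ l then x i ^ (l - t) else 0 := by
  split_ifs with h
  · nth_rw 1 [← Nat.add_sub_of_le h]
    rw [pow_add, dq_pow_x_pow_mul]
  · rw [show t = (t - l - 1) + (l + 1) by omega, pow_add, Module.End.mul_apply, pow_succ',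
      Module.End.mul_apply, ← mul_one (x i ^ l), dq_pow_x_pow_mul, dq_one, map_zero]

theorem dq_pow_mono {m : ℕ} (a : Fin m → ℕ) (i : Fin m) {t : ℕ} (ht : a i < t) :
    (dq (i.1 + 1) ^ t) (mono k n a) = 0 := by
  induction m with
  | zero => exact i.elim0
  | succ m ih =>
    rw [mono_succ]
    induction i using Fin.lastCases with
    | last =>
      rw [Fin.val_last,
        dq_pow_mul_of_dq_left (dq_eq_zero_of_mem_vars (Nat.lt_succ_self m) (mono_mem_vars _)),
        dq_pow_x_pow, if_neg (by omega), mul_zero]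
    | cast i =>
      rw [dq_pow_mul_of_dq_right (dq_x_pow_of_ne (by simp; omega) _), Fin.val_castSucc,
        ih _ i ht, zero_mul]

/-- The operator that extracts, up to sign, the coefficient of a monomial. -/
def coeffOf (k : Type*) [Field k] (n : ℕ) : {m : ℕ} → (Fin m → ℕ) → OddPoly k n →ₗ[k] A k n
  | 0, _ => constTerm.toLinearMap
  | m + 1, b => coeffOf k n (fun i : Fin m => b i.castSucc) ∘ₗ (ev (m + 1)).toLinearMap ∘ₗ
      dq (m + 1) ^ b (Fin.last m)

theorem ev_of_mem_vars {i j : ℕ} (hij : i < j) {f : OddPoly k n} (hf : f ∈ vars k n i) :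
    ev j f = f := eq_ev_of_dq_eq_zero (dq_eq_zero_of_mem_vars hij hf)

theorem par_mono {m : ℕ} (a : Fin m → ℕ) :
    ∃ e : ℕ, par (mono k n a) = (-1 : k) ^ e • mono k n a := by
  induction m with
  | zero => exact ⟨0, by simp [mono_zero]⟩
  | succ m ih =>
    obtain ⟨e, he⟩ := ih (fun i => a i.castSucc)
    exact ⟨e + a (Fin.last m), by
      rw [mono_succ, map_mul, he, map_pow, par_x, neg_x_pow, smul_mul_smul_comm, pow_add]⟩

theorem ep_pow_mono {m : ℕ} (a : Fin m → ℕ) (t : ℕ) :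
    ∃ e : ℕ, (ep (m + 1) ^ t) (mono k n a) = (-1 : k) ^ e • mono k n a := by
  obtain ⟨e, he⟩ := par_mono (k := k) (n := n) a
  induction t with
  | zero => exact ⟨0, by simp⟩
  | succ t ih =>
    obtain ⟨e', he'⟩ := ih
    exact ⟨e' + e, by
      rw [pow_succ', AlgHom.mul_apply, he', map_smul, ep_eq_par (Nat.lt_succ_self m)
        (mono_mem_vars a), he, smul_smul, pow_add]⟩

theorem coeffOf_mono {m : ℕ} (b : Fin m → ℕ) : ∃ e : ℕ, ∀ (a : Fin m → ℕ) (c : A k n),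
    coeffOf k n b (mono k n a * C c) = if a = b then (-1 : k) ^ e • c else 0 := by
  induction m with
  | zero => exact ⟨0, fun a c => by simp [coeffOf, mono_zero, Subsingleton.elim a b]⟩
  | succ m ih =>
    obtain ⟨e, he⟩ := ih (fun i => b i.castSucc)
    obtain ⟨e', he'⟩ := ep_pow_mono (k := k) (n := n) (fun i => b i.castSucc) (b (Fin.last m))
    refine ⟨e' + e, fun a c => ?_⟩
    obtain ⟨e'', he''⟩ := ep_pow_mono (k := k) (n := n) (fun i => a i.castSucc) (b (Fin.last m))
    have h1 : coeffOf k n b (mono k n a * C c) = coeffOf k n (fun i => b i.castSucc)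
        (ev (m + 1) ((ep (m + 1) ^ b (Fin.last m)) (mono k n fun i => a i.castSucc) *
          (dq (m + 1) ^ b (Fin.last m)) (x (m + 1) ^ a (Fin.last m)) * C c)) := by
      rw [mono_succ, ← dq_pow_mul_of_dq_left
        (dq_eq_zero_of_mem_vars (Nat.lt_succ_self m) (mono_mem_vars _)), ← dq_pow_mul_C]
      rfl
    have hab : a = b ↔ (fun i : Fin m => a i.castSucc) = (fun i => b i.castSucc) ∧
        a (Fin.last m) = b (Fin.last m) := by
      refine ⟨fun h => by subst h; exact ⟨rfl, rfl⟩, fun ⟨h, h'⟩ => funext fun i => ?_⟩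
      induction i using Fin.lastCases with
      | last => exact h'
      | cast i => exact congrFun h i
    rw [h1, dq_pow_x_pow]
    rcases lt_trichotomy (a (Fin.last m)) (b (Fin.last m)) with h | h | h
    · rw [if_neg (by omega), if_neg (by rw [hab]; omega)]
      simp
    · rw [if_pos h.ge, h, Nat.sub_self, pow_zero, mul_one, map_mul, he'', map_smul,
        ev_of_mem_vars (Nat.lt_succ_self m) (mono_mem_vars _), ev_C, smul_mul_assoc, map_smul, he]
      by_cases h' : (fun i : Fin m => a i.castSucc) = (fun i => b i.castSucc)
      · rw [if_pos h', if_pos (hab.2 ⟨h', h⟩), smul_smul, pow_add]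
        -- The exponents `e'` and `e''` are independent choices for the same monomial and need not
        -- agree as numbers; extracting the coefficient shows that their signs act equally on `c`.
        rw [h', he'] at he''
        have h2 := congrArg (coeffOf k n (fun i : Fin m => b i.castSucc))
          (congrArg (· * C c) he'')
        simp only [smul_mul_assoc, map_smul, he, if_true] at h2
        rw [mul_smul, mul_smul, ← h2]
      · rw [if_neg h', if_neg (fun h2 => h' (hab.1 h2).1), smul_zero]
    · rw [if_pos h.le, if_neg (by rw [hab]; omega), map_mul (ev (m + 1)), map_mul (ev (m + 1)),
        map_pow, ev_x, if_pos rfl, zero_pow (by omega), mul_zero, zero_mul, map_zero]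

theorem mono_independent {m : ℕ} (s : Finset (Fin m → ℕ)) (c : (Fin m → ℕ) → A k n)
    (h : ∑ a ∈ s, mono k n a * C (c a) = 0) : ∀ a ∈ s, c a = 0 := by
  intro b hb
  obtain ⟨e, he⟩ := coeffOf_mono (k := k) (n := n) b
  have := congrArg (coeffOf k n b) h
  simp only [map_sum, he, map_zero, Finset.sum_ite_eq', hb, if_true] at this
  rw [← one_smul k (c b), ← neg_one_pow_mul_self e, mul_smul, this, smul_zero]

/-- The degree bound in the last variable removes the last generator; repeating this ends in the
ideal with no generators. -/
theorem eq_zero_of_mem_flagIdeal {m : ℕ} (hm : m ≤ n) {f : OddPoly k n}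
    (hf : f ∈ flagIdeal k n m) (hd : ∀ j < m, (dq (j + 1) ^ (n - j)) f = 0) : f = 0 := by
  induction m with
  | zero => simpa [flagIdeal] using hf
  | succ m ih =>
    exact ih (by omega) (mem_flagIdeal_of_dq_pow (by omega) hf (hd m (by omega)))
      (fun j hj => hd j (by omega))

/-- The monomials with exponents in `X_m` are independent modulo the flag ideal. -/
theorem mono_independent_mod {m : ℕ} (s : Finset (Fin m → ℕ)) (hs : ∀ a ∈ s, a ∈ X n m)
    (c : (Fin m → ℕ) → A k n) (h : ∑ a ∈ s, mono k n a * C (c a) ∈ flagIdeal k n m) :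
    ∀ a ∈ s, c a = 0 := by
  by_cases hm : m ≤ n
  · refine mono_independent s c (eq_zero_of_mem_flagIdeal hm h fun j hj => ?_)
    rw [map_sum]
    refine Finset.sum_eq_zero fun a ha => ?_
    have := hs a ha ⟨j, hj⟩
    rw [dq_pow_mul_C, dq_pow_mono a ⟨j, hj⟩ (by simp only at this; omega), zero_mul]
  -- For `m > n` the set `X n m` is empty: the entry at position `n` would have to be at most `-1`.
  · intro a ha
    have := hs a ha ⟨n, by omega⟩
    simp only at this
    omega

/-- The span of the monomials with exponents in `X_m`. -/
def monoSpan (k : Type*) [Field k] (n m : ℕ) : Submodule k (OddPoly k n) :=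
  Submodule.span k {f | ∃ a ∈ X n m, ∃ c, f = mono k n a * C c}

theorem mem_span_x_pow_mul {m t : ℕ} {f : OddPoly k n} (hf : f ∈ vars k n (m + 1))
    (hd : (dq (m + 1) ^ t) f = 0) :
    f ∈ Submodule.span k {g | ∃ l < t, ∃ u ∈ vars k n m, g = x (m + 1) ^ l * u} := by
  induction t generalizing f with
  | zero =>
    rw [pow_zero, Module.End.one_apply] at hd
    rw [hd]; exact zero_mem _
  | succ t ih =>
    have h := ih (dq_mem_vars hf) (by rwa [pow_succ, Module.End.mul_apply] at hd)
    rw [← ev_add_dq (m + 1) f]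
    refine add_mem (Submodule.subset_span ⟨0, by omega, _, ev_mem_vars hf, by simp⟩) ?_
    have h2 := Submodule.mem_map_of_mem (f := LinearMap.mulLeft k (x (m + 1) : OddPoly k n)) h
    rw [Submodule.map_span] at h2
    refine Submodule.span_mono ?_ h2
    rintro _ ⟨_, ⟨l, hl, u, hu, rfl⟩, rfl⟩
    exact ⟨l + 1, by omega, u, hu, by rw [LinearMap.mulLeft_apply, ← mul_assoc, pow_succ']⟩

theorem x_pow_mul_of_mem_vars {i j : ℕ} (hij : i < j) (l : ℕ) {f : OddPoly k n} {e : k}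
    (hf : f ∈ vars k n i) (he : par f = e • f) : x j ^ l * f = e ^ l • (f * x j ^ l) := by
  have h1 : x j * f = par f * x j := by
    clear he
    induction hf using vars_induction with
    | C c => rw [par_C, x_mul_C]
    | x l h h' => rw [par_x, x_mul_x (by omega), neg_mul]
    | add f g _ _ hf hg => rw [mul_add, hf, hg, map_add, add_mul]
    | mul f g _ _ hf hg => rw [← mul_assoc, hf, mul_assoc, hg, map_mul, mul_assoc]
  induction l with
  | zero => simp
  | succ l ih =>
    rw [pow_succ', mul_assoc, ih, mul_smul_comm, ← mul_assoc, h1, he, smul_mul_assoc,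
      smul_mul_assoc, smul_smul, pow_succ e, mul_assoc f]

/-- Modulo the flag ideal, all odd polynomials in `x_1, …, x_m` are combinations of the monomials
with exponents in `X_m`. -/
theorem vars_le_monoSpan_sup (m : ℕ) {f : OddPoly k n} (hf : f ∈ vars k n m) :
    f ∈ monoSpan k n m ⊔ (flagIdeal k n m).restrictScalars k := by
  induction m generalizing f with
  | zero =>
    refine Submodule.mem_sup_left ?_
    have : ∃ c, f = C c := by
      induction hf using vars_induction with
      | C c => exact ⟨c, rfl⟩
      | x j h h' => omega
      | add f g _ _ hf hg =>
        obtain ⟨c, rfl⟩ := hf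
        obtain ⟨c', rfl⟩ := hg
        exact ⟨c + c', by rw [map_add]⟩
      | mul f g _ _ hf hg =>
        obtain ⟨c, rfl⟩ := hf
        obtain ⟨c', rfl⟩ := hg
        exact ⟨c * c', by rw [map_mul]⟩
    obtain ⟨c, rfl⟩ := this
    exact Submodule.subset_span ⟨Fin.elim0, fun i => i.elim0, c, by rw [mono_zero, one_mul]⟩
  | succ m ih =>
    by_cases hm : m < n
    · obtain ⟨q, h1, h2⟩ := exists_sub_mul_flag hm.le hf
      have h3 : q * flag k n m ∈ monoSpan k n (m + 1) ⊔
          (flagIdeal k n (m + 1)).restrictScalars k :=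
        Submodule.mem_sup_right (flagIdeal_mul_mem _ (flag_mem_flagIdeal (Nat.lt_succ_self m)))
      rw [← sub_add_cancel f (q * flag k n m)]
      refine add_mem (Submodule.span_le.2 ?_ (mem_span_x_pow_mul h1 h2)) h3
      rintro _ ⟨l, hl, u, hu, rfl⟩
      have h4 := Submodule.mem_map_of_mem
        (f := LinearMap.mulLeft k ((x (m + 1) : OddPoly k n) ^ l)) (ih hu)
      rw [LinearMap.mulLeft_apply, Submodule.map_sup] at h4
      refine SetLike.le_def.1 (sup_le_sup ?_ ?_) h4
      · rw [monoSpan, Submodule.map_span_le]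
        rintro _ ⟨a, ha, c, rfl⟩
        obtain ⟨e, he⟩ := par_mono (k := k) (n := n) a
        rw [LinearMap.mulLeft_apply, ← mul_assoc,
          x_pow_mul_of_mem_vars (Nat.lt_succ_self m) l (mono_mem_vars a) he, smul_mul_assoc]
        refine Submodule.smul_mem _ _ (Submodule.subset_span
          ⟨Fin.snoc (α := fun _ => ℕ) a l, fun i => ?_, c, ?_⟩)
        · induction i using Fin.lastCases with
          | last => rw [Fin.snoc_last, Fin.val_last]; omega
          | cast i => rw [Fin.snoc_castSucc]; exact ha i
        · rw [mono_succ]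
          simp only [Fin.snoc_castSucc, Fin.snoc_last]
      · rintro _ ⟨g, hg, rfl⟩
        refine flagIdeal_mul_mem _ (Submodule.span_mono ?_ hg)
        exact Set.image_mono (Set.Iio_subset_Iio (Nat.le_succ m))
    -- For `m ≥ n` the generator `a_{n+1}` has degree zero, hence is `±1`, and the ideal is
    -- everything.
    · refine Submodule.mem_sup_right ?_
      obtain ⟨t, ht⟩ := dq_pow_flag (k := k) n le_rfl
      rw [Nat.sub_self, pow_zero, Module.End.one_apply] at ht
      have h1 : flag k n n ∈ flagIdeal k n (m + 1) := flag_mem_flagIdeal (by omega)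
      rw [ht] at h1
      have h2 := flagIdeal_mul_mem f (mem_flagIdeal_of_smul h1)
      rwa [mul_one] at h2

end OddPoly


/-! ## Inversions -/

section Inversions

variable {m : ℕ}

/-- The `i`-th point. -/
def Letter.lo (i : Letter m) : Fin m := ⟨i.1 - 1, by omega⟩

/-- The `(i+1)`-st point. -/
def Letter.hi (i : Letter m) : Fin m := ⟨i.1, i.2.2⟩

theorem simple_eq (i : Letter m) : simple i = Equiv.swap i.lo i.hi := rfl

@[simp] theorem simple_lo (i : Letter m) : simple i i.lo = i.hi := Equiv.swap_apply_left _ _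

@[simp] theorem simple_hi (i : Letter m) : simple i i.hi = i.lo := Equiv.swap_apply_right _ _

theorem Letter.lo_ne_hi (i : Letter m) : i.lo ≠ i.hi := by
  have := i.2
  simp only [Letter.lo, Letter.hi, ne_eq, Fin.mk.injEq]
  omega

theorem simple_of_ne {i : Letter m} {a : Fin m} (h : a ≠ i.lo) (h' : a ≠ i.hi) :
    simple i a = a := Equiv.swap_apply_of_ne_of_ne h h'

@[simp] theorem simple_mul_self (i : Letter m) : simple i * simple i = 1 :=
  Equiv.swap_mul_self _ _

@[simp] theorem simple_mul_cancel (i : Letter m) (w : Equiv.Perm (Fin m)) :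
    simple i * (simple i * w) = w := by rw [← mul_assoc, simple_mul_self, one_mul]

@[simp] theorem simple_inv (i : Letter m) : (simple i)⁻¹ = simple i := Equiv.swap_inv _ _

@[simp] theorem simple_simple (i : Letter m) (a : Fin m) : simple i (simple i a) = a :=
  Equiv.Perm.ext_iff.1 (simple_mul_self i) a

theorem simple_val (i : Letter m) (a : Fin m) :
    (simple i a).1 = if a.1 = i.1 - 1 then i.1 else if a.1 = i.1 then i.1 - 1 else a.1 := by
  rw [simple_eq, Equiv.swap_apply_def]
  simp only [Letter.lo, Letter.hi, Fin.ext_iff]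
  split_ifs <;> rfl

theorem simple_lt_simple {i : Letter m} {a b : Fin m} (h : a < b) (h' : ¬(a = i.lo ∧ b = i.hi)) :
    simple i a < simple i b := by
  have := i.2
  simp only [Letter.lo, Letter.hi, Fin.ext_iff] at h'
  rw [Fin.lt_def] at h ⊢
  rw [simple_val, simple_val]
  split_ifs <;> omega

/-- The inversions of a permutation. -/
def invSet (w : Equiv.Perm (Fin m)) : Finset (Fin m × Fin m) :=
  {p | p.1 < p.2 ∧ w p.2 < w p.1}

theorem mem_invSet {w : Equiv.Perm (Fin m)} {a b : Fin m} :
    (a, b) ∈ invSet w ↔ a < b ∧ w b < w a := by simp [invSet]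

/-- The number of inversions of a permutation. -/
def inv (w : Equiv.Perm (Fin m)) : ℕ := (invSet w).card

/-- The transposition permutes the ordered pairs of points except for the pair it exchanges, and
that pair becomes the one new inversion. -/
theorem inv_mul_simple {w : Equiv.Perm (Fin m)} {i : Letter m} (h : w i.lo < w i.hi) :
    inv (w * simple i) = inv w + 1 := by
  have hlt : i.lo < i.hi := by
    have := i.2
    simp only [Letter.lo, Letter.hi, Fin.mk_lt_mk]
    omega
  have : invSet (w * simple i) = Finset.cons (i.lo, i.hi)
      ((invSet w).map (Equiv.prodCongr (simple i) (simple i)).toEmbedding) (by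
        rw [Finset.mem_map_equiv]
        change ((simple i)⁻¹ i.lo, (simple i)⁻¹ i.hi) ∉ _
        rw [mem_invSet, simple_inv, simple_lo, simple_hi]
        exact fun h => h.1.not_gt hlt) := by
    ext ⟨a, b⟩
    rw [Finset.mem_cons, Finset.mem_map_equiv, mem_invSet, Prod.mk.injEq]
    change _ ↔ _ ∨ ((simple i)⁻¹ a, (simple i)⁻¹ b) ∈ _
    rw [mem_invSet, simple_inv, Equiv.Perm.mul_apply, Equiv.Perm.mul_apply]
    constructor
    · rintro ⟨hab, hw⟩
      by_cases h' : a = i.lo ∧ b = i.hi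
      · exact Or.inl h'
      · exact Or.inr ⟨simple_lt_simple hab h', hw⟩
    · rintro (⟨rfl, rfl⟩ | ⟨hab, hw⟩)
      · simpa [hlt] using h
      · refine ⟨?_, hw⟩
        have h2 := simple_lt_simple hab (i := i) (by
          rintro ⟨h1, h2⟩
          rw [h1, h2] at hw
          exact (h.trans hw).false)
        simpa using h2
  rw [inv, this, Finset.card_cons, Finset.card_map, inv]

theorem inv_mul_simple_of_gt {w : Equiv.Perm (Fin m)} {i : Letter m} (h : w i.hi < w i.lo) :
    inv (w * simple i) + 1 = inv w := by
  rw [← inv_mul_simple (w := w * simple i) (i := i) (by simpa using h), mul_assoc,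
    simple_mul_self, mul_one]

theorem inv_inv (w : Equiv.Perm (Fin m)) : inv w⁻¹ = inv w := by
  refine Finset.card_bij (fun p _ => (w⁻¹ p.2, w⁻¹ p.1)) ?_ ?_ ?_
  · rintro ⟨a, b⟩ h
    simp only [invSet, Finset.mem_filter, Finset.mem_univ, true_and] at h ⊢
    simpa using h.symm
  · rintro ⟨a, b⟩ _ ⟨c, d⟩ _ h
    simp only [Prod.mk.injEq, EmbeddingLike.apply_eq_iff_eq] at h
    rw [h.1, h.2]
  · rintro ⟨a, b⟩ h
    refine ⟨(w b, w a), ?_, by simp⟩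
    simp only [invSet, Finset.mem_filter, Finset.mem_univ, true_and] at h ⊢
    simpa using h.symm

theorem inv_simple_mul {w : Equiv.Perm (Fin m)} {i : Letter m} (h : w⁻¹ i.lo < w⁻¹ i.hi) :
    inv (simple i * w) = inv w + 1 := by
  rw [← inv_inv, mul_inv_rev, simple_inv, inv_mul_simple h, inv_inv]

theorem inv_simple_mul_of_gt {w : Equiv.Perm (Fin m)} {i : Letter m}
    (h : w⁻¹ i.hi < w⁻¹ i.lo) : inv (simple i * w) + 1 = inv w := by
  rw [← inv_inv, mul_inv_rev, simple_inv, inv_mul_simple_of_gt h, inv_inv]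

theorem lo_hi_lt_or_gt (w : Equiv.Perm (Fin m)) (i : Letter m) :
    w i.lo < w i.hi ∨ w i.hi < w i.lo :=
  lt_or_gt_of_ne fun h => i.lo_ne_hi (w.injective h)

theorem inv_simple_mul_cases (w : Equiv.Perm (Fin m)) (i : Letter m) :
    inv (simple i * w) = inv w + 1 ∨ inv (simple i * w) + 1 = inv w :=
  (lo_hi_lt_or_gt w⁻¹ i).imp inv_simple_mul inv_simple_mul_of_gt

theorem inv_simple_mul_lt_iff {w : Equiv.Perm (Fin m)} {i : Letter m} :
    inv (simple i * w) < inv w ↔ w⁻¹ i.hi < w⁻¹ i.lo := by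
  constructor
  · intro h
    by_contra h'
    have := inv_simple_mul ((lo_hi_lt_or_gt w⁻¹ i).resolve_right h')
    omega
  · intro h
    have := inv_simple_mul_of_gt h
    omega

@[simp] theorem inv_one : inv (1 : Equiv.Perm (Fin m)) = 0 := by
  simp only [inv, invSet, Finset.card_eq_zero, Finset.filter_eq_empty_iff]
  rintro ⟨a, b⟩ _ ⟨h, h'⟩
  exact (h.trans h').false

theorem perm_eq_one_of_strictMono {w : Equiv.Perm (Fin m)} (h : StrictMono w) : w = 1 := by
  have : (StrictMono.orderIsoOfSurjective w h w.surjective) = OrderIso.refl (Fin m) :=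
    Subsingleton.elim _ _
  ext a
  exact congrArg Fin.val (DFunLike.congr_fun this a)

theorem strictMono_of_lo_lt_hi {f : Fin m → Fin m} (h : ∀ i : Letter m, f i.lo < f i.hi) :
    StrictMono f := by
  cases m with
  | zero => exact fun a => a.elim0
  | succ m =>
    refine Fin.strictMono_iff_lt_succ.2 fun i => ?_
    exact h ⟨i.1 + 1, by omega, by omega⟩

theorem exists_descent {w : Equiv.Perm (Fin m)} (h : w ≠ 1) : ∃ i : Letter m, w i.hi < w i.lo := by
  by_contra! h'
  exact h (perm_eq_one_of_strictMono (strictMono_of_lo_lt_hi fun i =>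
    lt_of_le_of_ne (h' i) fun h => i.lo_ne_hi (w.injective h)))

theorem eq_one_of_inv_eq_zero {w : Equiv.Perm (Fin m)} (h : inv w = 0) : w = 1 := by
  by_contra h'
  obtain ⟨i, hi⟩ := exists_descent h'
  have := inv_mul_simple_of_gt hi
  omega

@[simp] theorem wordPerm_nil : wordPerm ([] : List (Letter m)) = 1 := rfl

@[simp] theorem wordPerm_cons (i : Letter m) (L : List (Letter m)) :
    wordPerm (i :: L) = simple i * wordPerm L := by simp [wordPerm]

@[simp] theorem wordPerm_append (L L' : List (Letter m)) :
    wordPerm (L ++ L') = wordPerm L * wordPerm L' := by simp [wordPerm]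

theorem inv_wordPerm_le (L : List (Letter m)) : inv (wordPerm L) ≤ L.length := by
  induction L with
  | nil => simp
  | cons i L ih =>
    rw [wordPerm_cons, List.length_cons]
    rcases inv_simple_mul_cases (wordPerm L) i with h | h <;> omega

theorem exists_word (w : Equiv.Perm (Fin m)) :
    ∃ L : List (Letter m), wordPerm L = w ∧ L.length = inv w := by
  induction h : inv w generalizing w with
  | zero => exact ⟨[], (eq_one_of_inv_eq_zero h).symm, rfl⟩
  | succ r ih =>
    have h1 : w⁻¹ ≠ 1 := by
      intro h1
      rw [← inv_inv, h1, inv_one] at h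
      omega
    obtain ⟨i, hi⟩ := exists_descent h1
    have h2 := inv_simple_mul_of_gt hi
    obtain ⟨L, hL, hl⟩ := ih (simple i * w) (by omega)
    exact ⟨i :: L, by rw [wordPerm_cons, hL, simple_mul_cancel], by rw [List.length_cons, hl]⟩

theorem IsReduced.length_eq {w : Equiv.Perm (Fin m)} {L : List (Letter m)} (h : IsReduced w L) :
    L.length = inv w := by
  obtain ⟨L', h1, h2⟩ := exists_word w
  have h3 := h.2 L' h1
  have h4 := inv_wordPerm_le L
  rw [h.1] at h4
  omega

theorem len_eq_inv (w : Equiv.Perm (Fin m)) : len w = inv w := by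
  obtain ⟨L, h1, h2⟩ := exists_word w
  refine le_antisymm (Nat.sInf_le ⟨L, h1, h2⟩) (le_csInf ⟨_, L, h1, rfl⟩ ?_)
  rintro _ ⟨L', rfl, rfl⟩
  exact inv_wordPerm_le L'

/-- The longest permutation. -/
def longest (m : ℕ) : Equiv.Perm (Fin m) := Fin.revPerm

/-- Composition with the order reversal interchanges inversions and non-inversions. -/
theorem inv_mul_longest (w : Equiv.Perm (Fin m)) :
    inv (w * longest m) + inv w = inv (longest m) := by
  have h1 : inv (w * longest m) =
      (Finset.univ.filter fun p : Fin m × Fin m => p.1 < p.2 ∧ ¬ w p.2 < w p.1).card := by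
    refine Finset.card_bij (fun p _ => (Fin.rev p.2, Fin.rev p.1)) ?_ ?_ ?_
    · rintro ⟨a, b⟩ h
      simp only [invSet, Finset.mem_filter, Finset.mem_univ, true_and, longest,
        Equiv.Perm.mul_apply, Fin.revPerm_apply] at h ⊢
      exact ⟨Fin.rev_lt_rev.2 h.1, h.2.not_gt⟩
    · rintro ⟨a, b⟩ _ ⟨c, d⟩ _ h
      simp only [Prod.mk.injEq, Fin.rev_inj] at h
      rw [h.1, h.2]
    · rintro ⟨a, b⟩ h
      refine ⟨(Fin.rev b, Fin.rev a), ?_, by simp⟩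
      simp only [invSet, Finset.mem_filter, Finset.mem_univ, true_and, longest,
        Equiv.Perm.mul_apply, Fin.revPerm_apply, Fin.rev_rev] at h ⊢
      refine ⟨Fin.rev_lt_rev.2 h.1, lt_of_le_of_ne (not_lt.1 h.2) fun h' => ?_⟩
      exact h.1.ne (w.injective h')
  have h2 : inv (longest m) = (Finset.univ.filter fun p : Fin m × Fin m => p.1 < p.2).card := by
    rw [inv, invSet]
    congr 1
    ext ⟨a, b⟩
    simp [longest]
  rw [h1, h2, inv, invSet, add_comm, ← Finset.filter_filter, ← Finset.filter_filter,
    Finset.card_filter_add_card_filter_not]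

end Inversions

/-! ## Equality up to sign -/

/-- Equality up to sign. -/
def EqSign {R : Type*} [Ring R] (a b : R) : Prop := a = b ∨ a = -b

namespace EqSign

variable {R : Type*} [Ring R] {a b c d : R}

theorem refl (a : R) : EqSign a a := Or.inl rfl

theorem symm (h : EqSign a b) : EqSign b a := by
  rcases h with rfl | rfl
  · exact Or.inl rfl
  · exact Or.inr (neg_neg b).symm

theorem trans (h : EqSign a b) (h' : EqSign b c) : EqSign a c := by
  rcases h with rfl | rfl <;> rcases h' with rfl | rfl <;> simp [EqSign]

theorem mul (h : EqSign a b) (h' : EqSign c d) : EqSign (a * c) (b * d) := by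
  rcases h with rfl | rfl <;> rcases h' with rfl | rfl <;> simp [EqSign]

theorem mul_left (a : R) (h : EqSign c d) : EqSign (a * c) (a * d) := (refl a).mul h

theorem mul_right (h : EqSign a b) (c : R) : EqSign (a * c) (b * c) := h.mul (refl c)

theorem neg_left (a : R) : EqSign (-a) a := Or.inr rfl

theorem map {S F : Type*} [Ring S] [FunLike F R S] [AddMonoidHomClass F R S] (f : F)
    (h : EqSign a b) : EqSign (f a) (f b) := by
  rcases h with rfl | rfl
  · exact refl _
  · exact Or.inr (map_neg f b)

theorem eq_zero (h : EqSign a b) (hb : b = 0) : a = 0 := by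
  rcases h with rfl | rfl <;> simp [hb]

theorem neg_one_pow (t : ℕ) : EqSign ((-1 : R) ^ t) 1 := by
  rcases neg_one_pow_eq_or R t with h | h <;> simp [h, EqSign]

end EqSign

/-! ## Products of the generators `τ_i` along words -/

section Words

variable (k : Type*) [Field k] {m : ℕ}

theorem ONH.mk_rel {a b : FreeAlgebra k (Gen m)} (h : Rel k m a b) : ONH.mk k m a = ONH.mk k m b :=
  RingQuot.mkAlgHom_rel k h

theorem ONH.t_mul_t_self {i : ℕ} (hi : 1 ≤ i ∧ i < m) : ONH.t k m i * ONH.t k m i = 0 := by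
  have := ONH.mk_rel k (Rel.t_sq i hi)
  rwa [map_mul, map_zero] at this

theorem ONH.t_braid {i : ℕ} (hi : 1 ≤ i ∧ i + 1 < m) :
    ONH.t k m i * ONH.t k m (i + 1) * ONH.t k m i =
      ONH.t k m (i + 1) * ONH.t k m i * ONH.t k m (i + 1) := by
  have := ONH.mk_rel k (Rel.braid i hi)
  rwa [map_mul, map_mul, map_mul, map_mul] at this

theorem ONH.t_mul_t_far {i j : ℕ} (hi : 1 ≤ i ∧ i < m) (hj : 1 ≤ j ∧ j < m)
    (hij : i + 1 < j ∨ j + 1 < i) : ONH.t k m i * ONH.t k m j = -(ONH.t k m j * ONH.t k m i) := by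
  have := ONH.mk_rel k (Rel.t_t i j hi hj hij)
  rw [map_add, map_mul, map_mul, map_zero] at this
  exact eq_neg_of_add_eq_zero_left this

@[simp] theorem tauWord_nil : tauWord k ([] : List (Letter m)) = 1 := rfl

@[simp] theorem tauWord_cons (i : Letter m) (L : List (Letter m)) :
    tauWord k (i :: L) = ONH.t k m i.1 * tauWord k L := by simp [tauWord]

@[simp] theorem tauWord_append (L L' : List (Letter m)) :
    tauWord k (L ++ L') = tauWord k L * tauWord k L' := by simp [tauWord]

theorem simple_mul_simple_far {i j : Letter m} (h : i.1 + 1 < j.1) :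
    simple i * simple j = simple j * simple i := by
  ext a
  have := i.2
  have := j.2
  simp only [Equiv.Perm.mul_apply, simple_val]
  split_ifs <;> omega

theorem hi_eq_lo {i j : Letter m} (h : i.1 + 1 = j.1) : i.hi = j.lo :=
  Fin.ext (by simp only [Letter.hi, Letter.lo]; omega)

theorem simple_braid {i j : Letter m} (h : i.1 + 1 = j.1) :
    simple i * (simple j * simple i) = simple j * (simple i * simple j) := by
  have hq := hi_eq_lo h
  have h1 := i.lo_ne_hi
  have h2 := j.lo_ne_hi
  have h3 : i.lo ≠ j.hi := by
    simp only [Letter.hi, Letter.lo, ne_eq, Fin.mk.injEq]; omega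
  have e1 : simple j i.lo = i.lo := simple_of_ne (hq ▸ h1) h3
  have e2 : simple i j.hi = j.hi := simple_of_ne h3.symm (hq ▸ h2.symm)
  have e3 : simple i j.lo = i.lo := by rw [← hq, simple_hi]
  have e4 : simple j i.hi = j.hi := by rw [hq, simple_lo]
  refine Equiv.ext fun a => ?_
  simp only [Equiv.Perm.mul_apply]
  by_cases ha : a = i.lo
  · subst ha; rw [simple_lo, e4, e2, e1, simple_lo, e4]
  by_cases hb : a = j.lo
  · subst hb; rw [e3, e1, simple_lo, simple_lo, e2, simple_hi, hq]
  by_cases hc : a = j.hi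
  · subst hc; rw [e2, simple_hi, e3, e1]
  · rw [simple_of_ne ha (hq ▸ hb), simple_of_ne hb hc, simple_of_ne ha (hq ▸ hb),
      simple_of_ne hb hc]

/-- Two reduced words of a permutation give the same product of the `τ_i` up to sign. -/
theorem tauWord_eqSign {L L' : List (Letter m)} (h : wordPerm L = wordPerm L')
    (hL : inv (wordPerm L) = L.length) (hL' : L'.length = L.length) :
    EqSign (tauWord k L) (tauWord k L') := by
  induction hr : L.length using Nat.strong_induction_on generalizing L L' with
  | _ r ih =>
    rcases L with _ | ⟨i, L⟩
    · rw [List.length_nil, List.length_eq_zero_iff] at hL'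
      subst hL'
      exact EqSign.refl _
    rcases L' with _ | ⟨j, L'⟩
    · simp at hL'
    rw [List.length_cons] at hr
    have hlen' : L'.length = L.length := by simpa using hL'
    rw [wordPerm_cons, wordPerm_cons] at h
    rw [wordPerm_cons, List.length_cons] at hL
    have hred : inv (wordPerm L) = L.length := by
      have := inv_wordPerm_le L
      rcases inv_simple_mul_cases (wordPerm L) i with h | h <;> omega
    have hred' : inv (wordPerm L') = L'.length := by
      have := inv_wordPerm_le L'
      rw [h] at hL
      rcases inv_simple_mul_cases (wordPerm L') j with h | h <;> omega
    rw [tauWord_cons, tauWord_cons]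
    by_cases hij : i = j
    · subst hij
      exact (ih L.length (by omega) (mul_left_cancel h) hred hlen' rfl).mul_left _
    -- Both `i` and `j` are left descents of `w`, so `w` also has a reduced word starting with `i
    -- j`, or with `i j i` if they are adjacent, followed by some `K`. The induction hypothesis
    -- compares the two tails with such words, and a single defining relation joins them.
    have key : ∀ (i j : Letter m) (L L' : List (Letter m)), i.1 < j.1 →
        L.length + 1 = r → L'.length = L.length → inv (wordPerm L) = L.length →
        inv (wordPerm L') = L'.length →
        simple i * wordPerm L = simple j * wordPerm L' →
        inv (simple i * wordPerm L) = L.length + 1 →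
        EqSign (ONH.t k m i.1 * tauWord k L) (ONH.t k m j.1 * tauWord k L') := by
      clear hij hred' hred hL h hlen' hr hL' L L' i j
      intro i j L L' hij hr hlen hred hred' h hw
      set w := simple i * wordPerm L with hwdef
      have hL : wordPerm L = simple i * w := by rw [hwdef, simple_mul_cancel]
      have hL' : wordPerm L' = simple j * w := by rw [h, simple_mul_cancel]
      have hdi : w⁻¹ i.hi < w⁻¹ i.lo := inv_simple_mul_lt_iff.1 (by rw [← hL]; omega)
      have hdj : w⁻¹ j.hi < w⁻¹ j.lo := inv_simple_mul_lt_iff.1 (by rw [← hL']; omega)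
      by_cases hfar : i.1 + 1 < j.1
      · have hcomm := simple_mul_simple_far hfar
        have h1 : inv (simple j * (simple i * w)) + 1 = inv (simple i * w) := by
          refine inv_simple_mul_of_gt ?_
          rw [mul_inv_rev, simple_inv, Equiv.Perm.mul_apply, Equiv.Perm.mul_apply, simple_of_ne,
            simple_of_ne]
          · exact hdj
          all_goals
            simp only [Letter.hi, Letter.lo, ne_eq, Fin.mk.injEq]; omega
        obtain ⟨K, hK, hKl⟩ := exists_word (simple j * (simple i * w))
        rw [← hL] at h1
        have e1 : wordPerm L = wordPerm (j :: K) := by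
          rw [wordPerm_cons, hK, simple_mul_cancel, hL]
        have e2 : wordPerm L' = wordPerm (i :: K) := by
          rw [wordPerm_cons, hK, ← mul_assoc (simple j), ← hcomm, mul_assoc, simple_mul_cancel,
            hL']
        have l1 : (j :: K).length = L.length := by rw [List.length_cons, hKl, ← hL]; omega
        have f1 := (ih L.length (by omega) e1 hred l1 rfl).mul_left (ONH.t k m i.1)
        have f2 := (ih L'.length (by omega) e2 hred'
          (by rw [List.length_cons] at l1 ⊢; omega) rfl).mul_left (ONH.t k m j.1)
        rw [tauWord_cons, ← mul_assoc] at f1 f2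
        refine f1.trans (EqSign.trans ?_ f2.symm)
        rw [ONH.t_mul_t_far k i.2 j.2 (Or.inl hfar), neg_mul]
        exact EqSign.neg_left _
      · have hadj : i.1 + 1 = j.1 := by omega
        have hq := hi_eq_lo hadj
        have hbr := simple_braid hadj
        have e0 : simple i j.hi = j.hi := by
          refine simple_of_ne ?_ ?_ <;>
            (have := i.2; simp only [Letter.hi, Letter.lo, ne_eq, Fin.mk.injEq]; omega)
        have e0' : simple j i.lo = i.lo := by
          refine simple_of_ne ?_ ?_ <;>
            (have := i.2; simp only [Letter.hi, Letter.lo, ne_eq, Fin.mk.injEq]; omega)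
        have h1 : inv (simple j * (simple i * w)) + 1 = inv (simple i * w) := by
          refine inv_simple_mul_of_gt ?_
          rw [mul_inv_rev, simple_inv, Equiv.Perm.mul_apply, Equiv.Perm.mul_apply, ← hq,
            simple_hi, e0]
          exact hdj.trans (hq ▸ hdi)
        have h2 : inv (simple i * (simple j * (simple i * w))) + 1 =
            inv (simple j * (simple i * w)) := by
          refine inv_simple_mul_of_gt ?_
          rw [mul_inv_rev, mul_inv_rev, simple_inv, simple_inv, Equiv.Perm.mul_apply,
            Equiv.Perm.mul_apply, Equiv.Perm.mul_apply, Equiv.Perm.mul_apply, e0', simple_lo,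
            hq, simple_lo, e0, ← hq]
          exact hq ▸ hdj
        obtain ⟨K, hK, hKl⟩ := exists_word (simple i * (simple j * (simple i * w)))
        have e1 : wordPerm L = wordPerm (j :: i :: K) := by
          rw [wordPerm_cons, wordPerm_cons, hK, simple_mul_cancel, simple_mul_cancel, hL]
        have e2 : wordPerm L' = wordPerm (i :: j :: K) := by
          have : simple i * (simple j * (simple i * w)) = simple j * (simple i * (simple j * w)) := by
            have := congrArg (· * w) hbr
            simpa only [mul_assoc] using this
          rw [wordPerm_cons, wordPerm_cons, hK, this, simple_mul_cancel, simple_mul_cancel, hL']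
        rw [← hL] at h1 h2
        have l1 : (j :: i :: K).length = L.length := by
          rw [List.length_cons, List.length_cons, hKl, ← hL]; omega
        have f1 := (ih L.length (by omega) e1 hred l1 rfl).mul_left (ONH.t k m i.1)
        have f2 := (ih L'.length (by omega) e2 hred'
          (by rw [List.length_cons, List.length_cons] at l1 ⊢; omega) rfl).mul_left
            (ONH.t k m j.1)
        have hb := ONH.t_braid k (m := m) (i := i.1) ⟨i.2.1, by have := j.2; omega⟩
        rw [hadj] at hb
        rw [tauWord_cons, tauWord_cons, ← mul_assoc, ← mul_assoc] at f1 f2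
        rw [hb] at f1
        exact f1.trans f2.symm
    rcases lt_or_gt_of_ne (fun h' : i.1 = j.1 => hij (Subtype.ext h')) with h' | h'
    · exact key i j L L' h' hr hlen' hred hred' h hL
    · exact (key j i L' L h' (by omega) hlen'.symm hred' hred h.symm (by rw [← h]; omega)).symm

/-- The product of the `τ_i` along a word that is not reduced vanishes. -/
theorem tauWord_eq_zero {L : List (Letter m)} (h : inv (wordPerm L) < L.length) :
    tauWord k L = 0 := by
  induction L with
  | nil => simp at h
  | cons i L ih =>
    rw [wordPerm_cons, List.length_cons] at h
    rw [tauWord_cons]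
    by_cases hL : inv (wordPerm L) < L.length
    · rw [ih hL, mul_zero]
    have hred : inv (wordPerm L) = L.length := le_antisymm (inv_wordPerm_le L) (not_lt.1 hL)
    have hd : inv (simple i * wordPerm L) + 1 = inv (wordPerm L) :=
      (inv_simple_mul_cases (wordPerm L) i).resolve_left (by omega)
    -- The tail is reduced but has `i` as a left descent, so up to sign it can be rewritten to begin
    -- with `τ_i`; then `τ_i² = 0`.
    obtain ⟨K, hK, hKl⟩ := exists_word (simple i * wordPerm L)
    have h1 := (tauWord_eqSign k (L := L) (L' := i :: K)
      (by rw [wordPerm_cons, hK, simple_mul_cancel]) hred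
      (by rw [List.length_cons]; omega)).mul_left (ONH.t k m i.1)
    refine h1.eq_zero ?_
    rw [tauWord_cons, ← mul_assoc, ONH.t_mul_t_self k i.2, zero_mul]

end Words


/-! ## Homogeneous elements -/

section Homogeneous

variable (k : Type*) [Field k] {n m : ℕ}

@[simp] theorem ONH.parity_x (i : ℕ) : ONH.parity k m (ONH.x k m i) = -ONH.x k m i := by
  rw [ONH.x, ONH.parity_mk, freeParity_freeX, map_neg]

@[simp] theorem ONH.parity_t (i : ℕ) : ONH.parity k m (ONH.t k m i) = -ONH.t k m i := by
  rw [ONH.t, ONH.parity_mk, freeParity_freeT, map_neg]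

variable {k}

/-- The element `h` is homogeneous of parity `t`. -/
def HasParity (t : ℕ) (h : ONH k m) : Prop := ONH.parity k m h = (-1 : k) ^ t • h

theorem HasParity.mul {s t : ℕ} {g h : ONH k m} (hg : HasParity s g) (hh : HasParity t h) :
    HasParity (s + t) (g * h) := by
  rw [HasParity, map_mul, hg, hh, smul_mul_smul_comm, pow_add]

theorem hasParity_x (i : ℕ) : HasParity 1 (ONH.x k m i) := by simp [HasParity]

theorem hasParity_t (i : ℕ) : HasParity 1 (ONH.t k m i) := by simp [HasParity]

theorem hasParity_one : HasParity 0 (1 : ONH k m) := by simp [HasParity]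

/-- The element `h` is homogeneous. -/
def IsHomog (h : ONH k m) : Prop := ∃ t, HasParity t h

theorem IsHomog.mul {g h : ONH k m} (hg : IsHomog g) (hh : IsHomog h) : IsHomog (g * h) := by
  obtain ⟨s, hs⟩ := hg
  obtain ⟨t, ht⟩ := hh
  exact ⟨s + t, hs.mul ht⟩

theorem isHomog_one : IsHomog (1 : ONH k m) := ⟨0, hasParity_one⟩

theorem isHomog_x (i : ℕ) : IsHomog (ONH.x k m i) := ⟨1, hasParity_x i⟩

theorem isHomog_t (i : ℕ) : IsHomog (ONH.t k m i) := ⟨1, hasParity_t i⟩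

theorem IsHomog.pow {h : ONH k m} (hh : IsHomog h) (l : ℕ) : IsHomog (h ^ l) := by
  induction l with
  | zero => rw [pow_zero]; exact isHomog_one
  | succ l ih => rw [pow_succ]; exact ih.mul hh

theorem isHomog_list_prod {L : List (ONH k m)} (h : ∀ y ∈ L, IsHomog y) : IsHomog L.prod := by
  induction L with
  | nil => exact isHomog_one
  | cons y L ih =>
    rw [List.prod_cons]
    exact (h y List.mem_cons_self).mul (ih fun z hz => h z (List.mem_cons_of_mem _ hz))

theorem isHomog_neg_one_pow (l : ℕ) : IsHomog ((-1 : ONH k m) ^ l) :=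
  IsHomog.pow ⟨0, by simp [HasParity]⟩ l

theorem isHomog_monomial (a : Fin m → ℕ) : IsHomog (monomial k a) := by
  refine isHomog_list_prod fun y hy => ?_
  obtain ⟨i, rfl⟩ := List.mem_ofFn.1 hy
  exact (isHomog_x _).pow _

theorem isHomog_tauWord (L : List (Letter m)) : IsHomog (tauWord k L) := by
  refine isHomog_list_prod fun y hy => ?_
  obtain ⟨i, _, rfl⟩ := List.mem_map.1 hy
  exact isHomog_t _

theorem isHomog_tauLongest (l r : ℕ) : IsHomog (tauLongest k m l r) := by
  refine isHomog_list_prod fun y hy => ?_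
  obtain ⟨j, _, rfl⟩ := List.mem_map.1 hy
  refine isHomog_list_prod fun y hy => ?_
  obtain ⟨i, _, rfl⟩ := List.mem_map.1 hy
  exact isHomog_t _

theorem isHomog_xInt (l r : ℕ) : IsHomog (xInt k m l r) := by
  refine (isHomog_neg_one_pow _).mul (isHomog_list_prod fun y hy => ?_)
  obtain ⟨i, _, rfl⟩ := List.mem_map.1 hy
  exact (isHomog_x _).pow _

theorem isHomog_xInt' (l r : ℕ) : IsHomog (xInt' k m l r) := by
  refine (isHomog_neg_one_pow _).mul (isHomog_list_prod fun y hy => ?_)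
  obtain ⟨i, _, rfl⟩ := List.mem_map.1 hy
  exact (isHomog_x _).pow _

theorem isHomog_idem (l r : ℕ) : IsHomog (idem k m l r) :=
  (isHomog_tauLongest l r).mul (isHomog_xInt l r)

theorem isHomog_idem' (l r : ℕ) : IsHomog (idem' k m l r) :=
  (isHomog_xInt' l r).mul (isHomog_tauLongest l r)

theorem HasParity.mem_part {t : ℕ} {h : ONH k m} (hh : HasParity t h) :
    h ∈ ONH.part k m (t : ZMod 2) := by
  rcases Nat.even_or_odd t with ht | ht
  · rw [(ZMod.natCast_eq_zero_iff_even).2 ht]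
    exact (mem_parityPart_zero _ _).2 (by rw [hh, ht.neg_one_pow, one_smul])
  · rw [(ZMod.natCast_eq_one_iff_odd).2 ht]
    exact (mem_parityPart_one _ _).2 (by rw [hh, ht.neg_one_pow, neg_one_smul])

theorem A.iterate_parity_of_mem {t : ℕ} {j : ZMod 2} {c : A k n} (hc : c ∈ A.part k n j) :
    (A.parity k n)^[t] c = (-1 : ℤˣ) ^ (j * (t : ZMod 2)) • c := by
  have hj : ∀ j : ZMod 2, j = 0 ∨ j = 1 := by decide
  rcases hj j with rfl | rfl
  · have := (mem_parityPart_zero _ _).1 hc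
    rw [zero_mul, uzpow_zero, one_smul, Function.iterate_fixed this]
  · have := (mem_parityPart_one _ _).1 hc
    rw [one_mul, uzpow_natCast]
    induction t with
    | zero => simp
    | succ t ih =>
      rw [Function.iterate_succ_apply', ih, pow_succ]
      rcases Int.units_eq_one_or ((-1 : ℤˣ) ^ t) with h | h <;> simp [h, this, Units.smul_def]

theorem ONH.induction {p : ONH k m → Prop} (scalar : ∀ r, p (algebraMap k _ r))
    (x : ∀ i, 1 ≤ i → i ≤ m → p (ONH.x k m i)) (t : ∀ i, 1 ≤ i → i < m → p (ONH.t k m i))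
    (add : ∀ g h, p g → p h → p (g + h)) (mul : ∀ g h, p g → p h → p (g * h)) (h : ONH k m) :
    p h := by
  obtain ⟨z, rfl⟩ := RingQuot.mkAlgHom_surjective k (Rel k m) h
  change p (ONH.mk k m z)
  induction z using FreeAlgebra.induction with
  | grade0 r => rw [AlgHom.commutes]; exact scalar r
  | grade1 y =>
    rcases y with ⟨i, hi⟩ | ⟨i, hi⟩
    · have := x i hi.1 hi.2
      rwa [ONH.x, freeX, dif_pos hi] at this
    · have := t i hi.1 hi.2
      rwa [ONH.t, freeT, dif_pos hi] at this
  | mul a b ha hb => rw [map_mul]; exact mul _ _ ha hb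
  | add a b ha hb => rw [map_add]; exact add _ _ ha hb

theorem ONH.x_eq_zero {i : ℕ} (h : ¬(1 ≤ i ∧ i ≤ m)) : ONH.x k m i = 0 := by
  rw [ONH.x, freeX, dif_neg h, map_zero]

theorem ONH.x_mul_x {i j : ℕ} (h : i ≠ j) :
    ONH.x k m i * ONH.x k m j + ONH.x k m j * ONH.x k m i = 0 := by
  by_cases hi : 1 ≤ i ∧ i ≤ m
  · by_cases hj : 1 ≤ j ∧ j ≤ m
    · have := ONH.mk_rel k (Rel.x_x i j hi hj h)
      rwa [map_add, map_mul, map_mul, map_zero] at this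
    · rw [ONH.x_eq_zero hj, mul_zero, zero_mul, add_zero]
  · rw [ONH.x_eq_zero hi, mul_zero, zero_mul, add_zero]

theorem ONH.t_mul_x {i : ℕ} (hi : 1 ≤ i ∧ i < m) (j : ℕ) :
    ONH.t k m i * ONH.x k m j = (if j = i ∨ j = i + 1 then 1 else 0) -
      ONH.x k m (Equiv.swap i (i + 1) j) * ONH.t k m i := by
  by_cases h : j = i
  · subst h
    have := ONH.mk_rel k (Rel.t_x j hi)
    rw [map_add, map_mul, map_mul, map_one] at this
    rw [if_pos (Or.inl rfl), Equiv.swap_apply_left]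
    exact eq_sub_of_add_eq this
  by_cases h' : j = i + 1
  · subst h'
    have := ONH.mk_rel k (Rel.x_t i hi)
    rw [map_add, map_mul, map_mul, map_one] at this
    rw [if_pos (Or.inr rfl), Equiv.swap_apply_right]
    exact eq_sub_of_add_eq' this
  rw [if_neg (by tauto), Equiv.swap_apply_of_ne_of_ne h h', zero_sub]
  by_cases hj : 1 ≤ j ∧ j ≤ m
  · have := ONH.mk_rel k (Rel.x_t_far j i hj hi h h')
    rw [map_add, map_mul, map_mul, map_zero] at this
    exact eq_neg_of_add_eq_zero_right this
  · rw [ONH.x_eq_zero hj, mul_zero, zero_mul, neg_zero]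

theorem A.iterate_parity_iterate_parity (t : ℕ) (c : A k n) :
    (A.parity k n)^[t] ((A.parity k n)^[t] c) = c :=
  (Function.Involutive.iterate_even (A.parity_parity k n) ⟨t, rfl⟩ ▸
    (Function.iterate_add_apply (A.parity k n) t t c).symm :)

end Homogeneous

/-! ## The structure of the cyclotomic quotient -/

section Cyclotomic

variable {k : Type*} [Field k] [NeZero (2 : k)] {n m : ℕ}

-- The sign rule of the super tensor product, expressed by powers of the parity involution so that
-- it applies to inhomogeneous coefficients as well.
open GradedTensorProduct in
theorem CycQuot.ofA_mul_ofONH {t : ℕ} {h : ONH k m} (hh : HasParity t h) (c : A k n) :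
    ofA k n m c * ofONH k n m h = ofONH k n m h * ofA k n m ((A.parity k n)^[t] c) := by
  have key : includeRight (ONH.part k m) (A.part k n) c * includeLeft (ONH.part k m) (A.part k n) h
      = includeLeft (ONH.part k m) (A.part k n) h *
        includeRight (ONH.part k m) (A.part k n) ((A.parity k n)^[t] c) := by
    induction c using DirectSum.Decomposition.inductionOn (A.part k n) with
    | zero => rw [Function.iterate_fixed (map_zero _), map_zero, mul_zero, zero_mul]
    | @homogeneous j c =>
      rw [A.iterate_parity_of_mem c.2]
      have h1 := tmul_coe_mul_coe_tmul (R := k) (ONH.part k m) (A.part k n) 1 c ⟨h, hh.mem_part⟩ 1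
      have h2 := tmul_one_mul_one_tmul (R := k) (ONH.part k m) (A.part k n) h (c : A k n)
      rw [one_mul, mul_one] at h1
      rw [Units.smul_def, map_zsmul, mul_smul_comm, ← Units.smul_def]
      exact h1.trans (by rw [← h2]; rfl)
    | add c c' h1 h2 =>
      rw [map_add, add_mul, h1, h2, ← mul_add, ← map_add]
      congr 2
      exact (iterate_map_add (A.parity k n) t c c').symm
  have := congrArg (mk k n m) key
  rwa [map_mul, map_mul] at this

theorem CycQuot.ofA_mul_ofONH' {h : ONH k m} (hh : IsHomog h) :
    ∃ t : ℕ, ∀ c : A k n,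
      ofA k n m c * ofONH k n m h = ofONH k n m h * ofA k n m ((A.parity k n)^[t] c) :=
  ⟨_, ofA_mul_ofONH hh.choose_spec⟩

theorem CycQuot.ofONH_mul_ofA {t : ℕ} {h : ONH k m} (hh : HasParity t h) (c : A k n) :
    ofONH k n m h * ofA k n m c = ofA k n m ((A.parity k n)^[t] c) * ofONH k n m h := by
  rw [ofA_mul_ofONH hh, A.iterate_parity_iterate_parity]

theorem CycQuot.ofONH_mem_part {h : ONH k m} (hh : IsHomog h) :
    ∃ p, ofONH k n m h ∈ part k n m p := by
  obtain ⟨t, ht⟩ := hh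
  refine ⟨t, Submodule.subset_span ⟨t, 0, add_zero _, h, ht.mem_part, 1, ?_, rfl⟩⟩
  exact (mem_parityPart_zero _ _).2 (map_one _)

theorem CycQuot.induction {p : CycQuot k n m → Prop}
    (add : ∀ q q', p q → p q' → p (q + q'))
    (mul : ∀ h c, p (ofONH k n m h * ofA k n m c)) (q : CycQuot k n m) : p q := by
  obtain ⟨b, rfl⟩ := RingQuot.mkAlgHom_surjective k (CycRel k n m) q
  change p (CycQuot.mk k n m b)
  have hb : ∀ b : ONH k m ⊗[k] A k n,
      p (CycQuot.mk k n m (GradedTensorProduct.of k (ONH.part k m) (A.part k n) b)) := by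
    intro b
    induction b using TensorProduct.induction_on with
    | zero => have := mul 0 0; rwa [map_zero, zero_mul, ← map_zero (mk k n m)] at this
    | tmul h c =>
      have := mul h c
      have h2 := GradedTensorProduct.tmul_one_mul_one_tmul (R := k) (ONH.part k m) (A.part k n) h c
      rw [show GradedTensorProduct.of k (ONH.part k m) (A.part k n) (h ⊗ₜ c) = _ from h2.symm,
        map_mul]
      exact this
    | add b b' h h' => rw [map_add, map_add]; exact add _ _ h h'
  exact hb ((GradedTensorProduct.of k (ONH.part k m) (A.part k n)).symm b)

namespace CycQuot

variable (k n m)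

/-- The homomorphism from odd polynomials to the cyclotomic quotient. -/
def ofPoly : OddPoly k n →ₐ[k] CycQuot k n m :=
  OddPoly.lift (ofA k n m) (fun j => ofONH k n m (ONH.x k m j))
    (fun j c => by rw [ofONH_mul_ofA (hasParity_x j)]; rfl)
    (fun i j h => by rw [← map_mul, ← map_mul, ← map_add, ONH.x_mul_x h, map_zero])

variable {k n m}

@[simp] theorem ofPoly_x (j : ℕ) : ofPoly k n m (OddPoly.x j) = ofONH k n m (ONH.x k m j) :=
  OddPoly.lift_x _ _ _ _ j

@[simp] theorem ofPoly_C (c : A k n) : ofPoly k n m (OddPoly.C c) = ofA k n m c :=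
  OddPoly.lift_C _ _ _ _ c

theorem ofPoly_mono (a : Fin m → ℕ) :
    ofPoly k n m (OddPoly.mono k n a) = ofONH k n m (monomial k a) := by
  rw [OddPoly.mono, monomial, map_list_prod, map_list_prod, List.map_ofFn, List.map_ofFn]
  congr 2
  ext i
  simp

theorem ofPoly_cyc (hm : 1 ≤ m) : ofPoly k n m (OddPoly.cyc k n) = 0 := by
  have h : mk k n m (cycElement k n m) = mk k n m 0 :=
    RingQuot.mkAlgHom_rel k (show CycRel k n m (cycElement k n m) 0 from ⟨hm, rfl, rfl⟩)
  rw [map_zero, cycElement, map_sum] at h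
  rw [OddPoly.cyc, map_sum, ← h]
  refine Finset.sum_congr rfl fun l _ => ?_
  rw [map_smul, map_smul, map_mul, map_pow, ofPoly_x, ofPoly_C, ← map_pow]
  congr 1
  have h2 := GradedTensorProduct.tmul_one_mul_one_tmul (R := k) (ONH.part k m) (A.part k n)
    (ONH.x k m 1 ^ l) (A.c k n (n - l))
  rw [← h2, map_mul]
  rfl

/-- The relations between `τ_i` and the `x_j` give this on variables, and both sides are compatible
with products through the twisted Leibniz rule. Divided differences thus govern the multiplication
of the algebra itself. -/
theorem t_mul_ofPoly {i : ℕ} (hi : 1 ≤ i ∧ i < m) (f : OddPoly k n) :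
    ofONH k n m (ONH.t k m i) * ofPoly k n m f =
      ofPoly k n m (OddPoly.sg i f) * ofONH k n m (ONH.t k m i) + ofPoly k n m (OddPoly.dd i f) := by
  induction f using OddPoly.induction with
  | C c =>
    rw [OddPoly.sg_C, OddPoly.dd_C, map_zero, add_zero, ofPoly_C, ofPoly_C,
      ofONH_mul_ofA (hasParity_t i)]
    rfl
  | x j =>
    rw [ofPoly_x, ← map_mul, ONH.t_mul_x hi, OddPoly.sg_x, OddPoly.dd_x, map_neg, ofPoly_x, map_sub,
      map_mul, sub_eq_neg_add, neg_mul]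
    congr 1
    split_ifs <;> simp
  | add f g hf hg => simp only [map_add, mul_add, add_mul, hf, hg]; abel
  | mul f g hf hg =>
    rw [map_mul, ← mul_assoc, hf, add_mul, mul_assoc, hg, OddPoly.dd_mul]
    simp only [map_add, map_mul, mul_add, mul_assoc]
    abel

end CycQuot

end Cyclotomic


/-! ### Spanning of the cyclotomic quotient by the elements `x^a τ_w` -/

section Span

variable {k : Type*} [Field k] {m : ℕ} {red : Equiv.Perm (Fin m) → List (Letter m)}

theorem tauWord_eqSign_red (hred : ∀ w, IsReduced w (red w))
    {L : List (Letter m)} (h : inv (wordPerm L) = L.length) :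
    EqSign (tauWord k L) (tauWord k (red (wordPerm L))) :=
  tauWord_eqSign k (hred _).1.symm h (by rw [(hred _).length_eq, h])

/-- Left multiplication by a generator maps the element of a permutation to zero or to the element
of a longer permutation. -/
theorem t_mul_tauWord_red (hred : ∀ w, IsReduced w (red w))
    (i : Letter m) (w : Equiv.Perm (Fin m)) :
    (ONH.t k m i.1 * tauWord k (red w) = 0) ∨ (inv (simple i * w) = inv w + 1 ∧
      EqSign (ONH.t k m i.1 * tauWord k (red w)) (tauWord k (red (simple i * w)))) := by
  rw [← tauWord_cons]
  have hw : wordPerm (i :: red w) = simple i * w := by rw [wordPerm_cons, (hred w).1]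
  have hl : (i :: red w).length = inv w + 1 := by rw [List.length_cons, (hred w).length_eq]
  rcases inv_simple_mul_cases w i with h | h
  · right
    refine ⟨h, ?_⟩
    have := tauWord_eqSign_red (k := k) hred (L := i :: red w) (by rw [hw, hl, h])
    rwa [hw] at this
  · left
    exact tauWord_eq_zero k (by rw [hw, hl]; omega)

theorem tauWord_red_one (hred : ∀ w, IsReduced w (red w)) :
    tauWord k (red 1) = 1 := by
  have := (hred 1).length_eq
  rw [inv_one, List.length_eq_zero_iff] at this
  rw [this, tauWord_nil]

theorem EqSign.mem {R : Type*} [Ring R] [Algebra k R] {V : Submodule k R} {a b : R}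
    (h : EqSign a b) (hb : b ∈ V) : a ∈ V := by
  rcases h with rfl | rfl
  · exact hb
  · exact neg_mem hb

variable [NeZero (2 : k)] {n : ℕ}

open CycQuot

/-- The span of the `f τ_w` with `f` an odd polynomial and `w` of length at least `r`. -/
def polySpan (k : Type*) [Field k] [NeZero (2 : k)] (n : ℕ)
    (red : Equiv.Perm (Fin m) → List (Letter m)) (r : ℕ) : Submodule k (CycQuot k n m) :=
  Submodule.span k {q | ∃ f w, r ≤ inv w ∧ q = ofPoly k n m f * ofONH k n m (tauWord k (red w))}

/-- The span of the `x^a τ_w c` with `a ∈ X_m`, `c ∈ A_n` and `w` of length at least `r`. -/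
def basisSpan (k : Type*) [Field k] [NeZero (2 : k)] (n : ℕ)
    (red : Equiv.Perm (Fin m) → List (Letter m)) (r : ℕ) : Submodule k (CycQuot k n m) :=
  Submodule.span k {q | ∃ a ∈ X n m, ∃ w, r ≤ inv w ∧ ∃ c,
    q = ofONH k n m (monomial k a * tauWord k (red w)) * ofA k n m c}

theorem ofPoly_mul_tauWord_mem {r : ℕ} (f : OddPoly k n) {w : Equiv.Perm (Fin m)} (h : r ≤ inv w) :
    ofPoly k n m f * ofONH k n m (tauWord k (red w)) ∈ polySpan k n red r :=
  Submodule.subset_span ⟨f, w, h, rfl⟩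

theorem polySpan_anti {r s : ℕ} (h : r ≤ s) : polySpan k n red s ≤ polySpan k n red r :=
  Submodule.span_mono fun _ ⟨f, w, hw, hq⟩ => ⟨f, w, h.trans hw, hq⟩

theorem basisSpan_anti {r s : ℕ} (h : r ≤ s) : basisSpan k n red s ≤ basisSpan k n red r :=
  Submodule.span_mono fun _ ⟨a, ha, w, hw, hq⟩ => ⟨a, ha, w, h.trans hw, hq⟩

theorem ofPoly_mul_mem_polySpan {r : ℕ} (f : OddPoly k n) {q : CycQuot k n m}
    (hq : q ∈ polySpan k n red r) : ofPoly k n m f * q ∈ polySpan k n red r := by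
  have h2 := Submodule.mem_map_of_mem (f := LinearMap.mulLeft k (ofPoly k n m f)) hq
  rw [polySpan, Submodule.map_span] at h2
  refine Submodule.span_mono ?_ h2
  rintro _ ⟨_, ⟨g, w, hw, rfl⟩, rfl⟩
  exact ⟨f * g, w, hw, by rw [LinearMap.mulLeft_apply, map_mul, mul_assoc]⟩

/-- `τ_i f τ_w` consists of a term with `τ_i τ_w`, which is zero or belongs to a longer permutation,
and of `∂_i(f) τ_w`; no term gets shorter. -/
theorem t_mul_mem_polySpan (hred : ∀ w, IsReduced w (red w)) {r i : ℕ}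
    (hi : 1 ≤ i ∧ i < m) {q : CycQuot k n m}
    (hq : q ∈ polySpan k n red r) : ofONH k n m (ONH.t k m i) * q ∈ polySpan k n red r := by
  refine Submodule.span_le (p := (polySpan k n red r).comap
    (LinearMap.mulLeft k (ofONH k n m (ONH.t k m i)))).2 ?_ hq
  rintro _ ⟨f, w, hw, rfl⟩
  rw [SetLike.mem_coe, Submodule.mem_comap, LinearMap.mulLeft_apply, ← mul_assoc,
    t_mul_ofPoly hi, add_mul, mul_assoc, ← map_mul]
  refine add_mem ?_ (ofPoly_mul_tauWord_mem _ hw)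
  rcases t_mul_tauWord_red (k := k) hred ⟨i, hi⟩ w with h | ⟨h1, h2⟩
  · simp only at h
    rw [h, map_zero, mul_zero]
    exact zero_mem _
  · exact ((h2.map (ofONH k n m)).mul_left _).mem (ofPoly_mul_tauWord_mem _ (by omega))

/-- Modulo longer permutations, the flag ideal acts by zero. -/
theorem flag_mul_tauWord_mem (hred : ∀ w, IsReduced w (red w))
    {j : ℕ} (hj : j < m) (w : Equiv.Perm (Fin m)) :
    ofPoly k n m (OddPoly.flag k n j) * ofONH k n m (tauWord k (red w)) ∈
      polySpan k n red (inv w + 1) := by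
  induction j with
  | zero => rw [OddPoly.flag, ofPoly_cyc (by omega), zero_mul]; exact zero_mem _
  | succ j ih =>
    have hi : 1 ≤ j + 1 ∧ j + 1 < m := ⟨by omega, hj⟩
    -- Multiplying the previous membership by `τ_{j+1}` yields `∂_{j+1}` of the previous polynomial
    -- times `τ_w`, plus a term with `τ_{j+1} τ_w`, which is already longer.
    have h1 := t_mul_mem_polySpan hred hi (ih (by omega))
    rw [← mul_assoc, t_mul_ofPoly hi, add_mul, mul_assoc, ← map_mul] at h1
    rw [OddPoly.flag]
    refine (Submodule.add_mem_iff_right _ ?_).1 h1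
    rcases t_mul_tauWord_red (k := k) hred ⟨j + 1, hi⟩ w with h | ⟨h1, h2⟩
    · simp only at h
      rw [h, map_zero, mul_zero]
      exact zero_mem _
    · exact ((h2.map (ofONH k n m)).mul_left _).mem (ofPoly_mul_tauWord_mem _ (by omega))

/-- `OddPoly` has a variable for every natural number; those outside `1, …, m` become zero in the
algebra. -/
theorem exists_vars_ofPoly_eq (f : OddPoly k n) :
    ∃ g ∈ OddPoly.vars k n m, ofPoly k n m f = ofPoly k n m g := by
  induction f using OddPoly.induction with
  | C c => exact ⟨_, OddPoly.C_mem_vars _ c, rfl⟩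
  | x j =>
    by_cases h : 1 ≤ j ∧ j ≤ m
    · exact ⟨_, OddPoly.x_mem_vars h.1 h.2, rfl⟩
    · exact ⟨0, zero_mem _, by rw [ofPoly_x, ONH.x_eq_zero h, map_zero, map_zero]⟩
  | add f g hf hg =>
    obtain ⟨f', h1, h2⟩ := hf
    obtain ⟨g', h3, h4⟩ := hg
    exact ⟨f' + g', add_mem h1 h3, by rw [map_add, h2, h4, map_add]⟩
  | mul f g hf hg =>
    obtain ⟨f', h1, h2⟩ := hf
    obtain ⟨g', h3, h4⟩ := hg
    exact ⟨f' * g', mul_mem h1 h3, by rw [map_mul, h2, h4, map_mul]⟩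

theorem inv_le_longest (w : Equiv.Perm (Fin m)) : inv w ≤ inv (longest m) := by
  have := inv_mul_longest w
  omega

/-- Descending induction on the length: modulo the flag ideal a polynomial reduces to monomials with
exponents in `X_m`, and the part in the ideal is pushed to longer permutations by
`flag_mul_tauWord_mem`. Lengths are bounded, so the process stops. -/
theorem polySpan_le_basisSpan (hred : ∀ w, IsReduced w (red w)) (r : ℕ) :
    polySpan k n red r ≤ basisSpan k n red r := by
  obtain ⟨d, hd⟩ : ∃ d, inv (longest m) + 1 ≤ r + d := ⟨inv (longest m) + 1, by omega⟩
  induction d generalizing r with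
  | zero =>
    refine Submodule.span_le.2 ?_
    rintro _ ⟨f, w, hw, rfl⟩
    have := inv_le_longest w
    omega
  | succ d ih =>
    refine Submodule.span_le.2 ?_
    rintro _ ⟨f, w, hw, rfl⟩
    obtain ⟨g, hg, hfg⟩ := exists_vars_ofPoly_eq (m := m) f
    rw [hfg, SetLike.mem_coe]
    obtain ⟨u, hu, v, hv, rfl⟩ := Submodule.mem_sup.1 (OddPoly.vars_le_monoSpan_sup m hg)
    rw [map_add, add_mul]
    refine add_mem ?_ ?_
    · clear hfg hg
      refine Submodule.span_le (p := (basisSpan k n red r).comap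
        (LinearMap.mulRight k (ofONH k n m (tauWord k (red w))) ∘ₗ
          (ofPoly k n m).toLinearMap)).2 ?_ hu
      rintro _ ⟨a, ha, c, rfl⟩
      obtain ⟨t, ht⟩ := isHomog_tauWord (k := k) (red w)
      refine Submodule.subset_span ⟨a, ha, w, hw, (A.parity k n)^[t] c, ?_⟩
      simp only [LinearMap.comp_apply, LinearMap.mulRight_apply, AlgHom.toLinearMap_apply]
      rw [map_mul, ofPoly_mono, ofPoly_C, mul_assoc, ofA_mul_ofONH ht, ← mul_assoc, ← map_mul]
    · refine basisSpan_anti (Nat.le_succ r) (ih (r + 1) (by omega) ?_)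
      rw [Submodule.restrictScalars_mem] at hv
      clear hfg hg
      induction hv using OddPoly.flagIdeal_induction with
      | zero => rw [map_zero, zero_mul]; exact zero_mem _
      | add f g _ _ hf hg => rw [map_add, add_mul]; exact add_mem hf hg
      | gen q j hj =>
        rw [map_mul, mul_assoc]
        exact ofPoly_mul_mem_polySpan _
          (polySpan_anti (by omega) (flag_mul_tauWord_mem hred hj w))

theorem polySpan_zero (hred : ∀ w, IsReduced w (red w)) :
    polySpan k n red 0 = ⊤ := by
  refine top_unique fun q _ => ?_
  have h1 : ∀ (h : ONH k m) (q : CycQuot k n m), q ∈ polySpan k n red 0 →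
      ofONH k n m h * q ∈ polySpan k n red 0 := by
    intro h
    induction h using ONH.induction with
    | scalar r =>
      intro q hq
      rw [AlgHom.commutes, ← Algebra.smul_def]
      exact Submodule.smul_mem _ _ hq
    | x i _ _ =>
      intro q hq
      rw [← ofPoly_x]
      exact ofPoly_mul_mem_polySpan _ hq
    | t i hi hi' => exact fun q hq => t_mul_mem_polySpan hred ⟨hi, hi'⟩ hq
    | add g h hg hh => intro q hq; rw [map_add, add_mul]; exact add_mem (hg q hq) (hh q hq)
    | mul g h hg hh => intro q hq; rw [map_mul, mul_assoc]; exact hg _ (hh q hq)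
  induction q using CycQuot.induction with
  | add q q' h h' => exact add_mem (h trivial) (h' trivial)
  | mul h c =>
    refine h1 _ _ ?_
    have := ofPoly_mul_tauWord_mem (red := red) (OddPoly.C c) (Nat.zero_le (inv (1 : Equiv.Perm (Fin m))))
    rwa [tauWord_red_one hred, map_one, mul_one, ofPoly_C] at this

/-- The elements `x^a τ_w` span the cyclotomic quotient. -/
theorem basisSpan_zero (hred : ∀ w, IsReduced w (red w)) :
    basisSpan k n red 0 = ⊤ :=
  top_unique ((polySpan_zero hred).ge.trans (polySpan_le_basisSpan hred 0))

end Span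


/-! ## The polynomial representation -/

section Action

variable (k : Type*) [Field k] (n m : ℕ)

open OddPoly

/-- The operators of the polynomial representation. -/
def freeAct : FreeAlgebra k (Gen m) →ₐ[k] Module.End k (OddPoly k n) :=
  FreeAlgebra.lift k fun g => match g with
    | Gen.x i _ => LinearMap.mulLeft k (OddPoly.x i)
    | Gen.t i _ => dd i

variable {k n m}

theorem freeAct_freeX {i : ℕ} (h : 1 ≤ i ∧ i ≤ m) (f : OddPoly k n) :
    freeAct k n m (freeX k m i) f = OddPoly.x i * f := by
  simp [freeX, freeAct, h]

theorem freeAct_freeT {i : ℕ} (h : 1 ≤ i ∧ i < m) (f : OddPoly k n) :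
    freeAct k n m (freeT k m i) f = dd i f := by
  simp [freeT, freeAct, h]

variable (k n m)

/-- The polynomial representation of the odd nilHecke algebra. -/
def act : ONH k m →ₐ[k] Module.End k (OddPoly k n) :=
  RingQuot.liftAlgHom k ⟨freeAct k n m, fun a b h => by
    ext f
    cases h with
    | t_sq i hi => simp [freeAct_freeT hi, dd_dd]
    | braid i hi =>
      have h1 : 1 ≤ i ∧ i < m := by omega
      have h2 : 1 ≤ i + 1 ∧ i + 1 < m := by omega
      simp [freeAct_freeT h1, freeAct_freeT h2, dd_braid]
    | x_t i hi =>
      have h1 : 1 ≤ i ∧ i ≤ m := by omega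
      have h2 : 1 ≤ i + 1 ∧ i + 1 ≤ m := by omega
      simp [freeAct_freeT hi, freeAct_freeX h1, freeAct_freeX h2, dd_x_succ_mul]
    | t_x i hi =>
      have h1 : 1 ≤ i ∧ i ≤ m := by omega
      have h2 : 1 ≤ i + 1 ∧ i + 1 ≤ m := by omega
      simp [freeAct_freeT hi, freeAct_freeX h1, freeAct_freeX h2, dd_x_mul]
    | x_x i j hi hj hij =>
      simp [freeAct_freeX hi, freeAct_freeX hj, ← mul_assoc, x_mul_x hij]
    | t_t i j hi hj hij =>
      rcases hij with h | h <;> simp [freeAct_freeT hi, freeAct_freeT hj, dd_dd_far h]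
    | x_t_far i j hi hj h0 h1 =>
      simp [freeAct_freeX hi, freeAct_freeT hj, dd_x_mul_of_ne h0 h1]⟩

variable {k n m}

theorem act_mk (z : FreeAlgebra k (Gen m)) : act k n m (ONH.mk k m z) = freeAct k n m z :=
  RingQuot.liftAlgHom_mkAlgHom_apply _ _ _ _

theorem act_x {i : ℕ} (h : 1 ≤ i ∧ i ≤ m) (f : OddPoly k n) :
    act k n m (ONH.x k m i) f = OddPoly.x i * f := by
  rw [ONH.x, act_mk, freeAct_freeX h]

theorem act_t {i : ℕ} (h : 1 ≤ i ∧ i < m) (f : OddPoly k n) :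
    act k n m (ONH.t k m i) f = dd i f := by
  rw [ONH.t, act_mk, freeAct_freeT h]

theorem act_monomial (a : Fin m → ℕ) (f : OddPoly k n) :
    act k n m (monomial k a) f = mono k n a * f := by
  have hpow : ∀ (i e : ℕ) (hi : 1 ≤ i ∧ i ≤ m) (f : OddPoly k n),
      act k n m (ONH.x k m i ^ e) f = OddPoly.x i ^ e * f := by
    intro i e hi f
    induction e with
    | zero => simp
    | succ e ih => rw [pow_succ', map_mul, Module.End.mul_apply, ih, act_x hi, pow_succ', mul_assoc]
  have key : ∀ (L : List (Fin m)) (f : OddPoly k n),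
      act k n m (L.map fun i => ONH.x k m (i.1 + 1) ^ a i).prod f =
        (L.map fun i => (OddPoly.x (i.1 + 1) : OddPoly k n) ^ a i).prod * f := by
    intro L f
    induction L with
    | nil => simp
    | cons i L ih => rw [List.map_cons, List.prod_cons, map_mul, Module.End.mul_apply, ih,
        hpow _ _ (by omega), List.map_cons, List.prod_cons, mul_assoc]
  rw [monomial, mono, List.ofFn_eq_map, List.ofFn_eq_map]
  exact key _ f

theorem act_mul_C (h : ONH k m) (f : OddPoly k n) (c : A k n) :
    act k n m h (f * C c) = act k n m h f * C c := by
  induction h using ONH.induction generalizing f with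
  | scalar r => simp [Module.algebraMap_end_apply]
  | x i hi hi' => rw [act_x ⟨hi, hi'⟩, act_x ⟨hi, hi'⟩, mul_assoc]
  | t i hi hi' => rw [act_t ⟨hi, hi'⟩, act_t ⟨hi, hi'⟩, dd_mul_C]
  | add g h hg hh => simp only [map_add, LinearMap.add_apply, hg, hh, add_mul]
  | mul g h hg hh => simp only [map_mul, Module.End.mul_apply, hg, hh]

theorem act_mem_flagIdeal (h : ONH k m) {f : OddPoly k n} (hf : f ∈ flagIdeal k n m) :
    act k n m h f ∈ flagIdeal k n m := by
  induction h using ONH.induction generalizing f with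
  | scalar r =>
    rw [AlgHom.commutes, Module.algebraMap_end_apply]
    exact flagIdeal_smul_mem r hf
  | x i hi hi' => rw [act_x ⟨hi, hi'⟩]; exact flagIdeal_mul_mem _ hf
  | t i hi hi' => rw [act_t ⟨hi, hi'⟩]; exact dd_mem_flagIdeal hi hi' hf
  | add g h hg hh => rw [map_add, LinearMap.add_apply]; exact add_mem (hg hf) (hh hf)
  | mul g h hg hh => rw [map_mul, Module.End.mul_apply]; exact hg (hh hf)

end Action

/-- The algebra of endomorphisms that preserve a submodule. -/
def stabilizerAlgebra {k M : Type*} [Field k] [AddCommGroup M] [Module k M] (J : Submodule k M) :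
    Subalgebra k (Module.End k M) where
  carrier := {φ | ∀ y ∈ J, φ y ∈ J}
  mul_mem' := fun h h' y hy => h _ (h' y hy)
  add_mem' := fun {a b} (h : ∀ y ∈ J, a y ∈ J) (h' : ∀ y ∈ J, b y ∈ J) y hy =>
    J.add_mem (h y hy) (h' y hy)
  algebraMap_mem' := fun r _ hy => J.smul_mem r hy

/-- The induced action on the quotient. -/
def stabilizerAct {k M : Type*} [Field k] [AddCommGroup M] [Module k M] (J : Submodule k M) :
    stabilizerAlgebra J →ₐ[k] Module.End k (M ⧸ J) where
  toFun φ := J.mapQ J φ.1 (show ∀ y ∈ J, φ.1 y ∈ J from φ.2)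
  map_one' := by ext; rfl
  map_mul' _ _ := by ext; rfl
  map_zero' := by ext; rfl
  map_add' _ _ := by ext; rfl
  commutes' _ := by ext; rfl

section Action

variable {k : Type*} [Field k] {n m : ℕ}

open OddPoly

/-- This sign is the compatibility required for combining the actions of `ONH_m` and `A_n` into one
of the super tensor product. -/
theorem act_mul_C_mul {i j : ZMod 2} {h : ONH k m} (hh : h ∈ ONH.part k m i) {c : A k n}
    (hc : c ∈ A.part k n j) (f : OddPoly k n) :
    act k n m h (C c * f) = (-1 : ℤˣ) ^ (j * i) • (C c * act k n m h f) := by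
  have h2 : ∀ j : ZMod 2, j = 0 ∨ j = 1 := by decide
  rcases h2 j with rfl | rfl
  · rw [zero_mul, uzpow_zero, one_smul]
    have hc' := (mem_parityPart_zero _ _).1 hc
    clear hh
    induction h using ONH.induction generalizing f with
    | scalar r => simp [Module.algebraMap_end_apply]
    | x i hi hi' => rw [act_x ⟨hi, hi'⟩, act_x ⟨hi, hi'⟩, ← mul_assoc, x_mul_C, hc', mul_assoc]
    | t i hi hi' => rw [act_t ⟨hi, hi'⟩, act_t ⟨hi, hi'⟩, dd_C_mul, hc']
    | add g h hg hh => simp only [map_add, LinearMap.add_apply, hg, hh, mul_add]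
    | mul g h hg hh => simp only [map_mul, Module.End.mul_apply, hg, hh]
  · rw [one_mul]
    have hc' := (mem_parityPart_one _ _).1 hc
    have key : ∀ f, act k n m h (C c * f) = C c * act k n m (ONH.parity k m h) f := by
      clear hh
      induction h using ONH.induction with
      | scalar r => intro f; simp [Module.algebraMap_end_apply]
      | x i hi hi' =>
        intro f
        rw [ONH.parity_x, map_neg, LinearMap.neg_apply, act_x ⟨hi, hi'⟩, act_x ⟨hi, hi'⟩,
          ← mul_assoc, x_mul_C, hc', map_neg, neg_mul, neg_mul, mul_neg, mul_assoc]
      | t i hi hi' =>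
        intro f
        rw [ONH.parity_t, map_neg, LinearMap.neg_apply, act_t ⟨hi, hi'⟩, act_t ⟨hi, hi'⟩,
          dd_C_mul, hc', map_neg, neg_mul, mul_neg]
      | add g h hg hh => intro f; simp only [map_add, LinearMap.add_apply, hg, hh, mul_add]
      | mul g h hg hh => intro f; simp only [map_mul, Module.End.mul_apply, hg, hh]
    rw [key]
    rcases h2 i with rfl | rfl
    · rw [(mem_parityPart_zero _ _).1 hh, uzpow_zero, one_smul]
    · rw [(mem_parityPart_one _ _).1 hh, uzpow_one, map_neg, LinearMap.neg_apply, mul_neg,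
        Units.neg_smul, one_smul]

variable (k n m) [NeZero (2 : k)]

/-- The polynomial representation of `ONH_m ⊗ A_n`. -/
def superAct : SuperTensor k n m →ₐ[k] Module.End k (OddPoly k n) :=
  GradedTensorProduct.lift _ _ (act k n m)
    ((Algebra.lmul k (OddPoly k n)).comp OddPoly.C) (fun i j a b => by
      ext f
      exact act_mul_C_mul a.2 b.2 f)

/-- The space on which the cyclotomic quotient acts. -/
abbrev FlagQuot : Type _ := OddPoly k n ⧸ (flagIdeal k n m).restrictScalars k

variable {k n m}

theorem superAct_mem (b : SuperTensor k n m) :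
    superAct k n m b ∈ stabilizerAlgebra ((flagIdeal k n m).restrictScalars k) := by
  have hb : ∀ b : ONH k m ⊗[k] A k n,
      superAct k n m (GradedTensorProduct.of k (ONH.part k m) (A.part k n) b) ∈
        stabilizerAlgebra ((flagIdeal k n m).restrictScalars k) := by
    intro b
    induction b using TensorProduct.induction_on with
    | zero => rw [map_zero, map_zero]; exact zero_mem _
    | tmul h c =>
      change ∀ f ∈ flagIdeal k n m, act k n m h (C c * f) ∈ flagIdeal k n m
      exact fun f hf => act_mem_flagIdeal h (flagIdeal_mul_mem _ hf)
    | add b b' h h' => rw [map_add, map_add]; exact add_mem h h'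
  exact hb ((GradedTensorProduct.of k (ONH.part k m) (A.part k n)).symm b)

theorem superAct_cycElement (hm : 1 ≤ m) (f : OddPoly k n) :
    superAct k n m (cycElement k n m) f = cyc k n * f := by
  rw [cycElement, cyc, map_sum, LinearMap.sum_apply, Finset.sum_mul]
  refine Finset.sum_congr rfl fun l hl => ?_
  clear hl
  rw [map_smul, LinearMap.smul_apply, smul_mul_assoc, mul_assoc]
  congr 1
  change act k n m (ONH.x k m 1 ^ l) (C (A.c k n (n - l)) * f) = _
  generalize C (A.c k n (n - l)) * f = g
  induction l with
  | zero => simp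
  | succ l ih => rw [pow_succ', map_mul, Module.End.mul_apply, ih, act_x ⟨le_rfl, hm⟩, pow_succ',
      mul_assoc]

variable (k n m)

/-- The action of the cyclotomic quotient. -/
def cycAct (hm : 1 ≤ m) : CycQuot k n m →ₐ[k] Module.End k (FlagQuot k n m) :=
  RingQuot.liftAlgHom k
    ⟨(stabilizerAct _).comp ((superAct k n m).codRestrict _ superAct_mem), fun a b h => by
      obtain ⟨_, rfl, rfl⟩ := h
      rw [map_zero]
      refine Submodule.linearMap_qext _ (LinearMap.ext fun f => ?_)
      refine (Submodule.Quotient.mk_eq_zero _).2 ?_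
      change superAct k n m (cycElement k n m) f ∈ _
      rw [superAct_cycElement hm]
      exact cyc_mul_mem_flagIdeal hm f⟩

variable {k n m}

theorem cycAct_mk (hm : 1 ≤ m) (b : SuperTensor k n m) (f : OddPoly k n) :
    cycAct k n m hm (CycQuot.mk k n m b) (Submodule.Quotient.mk f) =
      Submodule.Quotient.mk (superAct k n m b f) := by
  have : cycAct k n m hm (CycQuot.mk k n m b) = _ := RingQuot.liftAlgHom_mkAlgHom_apply _ _ _ _
  rw [this]
  rfl

theorem cycAct_ofONH (hm : 1 ≤ m) (h : ONH k m) (f : OddPoly k n) :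
    cycAct k n m hm (CycQuot.ofONH k n m h) (Submodule.Quotient.mk f) =
      Submodule.Quotient.mk (act k n m h f) := by
  refine (cycAct_mk hm _ f).trans ?_
  congr 1
  change act k n m h (C 1 * f) = _
  rw [map_one, one_mul]

theorem cycAct_ofA (hm : 1 ≤ m) (c : A k n) (f : OddPoly k n) :
    cycAct k n m hm (CycQuot.ofA k n m c) (Submodule.Quotient.mk f) =
      Submodule.Quotient.mk (C c * f) := by
  refine (cycAct_mk hm _ f).trans ?_
  congr 1
  change act k n m 1 (C c * f) = _
  rw [map_one, Module.End.one_apply]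

end Action


/-! ## Words of natural numbers -/

section NatWords

/-- The word `(l ⋯ (l+N-1)) (l ⋯ (l+N-2)) ⋯ l` of the longest permutation of `[l, l+N]`. -/
def upWord (l : ℕ) : ℕ → List ℕ
  | 0 => []
  | N + 1 => List.range' l (N + 1) ++ upWord l N

/-- The word `((l+N-1) ⋯ l) ((l+N-1) ⋯ (l+1)) ⋯ (l+N-1)` of the longest permutation of
`[l, l+N]`. -/
def downWord : ℕ → ℕ → List ℕ
  | _, 0 => []
  | l, N + 1 => (List.range' l (N + 1)).reverse ++ downWord (l + 1) N

theorem mem_upWord {l N i : ℕ} (h : i ∈ upWord l N) : l ≤ i ∧ i < l + N := by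
  induction N with
  | zero => simp [upWord] at h
  | succ N ih =>
    rcases List.mem_append.1 h with h | h
    · rw [List.mem_range'_1] at h; omega
    · have := ih h; omega

theorem mem_downWord {l N i : ℕ} (h : i ∈ downWord l N) : l ≤ i ∧ i < l + N := by
  induction N generalizing l with
  | zero => simp [downWord] at h
  | succ N ih =>
    rcases List.mem_append.1 h with h | h
    · rw [List.mem_reverse, List.mem_range'_1] at h; omega
    · have := ih h; omega

theorem length_upWord (l N : ℕ) : (upWord l N).length = (N + 1).choose 2 := by
  induction N with
  | zero => rfl
  | succ N ih => rw [upWord, List.length_append, ih, List.length_range', Nat.choose_succ_succ' (N + 1),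
      Nat.choose_one_right]

theorem length_downWord (l N : ℕ) : (downWord l N).length = (N + 1).choose 2 := by
  induction N generalizing l with
  | zero => rfl
  | succ N ih => rw [downWord, List.length_append, ih, List.length_reverse, List.length_range',
      Nat.choose_succ_succ' (N + 1), Nat.choose_one_right]

theorem exists_map_val_eq {m : ℕ} {L : List ℕ} (h : ∀ i ∈ L, 1 ≤ i ∧ i < m) :
    ∃ L' : List (Letter m), L'.map Subtype.val = L := by
  lift L to List (Letter m) using h
  exact ⟨L, rfl⟩

/-- The product of the transpositions of `i-1` and `i` along a word. -/
def natPerm (L : List ℕ) : Equiv.Perm ℕ := (L.map fun i => Equiv.swap (i - 1) i).prod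

theorem natPerm_cons (i : ℕ) (L : List ℕ) : natPerm (i :: L) = Equiv.swap (i - 1) i * natPerm L := by
  rw [natPerm, List.map_cons, List.prod_cons, natPerm]

theorem natPerm_append (L L' : List ℕ) : natPerm (L ++ L') = natPerm L * natPerm L' := by
  rw [natPerm, List.map_append, List.prod_append, natPerm, natPerm]

theorem wordPerm_val {m : ℕ} (L : List (Letter m)) (a : Fin m) :
    (wordPerm L a).1 = natPerm (L.map Subtype.val) a.1 := by
  induction L with
  | nil => rfl
  | cons i L ih =>
    rw [wordPerm_cons, Equiv.Perm.mul_apply, simple_val, ih, List.map_cons, natPerm_cons,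
      Equiv.Perm.mul_apply, Equiv.swap_apply_def]

theorem natPerm_range' (s N p : ℕ) : natPerm (List.range' (s + 1) N) p =
    if s ≤ p ∧ p < s + N then p + 1 else if p = s + N then s else p := by
  induction N generalizing s with
  | zero =>
    simp only [natPerm, List.range'_zero, List.map_nil, List.prod_nil, Equiv.Perm.one_apply]
    split_ifs <;> omega
  | succ N ih =>
    rw [List.range'_succ, natPerm_cons, Equiv.Perm.mul_apply, ih (s + 1), Nat.add_sub_cancel,
      Equiv.swap_apply_def]
    split_ifs <;> omega

theorem natPerm_reverse_range' (s N p : ℕ) : natPerm (List.range' (s + 1) N).reverse p =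
    if s < p ∧ p ≤ s + N then p - 1 else if p = s then s + N else p := by
  induction N with
  | zero =>
    simp only [natPerm, List.range'_zero, List.reverse_nil, List.map_nil, List.prod_nil,
      Equiv.Perm.one_apply]
    split_ifs <;> omega
  | succ N ih =>
    rw [List.range'_1_concat, List.reverse_append, natPerm_append, Equiv.Perm.mul_apply, ih,
      List.reverse_singleton, natPerm_cons, Equiv.Perm.mul_apply, Equiv.swap_apply_def]
    simp only [natPerm, List.map_nil, List.prod_nil, Equiv.Perm.one_apply]
    split_ifs <;> omega

/-- Both this word and `downWord` represent the reversal of the points `s, …, s + N`; working with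
permutations of `ℕ` leaves only arithmetic. -/
theorem natPerm_upWord (s N p : ℕ) : natPerm (upWord (s + 1) N) p =
    if s ≤ p ∧ p ≤ s + N then 2 * s + N - p else p := by
  induction N with
  | zero => simp [natPerm, upWord]; omega
  | succ N ih =>
    rw [upWord, natPerm_append, Equiv.Perm.mul_apply, ih, natPerm_range']
    split_ifs <;> omega

theorem natPerm_downWord (s N p : ℕ) : natPerm (downWord (s + 1) N) p =
    if s ≤ p ∧ p ≤ s + N then 2 * s + N - p else p := by
  induction N generalizing s with
  | zero => simp [natPerm, downWord]; omega
  | succ N ih =>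
    rw [downWord, natPerm_append, Equiv.Perm.mul_apply, ih, natPerm_reverse_range']
    split_ifs <;> omega

end NatWords

/-! ## Products of variables -/

namespace OddPoly

variable {k : Type*} [Field k] {n : ℕ}

variable (k n) in
/-- The product of the variables along a word. -/
def xs (L : List ℕ) : OddPoly k n := (L.map x).prod

theorem xs_cons (i : ℕ) (L : List ℕ) : xs k n (i :: L) = x i * xs k n L := by
  rw [xs, List.map_cons, List.prod_cons, xs]

theorem xs_append (L L' : List ℕ) : xs k n (L ++ L') = xs k n L * xs k n L' := by
  rw [xs, List.map_append, List.prod_append, xs, xs]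

theorem xs_eqSign {L L' : List ℕ} (h : L.Perm L') : EqSign (xs k n L) (xs k n L') := by
  induction h with
  | nil => exact .refl _
  | cons i _ ih => rw [xs_cons, xs_cons]; exact ih.mul_left _
  | swap i j L =>
    rw [xs_cons, xs_cons, xs_cons, xs_cons, ← mul_assoc, ← mul_assoc]
    refine EqSign.mul_right ?_ _
    by_cases hij : j = i
    · rw [hij]; exact .refl _
    · exact Or.inr (x_mul_x hij)
  | trans _ _ h1 h2 => exact h1.trans h2

theorem sg_xs (i : ℕ) (L : List ℕ) :
    EqSign (sg i (xs k n L)) (xs k n (L.map (Equiv.swap i (i + 1)))) := by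
  induction L with
  | nil => rw [xs, List.map_nil, List.prod_nil, map_one]; exact .refl _
  | cons j L ih =>
    rw [xs_cons, List.map_cons, xs_cons, map_mul, sg_x]
    exact (EqSign.neg_left _).mul ih

/-- The polynomial `f` is killed by the divided difference `∂_i` and invariant up to sign. -/
def IsInvariant (i : ℕ) (f : OddPoly k n) : Prop := dd i f = 0 ∧ EqSign (sg i f) f

theorem IsInvariant.dd_mul {i : ℕ} {f : OddPoly k n} (h : IsInvariant i f) (g : OddPoly k n) :
    EqSign (dd i (f * g)) (f * dd i g) := by
  rw [OddPoly.dd_mul, h.1, zero_mul, zero_add]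
  exact h.2.mul_right _

theorem isInvariant_xs_of_notMem {i : ℕ} {L : List ℕ} (h : i ∉ L) (h' : i + 1 ∉ L) :
    IsInvariant i (xs k n L) := by
  constructor
  · induction L with
    | nil => rw [xs, List.map_nil, List.prod_nil, dd_one]
    | cons j L ih =>
      simp only [List.mem_cons, not_or] at h h'
      rw [xs_cons, dd_x_mul_of_ne (Ne.symm h.1) (Ne.symm h'.1), ih h.2 h'.2, mul_zero, neg_zero]
  · have := sg_xs (k := k) (n := n) i L
    rwa [List.map_congr_left (g := id), List.map_id] at this
    intro j hj
    exact Equiv.swap_apply_of_ne_of_ne (fun e => h (e ▸ hj)) (fun e => h' (e ▸ hj))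

/-- Up to sign the product is `x_i x_{i+1}` times variables untouched by `∂_i`, and `∂_i(x_i
x_{i+1}) = 0`. Such factors can be pulled out of divided differences. -/
theorem isInvariant_xs_of_mem {i : ℕ} {L : List ℕ} (hL : L.Nodup) (h : i ∈ L) (h' : i + 1 ∈ L) :
    IsInvariant i (xs k n L) := by
  have h1 : i + 1 ∈ L.erase i := (List.mem_erase_of_ne (by omega)).2 h'
  set K := (L.erase i).erase (i + 1)
  have hp : L.Perm (i :: (i + 1) :: K) :=
    (List.perm_cons_erase h).trans ((List.perm_cons_erase h1).cons _)
  have hn := hp.nodup_iff.1 hL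
  simp only [List.nodup_cons, List.mem_cons, not_or] at hn
  have hK := isInvariant_xs_of_notMem (k := k) (n := n) hn.1.2 hn.2.1
  have e1 := xs_eqSign (k := k) (n := n) hp
  constructor
  · refine (e1.map (dd i)).eq_zero ?_
    rw [xs_cons, xs_cons, dd_x_mul, dd_x_succ_mul, hK.1, mul_zero, sub_zero, sub_self]
  · refine (sg_xs i L).trans (EqSign.trans (xs_eqSign ((hp.map _).trans ?_)) e1.symm)
    rw [List.map_cons, List.map_cons, Equiv.swap_apply_left, Equiv.swap_apply_right,
      List.map_congr_left (g := id), List.map_id]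
    · exact List.Perm.swap _ _ _
    intro j hj
    exact Equiv.swap_apply_of_ne_of_ne (fun e => hn.1.2 (e ▸ hj)) (fun e => hn.2.1 (e ▸ hj))

/-- The iterated divided difference along a word. -/
def ddWord (L : List ℕ) (f : OddPoly k n) : OddPoly k n := L.foldr (fun i g => dd i g) f

theorem ddWord_append (L L' : List ℕ) (f : OddPoly k n) :
    ddWord (L ++ L') f = ddWord L (ddWord L' f) := List.foldr_append

theorem ddWord_eqSign (L : List ℕ) {f g : OddPoly k n} (h : EqSign f g) :
    EqSign (ddWord L f) (ddWord L g) := by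
  induction L with
  | nil => exact h
  | cons i L ih => exact ih.map (dd i)

theorem ddWord_mul {L : List ℕ} {f : OddPoly k n} (hf : ∀ i ∈ L, IsInvariant i f)
    (g : OddPoly k n) : EqSign (ddWord L (f * g)) (f * ddWord L g) := by
  induction L with
  | nil => exact .refl _
  | cons i L ih =>
    refine ((ih fun j hj => hf j (List.mem_cons_of_mem _ hj)).map (dd i)).trans ?_
    exact (hf i List.mem_cons_self).dd_mul _

theorem ddWord_range' (l N : ℕ) :
    EqSign (ddWord (List.range' l N) (xs k n (List.range' l N))) 1 := by
  induction N with
  | zero => exact .refl _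
  | succ N ih =>
    rw [List.range'_1_concat, ddWord_append, xs_append]
    refine (ddWord_eqSign _ (IsInvariant.dd_mul (i := l + N) ?_ _)).trans ?_
    · exact isInvariant_xs_of_notMem (by simp) (by simp)
    · have : dd (l + N) (xs k n [l + N]) = 1 := by simp [xs, dd_x]
      rw [this, mul_one]
      exact ih

theorem ddWord_reverse_range' (l N : ℕ) :
    EqSign (ddWord (List.range' l N).reverse (xs k n (List.range' (l + 1) N))) 1 := by
  induction N generalizing l with
  | zero => exact .refl _
  | succ N ih =>
    rw [List.range'_succ, List.range'_succ, List.reverse_cons, ddWord_append, xs_cons]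
    have h : dd l (x (l + 1) * xs k n (List.range' (l + 1 + 1) N)) =
        xs k n (List.range' (l + 1 + 1) N) := by
      rw [dd_x_succ_mul, (isInvariant_xs_of_notMem _ _).1, mul_zero, sub_zero] <;>
        simp [List.mem_range'_1]
    change EqSign (ddWord _ (dd l (x (l + 1) * xs k n (List.range' (l + 1 + 1) N)))) 1
    rw [h]
    exact ih (l + 1)

/-- The exponents of `x_{[l,l+N]}` are those of the word of the longest permutation. -/
theorem ddWord_upWord (l N : ℕ) : EqSign (ddWord (upWord l N) (xs k n (upWord l N))) 1 := by
  induction N with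
  | zero => exact .refl _
  | succ N ih =>
    rw [upWord, ddWord_append, xs_append]
    -- The product `x_l ⋯ x_{l+N}` is invariant under the operators `∂_l, …, ∂_{l+N-1}` of the inner
    -- word and moves past them; the outer operators then strip its variables one at a time.
    refine (ddWord_eqSign _ (ddWord_mul (fun i hi => ?_) _)).trans ?_
    · have := mem_upWord hi
      refine isInvariant_xs_of_mem (List.nodup_range' ..) ?_ ?_ <;>
        (rw [List.mem_range'_1]; omega)
    · refine (ddWord_eqSign _ (ih.mul_left _)).trans ?_
      rw [mul_one]
      exact ddWord_range' l (N + 1)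

/-- The exponents of `x'_{[l,l+N]}` as a word. -/
def xWord' : ℕ → ℕ → List ℕ
  | _, 0 => []
  | l, N + 1 => List.range' (l + 1) (N + 1) ++ xWord' (l + 1) N

/-- The mirror image of `ddWord_upWord`, with exponents increasing instead of decreasing; it serves
the idempotent `e'`. -/
theorem ddWord_downWord (l N : ℕ) : EqSign (ddWord (downWord l N) (xs k n (xWord' l N))) 1 := by
  induction N generalizing l with
  | zero => exact .refl _
  | succ N ih =>
    rw [downWord, ddWord_append, xWord', xs_append]
    refine (ddWord_eqSign _ (ddWord_mul (fun i hi => ?_) _)).trans ?_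
    · have := mem_downWord hi
      refine isInvariant_xs_of_mem (List.nodup_range' ..) ?_ ?_ <;>
        (rw [List.mem_range'_1]; omega)
    · refine (ddWord_eqSign _ ((ih (l + 1)).mul_left _)).trans ?_
      rw [mul_one]
      exact ddWord_reverse_range' l (N + 1)

theorem xs_flatMap_replicate (f : ℕ → ℕ) (L : List ℕ) :
    xs k n (L.flatMap fun j => List.replicate j (f j)) = (L.map fun j => x (f j) ^ j).prod := by
  induction L with
  | nil => rfl
  | cons j L ih => rw [List.flatMap_cons, xs_append, ih, List.map_cons, List.prod_cons, xs,
      List.map_replicate, List.prod_replicate]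

/-- One copy is removed from each letter of positive exponent; the remaining exponents have the same
staircase shape with one step fewer. -/
theorem flatMap_replicate_succ_perm (f : ℕ → ℕ) (N : ℕ) :
    ((List.range (N + 1)).flatMap fun j => List.replicate j (f j)).Perm
      (((List.range N).map fun j => f (j + 1)) ++
        (List.range N).flatMap fun j => List.replicate j (f (j + 1))) := by
  rw [List.range_succ_eq_map, List.flatMap_cons, List.flatMap_map, List.replicate_zero,
    List.nil_append, List.map_eq_flatMap]
  exact (List.flatMap_append_perm (List.range N) (fun j => [f (j + 1)])
    (fun j => List.replicate j (f (j + 1)))).symm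

theorem xs_upWord (l N : ℕ) : EqSign
    (((List.range (N + 1)).map fun j => (x (l + N - j) : OddPoly k n) ^ j).prod)
    (xs k n (upWord l N)) := by
  rw [← xs_flatMap_replicate]
  refine xs_eqSign ?_
  induction N with
  | zero => rfl
  | succ N ih =>
    refine (flatMap_replicate_succ_perm _ (N + 1)).trans (List.Perm.append ?_ ?_)
    · refine List.Perm.trans (List.Perm.of_eq ?_) (List.reverse_perm _)
      refine List.ext_getElem (by simp) fun i h1 h2 => ?_
      simp at h1 h2 ⊢
      omega
    · refine List.Perm.trans (List.Perm.of_eq ?_) ih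
      congr 1
      ext j
      rw [show l + (N + 1) - (j + 1) = l + N - j by omega]

theorem xs_xWord' (l N : ℕ) : EqSign
    (((List.range (N + 1)).map fun j => (x (l + j) : OddPoly k n) ^ j).prod)
    (xs k n (xWord' l N)) := by
  rw [← xs_flatMap_replicate]
  refine xs_eqSign ?_
  induction N generalizing l with
  | zero => rfl
  | succ N ih =>
    refine (flatMap_replicate_succ_perm _ (N + 1)).trans (List.Perm.append ?_ ?_)
    · refine List.Perm.of_eq ?_
      refine List.ext_getElem (by simp) fun i h1 h2 => ?_
      simp at h1 h2 ⊢
      omega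
    · refine List.Perm.trans (List.Perm.of_eq ?_) (ih (l + 1))
      congr 1
      ext j
      rw [show l + (j + 1) = l + 1 + j by omega]

instance : Nontrivial (A k n) := by
  have h : ∀ y ∈ coeffIdeal k n, MvPolynomial.aeval (fun _ => (0 : k)) y = 0 := by
    have hle : coeffIdeal k n ≤ RingHom.ker (MvPolynomial.aeval (fun _ : CoeffGen n => (0 : k))) := by
      refine Ideal.span_le.2 ?_
      rintro _ (rfl | ⟨_, rfl⟩) <;> simp [RingHom.mem_ker, polyD]
    exact fun y hy => hle hy
  exact (Ideal.Quotient.liftₐ (coeffIdeal k n) _ h).toRingHom.domain_nontrivial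

instance : Nontrivial (OddPoly k n) := constTerm.toRingHom.domain_nontrivial

end OddPoly

theorem tauLongest_eq (k : Type*) [Field k] (m l N : ℕ) :
    tauLongest k m l (l + N) = ((upWord l N).map (ONH.t k m)).prod := by
  rw [tauLongest, Nat.add_sub_cancel_left]
  induction N with
  | zero => rfl
  | succ N ih =>
    rw [upWord, List.map_append, List.prod_append, ← ih, List.range_succ_eq_map, List.map_cons,
      List.prod_cons, List.map_map]
    congr 1
    · rw [List.range'_eq_map_range, List.map_map]
      rfl
    · congr 2
      ext j
      simp


/-! ## The longest permutation of an interval -/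

section Longest

variable {m : ℕ}

/-- The permutation that reverses the points `l, …, m`. -/
def revFrom (l : ℕ) : Equiv.Perm (Fin m) :=
  Function.Involutive.toPerm
    (fun a => ⟨if l - 1 ≤ a.1 then l - 1 + (m - 1) - a.1 else a.1, by split_ifs <;> omega⟩)
    (fun a => by ext; simp only; split_ifs <;> omega)

theorem revFrom_val (l : ℕ) (a : Fin m) :
    (revFrom l a).1 = if l - 1 ≤ a.1 then l - 1 + (m - 1) - a.1 else a.1 := rfl

theorem revFrom_mul_self (l : ℕ) : revFrom l * revFrom l = (1 : Equiv.Perm (Fin m)) := by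
  ext a
  rw [Equiv.Perm.mul_apply, revFrom_val, revFrom_val, Equiv.Perm.one_apply]
  split_ifs <;> omega

theorem revFrom_inv (l : ℕ) : (revFrom l : Equiv.Perm (Fin m))⁻¹ = revFrom l :=
  inv_eq_of_mul_eq_one_left (revFrom_mul_self l)

theorem revFrom_one : (revFrom 1 : Equiv.Perm (Fin m)) = longest m := by
  ext a
  simp only [revFrom_val, longest, Fin.revPerm_apply, Fin.val_rev]
  split_ifs <;> omega

theorem revFrom_hi_lt_lo {l : ℕ} {i : Letter m} (h : l ≤ i.1) : revFrom l i.hi < revFrom l i.lo := by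
  have e1 : i.hi.1 = i.1 := rfl
  have e2 : i.lo.1 = i.1 - 1 := rfl
  have := i.2
  rw [Fin.lt_def, revFrom_val, revFrom_val, if_pos (by omega), if_pos (by omega)]
  omega

/-- The hypothesis says that every inversion of `v` remains one of `w * v`; the other inversions of
`w * v` correspond under `v` to those of `w`. -/
theorem inv_mul_of_forall {w v : Equiv.Perm (Fin m)}
    (h : ∀ a b, a < b → v b < v a → w (v b) < w (v a)) : inv (w * v) = inv w + inv v := by
  classical
  have hsub : invSet v ⊆ invSet (w * v) := by
    rintro ⟨a, b⟩ hab
    rw [mem_invSet] at hab ⊢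
    exact ⟨hab.1, h a b hab.1 hab.2⟩
  have hc : (invSet (w * v) \ invSet v).card = (invSet w).card := by
    refine Finset.card_bij (fun p _ => (v p.1, v p.2)) ?_ ?_ ?_
    · rintro ⟨a, b⟩ hab
      rw [Finset.mem_sdiff, mem_invSet, mem_invSet] at hab
      rw [mem_invSet]
      refine ⟨lt_of_le_of_ne (not_lt.1 fun h' => hab.2 ⟨hab.1.1, h'⟩) fun h' => ?_, hab.1.2⟩
      exact hab.1.1.ne (v.injective h')
    · rintro ⟨a, b⟩ _ ⟨c, d⟩ _ hh
      simp only [Prod.mk.injEq, EmbeddingLike.apply_eq_iff_eq] at hh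
      rw [hh.1, hh.2]
    · rintro ⟨c, d⟩ hcd
      rw [mem_invSet] at hcd
      refine ⟨(v⁻¹ c, v⁻¹ d), ?_, by simp⟩
      have e1 : v (v⁻¹ c) = c := v.apply_symm_apply c
      have e2 : v (v⁻¹ d) = d := v.apply_symm_apply d
      rw [Finset.mem_sdiff, mem_invSet, mem_invSet, Equiv.Perm.mul_apply, Equiv.Perm.mul_apply,
        e1, e2]
      refine ⟨⟨?_, hcd.2⟩, fun h' => hcd.1.not_gt h'.2⟩
      rcases lt_trichotomy (v⁻¹ c) (v⁻¹ d) with h' | h' | h'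
      · exact h'
      · exact absurd (v⁻¹.injective h') hcd.1.ne
      · have := h _ _ h' (by rw [e1, e2]; exact hcd.1)
        rw [e1, e2] at this
        exact absurd hcd.2 this.not_gt
  rw [inv, ← Finset.card_sdiff_add_card_eq_card hsub, hc, inv, inv]

variable (k : Type*) [Field k]

theorem ONH.prod_map_t (L : List (Letter m)) :
    ((L.map Subtype.val).map (ONH.t k m)).prod = tauWord k L := by
  rw [tauWord, List.map_map]
  rfl

variable {k}

theorem act_tauWord {n : ℕ} (L : List (Letter m)) (f : OddPoly k n) :
    act k n m (tauWord k L) f = OddPoly.ddWord (L.map Subtype.val) f := by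
  induction L with
  | nil => rw [tauWord_nil, map_one]; rfl
  | cons i L ih => rw [tauWord_cons, map_mul, Module.End.mul_apply, ih, act_t i.2]; rfl

theorem act_prod_x {n : ℕ} {L : List ℕ} (hL : ∀ i ∈ L, 1 ≤ i ∧ i ≤ m) :
    act k n m (L.map (ONH.x k m)).prod 1 = OddPoly.xs k n L := by
  induction L with
  | nil =>
    rw [List.map_nil, List.prod_nil]
    exact congrArg (fun φ : Module.End k (OddPoly k n) => φ 1) (map_one (act k n m))
  | cons i L ih =>
    rw [List.map_cons, List.prod_cons, map_mul, Module.End.mul_apply,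
      ih fun j hj => hL j (List.mem_cons_of_mem _ hj), act_x (hL i List.mem_cons_self),
      OddPoly.xs_cons]

variable (k)

/-- The word is reduced because otherwise the product of its `τ_i` would vanish, whereas the
corresponding divided differences send a monomial to `±1`. -/
theorem exists_upWord {l : ℕ} (h1 : 1 ≤ l) (h2 : l ≤ m) : ∃ L : List (Letter m),
    L.map Subtype.val = upWord l (m - l) ∧ wordPerm L = revFrom l ∧
      inv (revFrom l : Equiv.Perm (Fin m)) = L.length := by
  obtain ⟨L, hL⟩ := exists_map_val_eq (m := m) (L := upWord l (m - l)) fun i hi => by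
    have := mem_upWord hi; omega
  have hp : wordPerm L = revFrom l := by
    ext a
    obtain ⟨s, rfl⟩ : ∃ s, l = s + 1 := ⟨l - 1, by omega⟩
    rw [wordPerm_val, hL, natPerm_upWord, revFrom_val]
    split_ifs <;> omega
  refine ⟨L, hL, hp, ?_⟩
  rw [← hp]
  refine le_antisymm (inv_wordPerm_le L) (not_lt.1 fun hlt => ?_)
  -- Inversions do not depend on the coefficients, so any polynomial representation with `1 ≠ 0`
  -- serves; here it is the one over `ℚ` with `n = 0`.
  have h3 := act_tauWord (k := ℚ) (n := 0) L (OddPoly.xs ℚ 0 (upWord l (m - l)))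
  rw [tauWord_eq_zero ℚ hlt, map_zero, LinearMap.zero_apply, hL] at h3
  have h4 := OddPoly.ddWord_upWord (k := ℚ) (n := 0) l (m - l)
  rw [← h3] at h4
  exact one_ne_zero (h4.symm.eq_zero rfl)

theorem exists_downWord {l : ℕ} (h1 : 1 ≤ l) (h2 : l ≤ m) : ∃ L : List (Letter m),
    L.map Subtype.val = downWord l (m - l) ∧ wordPerm L = revFrom l ∧
      inv (revFrom l : Equiv.Perm (Fin m)) = L.length := by
  obtain ⟨L, hL⟩ := exists_map_val_eq (m := m) (L := downWord l (m - l)) fun i hi => by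
    have := mem_downWord hi; omega
  have hp : wordPerm L = revFrom l := by
    ext a
    obtain ⟨s, rfl⟩ : ∃ s, l = s + 1 := ⟨l - 1, by omega⟩
    rw [wordPerm_val, hL, natPerm_downWord, revFrom_val]
    split_ifs <;> omega
  refine ⟨L, hL, hp, ?_⟩
  obtain ⟨L', e1, e2, e3⟩ := exists_upWord h1 h2
  rw [e3, ← List.length_map (f := Subtype.val), e1, length_upWord,
    ← List.length_map (f := Subtype.val) (as := L), hL, length_downWord]

theorem tauLongest_eqSign {l : ℕ} (h1 : 1 ≤ l) (h2 : l ≤ m) {L : List (Letter m)}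
    (hL : wordPerm L = revFrom l) (hL' : L.length = inv (revFrom l : Equiv.Perm (Fin m))) :
    EqSign (tauLongest k m l m) (tauWord k L) := by
  obtain ⟨L', e1, e2, e3⟩ := exists_upWord h1 h2
  have := tauLongest_eq k m l (m - l)
  rw [Nat.add_sub_cancel' h2, ← e1, ONH.prod_map_t] at this
  rw [this]
  exact tauWord_eqSign k (by rw [e2, hL]) (by rw [e2, e3]) (by omega)

theorem t_mul_tauLongest {l i : ℕ} (h1 : 1 ≤ l) (hi : l ≤ i) (hi' : i < m) :
    ONH.t k m i * tauLongest k m l m = 0 := by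
  obtain ⟨L, e1, e2, e3⟩ := exists_upWord h1 (hi.trans hi'.le)
  refine ((tauLongest_eqSign k h1 (hi.trans hi'.le) e2 e3.symm).mul_left _).eq_zero ?_
  have := tauWord_eq_zero k (L := ⟨i, by omega, hi'⟩ :: L) ?_
  · rwa [tauWord_cons] at this
  rw [wordPerm_cons, e2, List.length_cons, ← e3]
  have := inv_simple_mul_of_gt (w := (revFrom l : Equiv.Perm (Fin m))) (i := ⟨i, by omega, hi'⟩) ?_
  · omega
  rw [revFrom_inv]
  exact revFrom_hi_lt_lo (i := ⟨i, by omega, hi'⟩) hi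

theorem tauLongest_mul_t {l i : ℕ} (h1 : 1 ≤ l) (hi : l ≤ i) (hi' : i < m) :
    tauLongest k m l m * ONH.t k m i = 0 := by
  obtain ⟨L, e1, e2, e3⟩ := exists_upWord h1 (hi.trans hi'.le)
  refine ((tauLongest_eqSign k h1 (hi.trans hi'.le) e2 e3.symm).mul_right _).eq_zero ?_
  have := tauWord_eq_zero k (L := L ++ [⟨i, by omega, hi'⟩]) ?_
  · rwa [tauWord_append, tauWord_cons, tauWord_nil, mul_one] at this
  rw [wordPerm_append, e2, List.length_append, ← e3, wordPerm_cons, wordPerm_nil, mul_one]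
  have := inv_mul_simple_of_gt (w := (revFrom l : Equiv.Perm (Fin m))) (i := ⟨i, by omega, hi'⟩) ?_
  · simp only [List.length_singleton]; omega
  exact revFrom_hi_lt_lo (i := ⟨i, by omega, hi'⟩) hi

/-! ### Multiplication of the idempotents with the longest element -/

variable {k}
variable [NeZero (2 : k)] {n : ℕ}

open CycQuot

/-- On an element killed by all the `τ_i` involved, the first term of `t_mul_ofPoly` disappears at
every letter and only divided differences remain. -/
theorem CycQuot.tauWord_mul_ofPoly {L : List (Letter m)} {v : CycQuot k n m}
    (hv : ∀ i ∈ L, ofONH k n m (ONH.t k m i.1) * v = 0) (f : OddPoly k n) :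
    ofONH k n m (tauWord k L) * (ofPoly k n m f * v) =
      ofPoly k n m (OddPoly.ddWord (L.map Subtype.val) f) * v := by
  induction L with
  | nil => rw [tauWord_nil, map_one, one_mul]; rfl
  | cons i L ih =>
    rw [tauWord_cons, map_mul, mul_assoc, ih fun j hj => hv j (List.mem_cons_of_mem _ hj),
      ← mul_assoc, t_mul_ofPoly i.2, add_mul, mul_assoc, hv i List.mem_cons_self, mul_zero,
      zero_add]
    rfl

theorem CycQuot.xInt_eqSign (l N : ℕ) : EqSign (ofONH k n m (xInt k m l (l + N)))
    (ofPoly k n m (OddPoly.xs k n (upWord l N))) := by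
  refine EqSign.trans ?_ ((OddPoly.xs_upWord l N).map (ofPoly k n m))
  rw [xInt, map_mul, map_pow, map_neg, map_one, Nat.add_sub_cancel_left]
  have := (EqSign.neg_one_pow (R := CycQuot k n m) ((N + 1).choose 3)).mul_right
    (ofONH k n m ((List.range (N + 1)).map fun j => ONH.x k m (l + N - j) ^ j).prod)
  rw [one_mul] at this
  refine this.trans (Or.inl ?_)
  rw [map_list_prod, map_list_prod, List.map_map, List.map_map]
  congr 2
  ext j
  simp

theorem CycQuot.xInt'_eqSign (l N : ℕ) : EqSign (ofONH k n m (xInt' k m l (l + N)))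
    (ofPoly k n m (OddPoly.xs k n (OddPoly.xWord' l N))) := by
  refine EqSign.trans ?_ ((OddPoly.xs_xWord' l N).map (ofPoly k n m))
  rw [xInt', map_mul, map_pow, map_neg, map_one, Nat.add_sub_cancel_left]
  have := (EqSign.neg_one_pow (R := CycQuot k n m) ((N + 1).choose 3)).mul_right
    (ofONH k n m ((List.range (N + 1)).map fun j => ONH.x k m (l + j) ^ j).prod)
  rw [one_mul] at this
  refine this.trans (Or.inl ?_)
  rw [map_list_prod, map_list_prod, List.map_map, List.map_map]
  congr 2
  ext j
  simp

theorem CycQuot.tauLongest_mul_mul_tauLongest {l : ℕ} (h1 : 1 ≤ l) (h2 : l ≤ m)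
    {L : List (Letter m)} {K : List ℕ} (hp : wordPerm L = revFrom l)
    (hl : inv (revFrom l : Equiv.Perm (Fin m)) = L.length)
    (hd : EqSign (OddPoly.ddWord (L.map Subtype.val) (OddPoly.xs k n K)) 1)
    (hL : ∀ i ∈ L, l ≤ i.1) :
    EqSign (ofONH k n m (tauLongest k m l m) *
      (ofPoly k n m (OddPoly.xs k n K) * ofONH k n m (tauLongest k m l m)))
      (ofONH k n m (tauLongest k m l m)) := by
  refine (((tauLongest_eqSign k h1 h2 hp hl.symm).map (ofONH k n m)).mul_right _).trans ?_
  rw [tauWord_mul_ofPoly fun i hi => ?_]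
  · have := (hd.map (ofPoly k n m)).mul_right (ofONH k n m (tauLongest k m l m))
    rwa [map_one, one_mul] at this
  · rw [← map_mul, t_mul_tauLongest k h1 (hL i hi) i.2.2, map_zero]

/-- `τ_{ω₀}` times a polynomial times `τ_{ω₀}` is `∂_{ω₀}` of the polynomial times `τ_{ω₀}`, up to
sign, and here that polynomial has divided difference `±1`. -/
theorem CycQuot.idem_mul_tauLongest {l : ℕ} (h1 : 1 ≤ l) (h2 : l ≤ m) :
    EqSign (ofONH k n m (idem k m l m) * ofONH k n m (tauLongest k m l m))
      (ofONH k n m (tauLongest k m l m)) := by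
  obtain ⟨L, e1, e2, e3⟩ := exists_upWord h1 h2
  have h := xInt_eqSign (k := k) (m := m) (n := n) l (m - l)
  rw [Nat.add_sub_cancel' h2] at h
  rw [idem, map_mul, mul_assoc]
  refine ((h.mul_right _).mul_left _).trans ?_
  refine tauLongest_mul_mul_tauLongest h1 h2 e2 e3 ?_ fun i hi => ?_
  · rw [e1]; exact OddPoly.ddWord_upWord _ _
  · exact (mem_upWord (e1 ▸ List.mem_map_of_mem hi)).1

theorem CycQuot.tauLongest_mul_idem' {l : ℕ} (h1 : 1 ≤ l) (h2 : l ≤ m) :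
    EqSign (ofONH k n m (tauLongest k m l m) * ofONH k n m (idem' k m l m))
      (ofONH k n m (tauLongest k m l m)) := by
  obtain ⟨L, e1, e2, e3⟩ := exists_downWord h1 h2
  have h := xInt'_eqSign (k := k) (m := m) (n := n) l (m - l)
  rw [Nat.add_sub_cancel' h2] at h
  rw [idem', map_mul]
  refine ((h.mul_right _).mul_left _).trans ?_
  refine tauLongest_mul_mul_tauLongest h1 h2 e2 e3 ?_ fun i hi => ?_
  · rw [e1]; exact OddPoly.ddWord_downWord _ _
  · exact (mem_downWord (e1 ▸ List.mem_map_of_mem hi)).1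

end Longest


/-! ## The standard basis -/

theorem A.iterate_parity_eq_zero {k : Type*} [Field k] {n t : ℕ} {c : A k n}
    (h : (A.parity k n)^[t] c = 0) : c = 0 := by
  rw [← A.iterate_parity_iterate_parity t c, h]
  exact Function.iterate_fixed (map_zero _) t

section Basis

variable {k : Type*} [Field k] [NeZero (2 : k)] {n m : ℕ}

open CycQuot

theorem CycQuot.op_smul_eq (c : A k n) (q : CycQuot k n m) :
    MulOpposite.op c • q = q * ofA k n m c := rfl

theorem CycQuot.smul_eq (c : A k n) (q : CycQuot k n m) : c • q = ofA k n m c * q := rfl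

/-- A homogeneous basis for the right action is a basis for the left action. -/
theorem isSuperBasis_of_right {I : Type*} {b : I → ONH k m} (hb : ∀ i, IsHomog (b i))
    {S : Set (CycQuot k n m)}
    (h1 : LinearIndependent (A k n)ᵐᵒᵖ fun i => ofONH k n m (b i))
    (h2 : (Submodule.span (A k n)ᵐᵒᵖ (Set.range fun i => ofONH k n m (b i)) :
      Set (CycQuot k n m)) = S) :
    IsSuperBasis (fun i => ofONH k n m (b i)) S := by
  refine ⟨fun i => ofONH_mem_part (hb i), h1, h2, ?_, ?_⟩
  · rw [linearIndependent_iff'] at h1 ⊢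
    intro s g hg i hi
    -- Moving a coefficient across the homogeneous element `b i` only applies a power of the parity
    -- involution, which is injective.
    choose t ht using fun i => ofA_mul_ofONH' (n := n) (hb i)
    have := h1 s (fun i => MulOpposite.op ((A.parity k n)^[t i] (g i))) ?_ i hi
    · exact A.iterate_parity_eq_zero (MulOpposite.op_injective this)
    · rw [← hg]
      refine Finset.sum_congr rfl fun i _ => ?_
      rw [op_smul_eq, smul_eq, ht]
  · rw [← h2]
    refine Set.Subset.antisymm (fun q hq => ?_) (fun q hq => ?_)
    · rw [SetLike.mem_coe] at hq ⊢
      induction hq using Submodule.span_induction with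
      | mem q hq => exact Submodule.subset_span hq
      | zero => exact zero_mem _
      | add q q' _ _ h h' => exact add_mem h h'
      | smul c q _ hq =>
        rw [smul_eq]
        clear * - hb hq
        induction hq using Submodule.span_induction with
        | mem q hq =>
          obtain ⟨i, rfl⟩ := hq
          obtain ⟨t, ht⟩ := ofA_mul_ofONH' (n := n) (hb i)
          simp only [ht]
          rw [← op_smul_eq]
          exact Submodule.smul_mem _ _ (Submodule.subset_span ⟨i, rfl⟩)
        | zero => rw [mul_zero]; exact zero_mem _
        | add q q' _ _ h h' => rw [mul_add]; exact add_mem h h'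
        | smul c' q _ hq =>
          induction c' using MulOpposite.rec' with
          | h c' =>
            rw [op_smul_eq, ← mul_assoc, ← op_smul_eq]
            exact Submodule.smul_mem _ _ hq
    · rw [SetLike.mem_coe] at hq ⊢
      induction hq using Submodule.span_induction with
      | mem q hq => exact Submodule.subset_span hq
      | zero => exact zero_mem _
      | add q q' _ _ h h' => exact add_mem h h'
      | smul c q _ hq =>
        induction c using MulOpposite.rec' with
        | h c =>
          rw [op_smul_eq]
          clear * - hb hq
          induction hq using Submodule.span_induction with
          | mem q hq =>
            obtain ⟨i, rfl⟩ := hq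
            obtain ⟨t, ht⟩ := hb i
            simp only [ofONH_mul_ofA ht]
            rw [← smul_eq]
            exact Submodule.smul_mem _ _ (Submodule.subset_span ⟨i, rfl⟩)
          | zero => rw [zero_mul]; exact zero_mem _
          | add q q' _ _ h h' => rw [add_mul]; exact add_mem h h'
          | smul c' q _ hq =>
            rw [smul_eq, mul_assoc, ← smul_eq]
            exact Submodule.smul_mem _ _ hq

theorem finite_X (n m : ℕ) : (X n m).Finite :=
  (Set.finite_Iic fun _ => n).subset fun a ha i => by have := ha i; simp only; omega

instance (n m : ℕ) : Fintype (X n m) := (finite_X n m).fintype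

theorem inv_lt_longest {w : Equiv.Perm (Fin m)} (h : w ≠ longest m) : inv w < inv (longest m) := by
  refine lt_of_le_of_ne (inv_le_longest w) fun h' => h ?_
  have h1 := eq_one_of_inv_eq_zero (w := w * longest m) (by have := inv_mul_longest w; omega)
  have h2 : longest m * longest m = 1 := by rw [← revFrom_one, revFrom_mul_self]
  exact mul_right_cancel (h1.trans h2.symm)

variable {red : Equiv.Perm (Fin m) → List (Letter m)}

/-- By induction on the length `r` all shorter permutations have zero coefficients. Multiplying the
relation on the right by `τ_u` and a monomial, and applying it to `1` in the polynomial
representation, isolates a single `w` of length `r`; what remains is a relation between monomials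
modulo the flag ideal. -/
theorem mono_tauWord_independent (hm : 1 ≤ m) (hred : ∀ w, IsReduced w (red w))
    (c : (Fin m → ℕ) → Equiv.Perm (Fin m) → A k n)
    (h : ∑ a ∈ (finite_X n m).toFinset, ∑ w,
      ofONH k n m (monomial k a * tauWord k (red w)) * ofA k n m (c a w) = 0) :
    ∀ r w, inv w = r → ∀ a ∈ X n m, c a w = 0 := by
  intro r
  induction r using Nat.strong_induction_on with | _ r ih
  intro w hw
  set u := w⁻¹ * longest m with hu
  have hur : inv u + r = inv (longest m) := by
    rw [← hw, ← inv_inv w, hu, inv_mul_longest]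
  set d := ((upWord 1 (m - 1)).map (ONH.x k m)).prod with hd
  obtain ⟨t, ht⟩ : IsHomog (tauWord k (red u) * d) :=
    (isHomog_tauWord _).mul (isHomog_list_prod fun y hy => by
      obtain ⟨i, _, rfl⟩ := List.mem_map.1 hy; exact isHomog_x _)
  have hd1 : act k n m d 1 = OddPoly.xs k n (upWord 1 (m - 1)) :=
    act_prod_x fun i hi => by have := mem_upWord hi; omega
  have h2 : (∑ a ∈ (finite_X n m).toFinset, OddPoly.mono k n a *
      act k n m (tauWord k (red w ++ red u) * d) 1 * OddPoly.C ((A.parity k n)^[t] (c a w))) ∈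
        OddPoly.flagIdeal k n m := by
    have h3 := congrArg (fun q => cycAct k n m hm (q * ofONH k n m (tauWord k (red u) * d))
      (Submodule.Quotient.mk 1)) h
    simp only [Finset.sum_mul, zero_mul, map_zero, LinearMap.zero_apply, map_sum,
      LinearMap.sum_apply] at h3
    have h4 : ∀ a w', cycAct k n m hm (ofONH k n m (monomial k a * tauWord k (red w')) *
        ofA k n m (c a w') * ofONH k n m (tauWord k (red u) * d)) (Submodule.Quotient.mk 1) =
          Submodule.Quotient.mk (OddPoly.mono k n a *
            act k n m (tauWord k (red w' ++ red u) * d) 1 *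
              OddPoly.C ((A.parity k n)^[t] (c a w'))) := by
      intro a w'
      rw [mul_assoc, ofA_mul_ofONH ht, ← mul_assoc, ← map_mul, map_mul (cycAct k n m hm),
        Module.End.mul_apply, cycAct_ofA, mul_one, cycAct_ofONH, ← one_mul (OddPoly.C _),
        act_mul_C, mul_assoc, ← mul_assoc (tauWord k _), ← tauWord_append, map_mul,
        Module.End.mul_apply, act_monomial, one_mul (OddPoly.C _)]
    simp only [h4] at h3
    have h5 : ∀ a ∈ (finite_X n m).toFinset, (∑ w', (Submodule.Quotient.mk (OddPoly.mono k n a *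
            act k n m (tauWord k (red w' ++ red u) * d) 1 *
              OddPoly.C ((A.parity k n)^[t] (c a w'))) : FlagQuot k n m)) =
        Submodule.Quotient.mk (OddPoly.mono k n a *
            act k n m (tauWord k (red w ++ red u) * d) 1 *
              OddPoly.C ((A.parity k n)^[t] (c a w))) := by
      intro a ha
      refine Finset.sum_eq_single w (fun w' _ hne => ?_) (fun h => absurd (Finset.mem_univ _) h)
      -- If `inv w' ≥ r` and `w' ≠ w`, then `w' * u` is not the longest permutation, so its length
      -- is smaller than `inv w' + inv u`; the concatenated word is not reduced and acts by zero.
      by_cases hlt : inv w' < r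
      · rw [ih _ hlt w' rfl a ((finite_X n m).mem_toFinset.1 ha), Function.iterate_fixed (map_zero _),
          map_zero, mul_zero, Submodule.Quotient.mk_zero]
      · rw [tauWord_eq_zero, zero_mul, map_zero, LinearMap.zero_apply, mul_zero, zero_mul,
          Submodule.Quotient.mk_zero]
        rw [List.length_append, (hred w').length_eq, (hred u).length_eq, wordPerm_append,
          (hred w').1, (hred u).1]
        have : w' * u ≠ longest m := fun h' => hne (by
          rw [hu, ← mul_assoc] at h'
          have := mul_eq_right.1 h'
          rwa [mul_inv_eq_one] at this)
        have := inv_lt_longest this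
        omega
    rw [Finset.sum_congr rfl h5] at h3
    refine (Submodule.Quotient.mk_eq_zero ((OddPoly.flagIdeal k n m).restrictScalars k)).1 ?_
    rw [← h3]
    exact map_sum (Submodule.mkQ ((OddPoly.flagIdeal k n m).restrictScalars k)) _ _
  -- For `w` itself the concatenated word is a reduced word of the longest permutation, and `d` is
  -- the monomial on which that acts by `±1`.
  have h6 : EqSign (act k n m (tauWord k (red w ++ red u) * d) 1) 1 := by
    obtain ⟨L, e1, e2, e3⟩ := exists_upWord (m := m) le_rfl hm
    rw [revFrom_one] at e2 e3
    have h7 : EqSign (tauWord k L) (tauWord k (red w ++ red u)) := by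
      refine tauWord_eqSign k ?_ (by rw [e2, e3]) ?_
      · rw [wordPerm_append, (hred w).1, (hred u).1, e2, hu, mul_inv_cancel_left]
      · rw [List.length_append, (hred w).length_eq, (hred u).length_eq]; omega
    rw [map_mul, Module.End.mul_apply, hd1]
    have h8 := OddPoly.ddWord_upWord (k := k) (n := n) 1 (m - 1)
    rw [← e1, ← act_tauWord, e1] at h8
    refine EqSign.trans ?_ h8
    rcases h7 with h7 | h7
    · rw [h7]; exact .refl _
    · rw [h7, map_neg, LinearMap.neg_apply]; exact (EqSign.neg_left _).symm
  intro a ha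
  refine A.iterate_parity_eq_zero (t := t) (OddPoly.mono_independent_mod (m := m)
    (finite_X n m).toFinset (fun a ha => (finite_X n m).mem_toFinset.1 ha)
    (fun a => (A.parity k n)^[t] (c a w)) ?_ a ((finite_X n m).mem_toFinset.2 ha))
  rcases h6 with h6 | h6
  · simpa only [h6, mul_one] using h2
  · simp only [h6, mul_neg, mul_one, neg_mul, Finset.sum_neg_distrib] at h2
    exact neg_mem_iff.1 h2

theorem linearIndependent_monomial_tauWord (hm : 1 ≤ m) (hred : ∀ w, IsReduced w (red w)) :
    LinearIndependent (A k n)ᵐᵒᵖ fun i : X n m × Equiv.Perm (Fin m) =>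
      ofONH k n m (monomial k i.1.1 * tauWord k (red i.2)) := by
  classical
  rw [Fintype.linearIndependent_iff]
  rintro g hg ⟨⟨a, ha⟩, w⟩
  have := mono_tauWord_independent (n := n) hm hred
    (fun a w => if h : a ∈ X n m then (g (⟨a, h⟩, w)).unop else 0) ?_ _ w rfl a ha
  · simp only [dif_pos ha] at this
    exact MulOpposite.unop_injective this
  · rw [Fintype.sum_prod_type] at hg
    rw [← hg, ← Finset.sum_coe_sort]
    refine Fintype.sum_equiv (Equiv.subtypeEquivRight fun a => (finite_X n m).mem_toFinset) _ _ ?_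
    rintro ⟨a, ha⟩
    refine Finset.sum_congr rfl fun w _ => ?_
    rw [dif_pos ((finite_X n m).mem_toFinset.1 ha)]
    rfl

theorem mem_span_of_mem_basisSpan {r : ℕ} {q : CycQuot k n m} (hq : q ∈ basisSpan k n red r) :
    q ∈ Submodule.span (A k n)ᵐᵒᵖ (Set.range fun i : X n m × Equiv.Perm (Fin m) =>
      ofONH k n m (monomial k i.1.1 * tauWord k (red i.2))) := by
  induction hq using Submodule.span_induction with
  | mem q hq =>
    obtain ⟨a, ha, w, _, c, rfl⟩ := hq
    rw [← op_smul_eq]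
    exact Submodule.smul_mem _ _ (Submodule.subset_span ⟨(⟨a, ha⟩, w), rfl⟩)
  | zero => exact zero_mem _
  | add q q' _ _ h h' => exact add_mem h h'
  | smul r q _ hq =>
    have : r • q = MulOpposite.op (algebraMap k (A k n) r) • q := by
      rw [op_smul_eq, AlgHom.commutes, ← Algebra.commutes, Algebra.smul_def]
    rw [this]
    exact Submodule.smul_mem _ _ hq

theorem isSuperBasis_monomial_tauWord (hm : 1 ≤ m) (hred : ∀ w, IsReduced w (red w)) :
    IsSuperBasis (k := k) (n := n) (m := m) (fun i : X n m × Equiv.Perm (Fin m) =>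
      ofONH k n m (monomial k i.1.1 * tauWord k (red i.2))) Set.univ := by
  refine isSuperBasis_of_right (fun i => (isHomog_monomial _).mul (isHomog_tauWord _))
    (linearIndependent_monomial_tauWord hm hred) (Set.eq_univ_of_forall fun q => ?_)
  exact mem_span_of_mem_basisSpan (r := 0) (red := red) (by rw [basisSpan_zero hred]; trivial)

end Basis


/-! ## Minimal coset representatives -/

section Cosets

variable {m : ℕ}

/-- The permutation `w` is increasing on the points `p, …, m`. -/
def IncreasingFrom (p : ℕ) (w : Equiv.Perm (Fin m)) : Prop :=
  ∀ i : Letter m, p ≤ i.1 → w i.lo < w i.hi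

theorem IncreasingFrom.lt {p : ℕ} {w : Equiv.Perm (Fin m)} (h : IncreasingFrom p w) {a b : Fin m}
    (ha : p - 1 ≤ a.1) (hab : a < b) : w a < w b := by
  have hstep : ∀ a b : Fin m, p - 1 ≤ a.1 → b.1 = a.1 + 1 → w a < w b := by
    intro a b ha hb
    have := h ⟨b.1, by omega⟩ (by simp only; omega)
    rwa [show Letter.lo ⟨b.1, _⟩ = a from Fin.ext (by simp only [Letter.lo]; omega)] at this
  have hmono : ∀ d : ℕ, ∀ a b : Fin m, p - 1 ≤ a.1 → b.1 = a.1 + d + 1 → w a < w b := by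
    intro d
    induction d with
    | zero => exact hstep
    | succ d ih =>
      intro a b ha hb
      exact (ih a ⟨a.1 + d + 1, by omega⟩ ha rfl).trans (hstep _ _ (by simp only; omega) hb)
  exact hmono (b.1 - a.1 - 1) a b ha (by rw [Fin.lt_def] at hab; omega)

/-- `revFrom p` inverts only pairs of points in `p, …, m`, where `w` is increasing, so no inversion
is lost. -/
theorem IncreasingFrom.inv_mul_revFrom {w : Equiv.Perm (Fin m)} {p : ℕ} (h : IncreasingFrom p w) :
    inv (w * revFrom p) = inv w + inv (revFrom p : Equiv.Perm (Fin m)) := by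
  refine inv_mul_of_forall fun a b hab hlt => h.lt ?_ hlt
  rw [Fin.lt_def, revFrom_val, revFrom_val] at hlt
  rw [Fin.lt_def] at hab
  rw [revFrom_val]
  split_ifs at * <;> omega

theorem mem_intervalSubgroup {p : ℕ} {g : Equiv.Perm (Fin m)} :
    g ∈ intervalSubgroup p m ↔ ∀ a : Fin m, a.1 + 1 < p → g a = a := by
  rw [intervalSubgroup, mem_fixingSubgroup_iff]
  rfl

theorem simple_mem_intervalSubgroup {p : ℕ} {i : Letter m} (h : p ≤ i.1) :
    simple i ∈ intervalSubgroup p m := by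
  rw [mem_intervalSubgroup]
  intro a ha
  refine simple_of_ne ?_ ?_ <;>
    (simp only [Letter.lo, Letter.hi, ne_eq, Fin.ext_iff]; omega)

/-- Both `w` and `w * g` are increasing on the block `p, …, m`, which `g` preserves; hence `g` is
increasing there, and it fixes all other points. Each coset thus contains at most one such
permutation. -/
theorem IncreasingFrom.eq_of_mem {p : ℕ} {w g : Equiv.Perm (Fin m)} (h : IncreasingFrom p w)
    (h' : IncreasingFrom p (w * g)) (hg : g ∈ intervalSubgroup p m) : g = 1 := by
  rw [mem_intervalSubgroup] at hg
  have hge : ∀ a : Fin m, p ≤ a.1 + 1 → p ≤ (g a).1 + 1 := by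
    intro a ha
    by_contra hlt
    have h1 := g.injective (hg (g a) (by omega))
    rw [h1] at hlt
    exact hlt ha
  refine perm_eq_one_of_strictMono (strictMono_of_lo_lt_hi fun i => ?_)
  have e1 : i.hi.1 = i.1 := rfl
  have e2 : i.lo.1 = i.1 - 1 := rfl
  have := i.2
  by_cases hi : p ≤ i.1
  · have h1 := h' i hi
    rw [Equiv.Perm.mul_apply, Equiv.Perm.mul_apply] at h1
    refine lt_of_not_ge fun h2 => h1.not_ge ?_
    rcases h2.eq_or_lt with h2 | h2
    · rw [h2]
    · exact (h.lt (by have := hge i.hi (by omega); omega) h2).le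
  · rw [hg i.lo (by omega), Fin.lt_def]
    by_cases hi' : p ≤ i.1 + 1
    · have := hge i.hi (by omega)
      omega
    · rw [hg i.hi (by omega)]
      omega

/-- A descent inside the block could be removed by a simple transposition of the subgroup, giving a
shorter element of the same coset. -/
theorem increasingFrom_of_isMinimalSection {p : ℕ}
    {rep : Equiv.Perm (Fin m) ⧸ intervalSubgroup p m → Equiv.Perm (Fin m)}
    (hrep : IsMinimalSection p m rep) (ω : Equiv.Perm (Fin m) ⧸ intervalSubgroup p m) :
    IncreasingFrom p (rep ω) := by
  intro i hi
  rcases lo_hi_lt_or_gt (rep ω) i with h | h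
  · exact h
  · have h1 := inv_mul_simple_of_gt h
    have h2 := (hrep ω).2 (rep ω * simple i) (by
      rw [← (hrep ω).1, QuotientGroup.eq, (hrep ω).1, mul_inv_rev, inv_mul_cancel_right]
      exact inv_mem (simple_mem_intervalSubgroup hi))
    rw [len_eq_inv, len_eq_inv] at h2
    omega

theorem eq_rep_of_increasingFrom {p : ℕ}
    {rep : Equiv.Perm (Fin m) ⧸ intervalSubgroup p m → Equiv.Perm (Fin m)}
    (hrep : IsMinimalSection p m rep) {w : Equiv.Perm (Fin m)} (hw : IncreasingFrom p w) :
    w = rep (QuotientGroup.mk w) := by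
  set ω : Equiv.Perm (Fin m) ⧸ intervalSubgroup p m := QuotientGroup.mk w
  have h1 : w⁻¹ * rep ω ∈ intervalSubgroup p m := QuotientGroup.eq.1 (hrep ω).1.symm
  have h2 := hw.eq_of_mem (g := w⁻¹ * rep ω)
    (by rw [mul_inv_cancel_left]; exact increasingFrom_of_isMinimalSection hrep ω) h1
  exact inv_mul_eq_one.1 h2

variable (k : Type*) [Field k] {red : Equiv.Perm (Fin m) → List (Letter m)}

/-- A descent `i ≥ p` lets a reduced word of `w` end in `τ_i`, and `τ_i` kills the left factor of
the idempotent. -/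
theorem tauWord_red_mul_idem (hred : ∀ w, IsReduced w (red w)) {p : ℕ} (hp : 1 ≤ p)
    {w : Equiv.Perm (Fin m)} (hw : ¬IncreasingFrom p w) :
    tauWord k (red w) * idem k m p m = 0 := by
  simp only [IncreasingFrom, not_forall] at hw
  obtain ⟨i, hi, hlt⟩ := hw
  have h1 := inv_mul_simple_of_gt ((lo_hi_lt_or_gt w i).resolve_left hlt)
  have h2 : wordPerm (red (w * simple i) ++ [i]) = w := by
    rw [wordPerm_append, (hred _).1, wordPerm_cons, wordPerm_nil, mul_one, mul_assoc,
      simple_mul_self, mul_one]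
  have h3 := tauWord_eqSign k (L := red w) (L' := red (w * simple i) ++ [i])
    (by rw [h2, (hred w).1]) (by rw [(hred w).1, (hred w).length_eq])
    (by rw [List.length_append, (hred _).length_eq, (hred _).length_eq, List.length_singleton, h1])
  refine (h3.mul_right _).eq_zero ?_
  rw [tauWord_append, tauWord_cons, tauWord_nil, mul_one, mul_assoc, idem, ← mul_assoc (ONH.t k m i.1),
    t_mul_tauLongest k hp hi i.2.2, zero_mul, mul_zero]

theorem tauWord_red_mul_tauLongest (hred : ∀ w, IsReduced w (red w)) {p : ℕ} (hp : 1 ≤ p)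
    (hpm : p ≤ m) {w : Equiv.Perm (Fin m)} (hw : IncreasingFrom p w) :
    EqSign (tauWord k (red w) * tauLongest k m p m) (tauWord k (red (w * revFrom p))) := by
  refine ((tauLongest_eqSign k hp hpm (hred _).1 (hred _).length_eq).mul_left _).trans ?_
  rw [← tauWord_append]
  have h2 : wordPerm (red w ++ red (revFrom p)) = w * revFrom p := by
    rw [wordPerm_append, (hred _).1, (hred _).1]
  refine tauWord_eqSign k (h2.trans (hred _).1.symm) ?_ ?_
  · rw [h2, hw.inv_mul_revFrom, List.length_append, (hred _).length_eq, (hred _).length_eq]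
  · rw [List.length_append, (hred _).length_eq, (hred _).length_eq, (hred _).length_eq,
      hw.inv_mul_revFrom]

end Cosets

/-! ## Counting -/

theorem card_X (n m : ℕ) : Nat.card (X n m) = n.descFactorial m := by
  have h : X n m = (Fintype.piFinset fun i : Fin m => Finset.range (n - i.1) : Set (Fin m → ℕ)) := by
    ext a
    simp only [X, Set.mem_ofPred_eq, Finset.mem_coe, Fintype.mem_piFinset, Finset.mem_range]
    exact forall_congr' fun i => by omega
  rw [h, Nat.card_coe_set_eq, Set.ncard_coe_finset, Fintype.card_piFinset,
    Nat.descFactorial_eq_prod_range, Finset.prod_range]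
  simp

theorem finite_Y (n l m : ℕ) : (Y n l m).Finite := (finite_X n m).subset fun _ h => h.1

instance (n l m : ℕ) : Fintype (Y n l m) := (finite_Y n l m).fintype

theorem descFactorial_add (n s N : ℕ) :
    n.descFactorial (s + N) = n.descFactorial s * (n - s).descFactorial N := by
  simp only [Nat.descFactorial_eq_prod_range, Finset.prod_range_add, Nat.sub_sub]

/-- With `l = s + 1` and `m = s + N`, a tuple in `Y` is determined by its first `s` entries and by
the set of its last `N` entries, which are strictly decreasing and below `n - s`. Finally `N!` times
the number of such subsets is a falling factorial. Only the inequality is needed. -/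
theorem card_Y_le (n s N : ℕ) :
    N.factorial * Nat.card (Y n (s + 1) (s + N)) ≤ Nat.card (X n (s + N)) := by
  rw [card_X, descFactorial_add, Nat.descFactorial_eq_factorial_mul_choose (n - s),
    mul_left_comm]
  refine Nat.mul_le_mul_left _ ?_
  have hanti : ∀ a ∈ Y n (s + 1) (s + N), StrictAnti fun j : Fin N => a (Fin.natAdd s j) := by
    intro a ha i j hij
    exact ha.2 _ _ (by simp only [Fin.val_natAdd]; omega) (by
      rw [Fin.lt_def] at hij ⊢; simp only [Fin.val_natAdd]; omega)
  let F : Y n (s + 1) (s + N) →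
      X n s × Finset.powersetCard N (Finset.range (n - s)) := fun a =>
    (⟨fun i => a.1 (Fin.castAdd N i), fun i => a.2.1 (Fin.castAdd N i)⟩,
      ⟨Finset.univ.image fun j : Fin N => a.1 (Fin.natAdd s j), by
        rw [Finset.mem_powersetCard]
        refine ⟨fun y hy => ?_, ?_⟩
        · obtain ⟨j, _, rfl⟩ := Finset.mem_image.1 hy
          have := a.2.1 (Fin.natAdd s j)
          rw [Fin.val_natAdd] at this
          rw [Finset.mem_range]
          omega
        · rw [Finset.card_image_of_injective _ (hanti a.1 a.2).injective, Finset.card_univ,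
            Fintype.card_fin]⟩)
  have hF : Function.Injective F := by
    rintro ⟨a, ha⟩ ⟨b, hb⟩ hab
    simp only [F, Prod.mk.injEq, Subtype.mk.injEq] at hab
    obtain ⟨h1, h2⟩ := hab
    have h3 : (fun j : Fin N => a (Fin.natAdd s j)) = fun j : Fin N => b (Fin.natAdd s j) := by
      refine ((hanti a ha).range_inj (hanti b hb)).1 ?_
      have := congrArg (fun t : Finset ℕ => (t : Set ℕ)) h2
      simpa only [Finset.coe_image, Finset.coe_univ, Set.image_univ] using this
    refine Subtype.ext (funext fun i => ?_)
    induction i using Fin.addCases with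
    | left i => exact congrFun (congrArg Subtype.val h1) i
    | right i => exact congrFun h3 i
  have := Nat.card_le_card_of_injective F hF
  rwa [Nat.card_prod, card_X, Nat.card_eq_finsetCard, Finset.card_powersetCard,
    Finset.card_range] at this

/-- A generating family that is not larger than a basis is linearly independent. -/
theorem linearIndependent_of_span_of_card_le {R M I K : Type*} [CommRing R] [AddCommGroup M]
    [Module R M] [Fintype I] [Fintype K] {v : K → M} (hv : LinearIndependent R v)
    (hv' : Submodule.span R (Set.range v) = ⊤) {u : I → M}
    (hu : Submodule.span R (Set.range u) = ⊤) (hc : Fintype.card I ≤ Fintype.card K) :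
    LinearIndependent R u := by
  obtain ⟨e⟩ := Function.Embedding.nonempty_of_card_le hc
  have : Module.Finite R M := ⟨⟨(Set.finite_range v).toFinset, by simpa using hv'⟩⟩
  -- The free module on `I` embeds in `M` through part of the basis and maps onto `M` through `u`;
  -- over a commutative ring such a surjection is injective.
  refine OrzechProperty.injective_of_surjective_of_injective (Finsupp.linearCombination R (v ∘ e)) _
    (hv.comp e e.injective) ?_
  rw [← LinearMap.range_eq_top, Finsupp.range_linearCombination, hu]


/-! ## Monomials as words -/

section Monomials

variable {m : ℕ}

/-- The exponents `p` and `q` at two adjacent positions instead of those given by `a`. -/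
def setPair (a : Fin m → ℕ) (i : Letter m) (p q : ℕ) : Fin m → ℕ :=
  Function.update (Function.update a i.lo p) i.hi q

theorem setPair_lo (a : Fin m → ℕ) (i : Letter m) (p q : ℕ) : setPair a i p q i.lo = p := by
  rw [setPair, Function.update_of_ne i.lo_ne_hi, Function.update_self]

theorem setPair_hi (a : Fin m → ℕ) (i : Letter m) (p q : ℕ) : setPair a i p q i.hi = q := by
  rw [setPair, Function.update_self]

theorem setPair_of_ne (a : Fin m → ℕ) {i : Letter m} (p q : ℕ) {j : Fin m} (h : j ≠ i.lo)
    (h' : j ≠ i.hi) : setPair a i p q j = a j := by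
  rw [setPair, Function.update_of_ne h', Function.update_of_ne h]

theorem setPair_self (a : Fin m → ℕ) (i : Letter m) : setPair a i (a i.lo) (a i.hi) = a := by
  rw [setPair, Function.update_eq_self, Function.update_eq_self]

/-- The monomial `x^a` as a word. -/
def expWord (a : Fin m → ℕ) : List ℕ :=
  (List.ofFn fun j : Fin m => List.replicate (a j) (j.1 + 1)).flatten

theorem count_expWord (a : Fin m → ℕ) (i : ℕ) :
    (expWord a).count i = ∑ j : Fin m, if j.1 + 1 = i then a j else 0 := by
  rw [expWord, List.count_flatten, List.map_ofFn, List.sum_ofFn]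
  refine Finset.sum_congr rfl fun j _ => ?_
  simp [List.count_replicate]

theorem expWord_setPair_perm (a : Fin m → ℕ) (i : Letter m) (p q : ℕ) :
    (expWord (setPair a i p q)).Perm (expWord (setPair a i 0 0) ++
      (List.replicate p i.1 ++ List.replicate q (i.1 + 1))) := by
  rw [List.perm_iff_count]
  intro c
  have h := i.2
  have e1 : i.hi.1 = i.1 := rfl
  have e2 : i.lo.1 = i.1 - 1 := rfl
  simp only [List.count_append, count_expWord, List.count_replicate, beq_iff_eq]
  rw [← Finset.add_sum_erase _ _ (Finset.mem_univ i.lo),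
    ← Finset.add_sum_erase _ _ (Finset.mem_erase.2 ⟨i.lo_ne_hi.symm, Finset.mem_univ i.hi⟩),
    ← Finset.add_sum_erase (a := i.lo) _ (fun j => if j.1 + 1 = c then setPair a i 0 0 j else 0)
      (Finset.mem_univ i.lo),
    ← Finset.add_sum_erase (a := i.hi) _ (fun j => if j.1 + 1 = c then setPair a i 0 0 j else 0)
      (Finset.mem_erase.2 ⟨i.lo_ne_hi.symm, Finset.mem_univ i.hi⟩),
    setPair_lo, setPair_hi, setPair_lo, setPair_hi]
  have : ∀ j ∈ (Finset.univ.erase i.lo).erase i.hi, (if j.1 + 1 = c then setPair a i p q j else 0) =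
      if j.1 + 1 = c then setPair a i 0 0 j else 0 := by
    intro j hj
    rw [Finset.mem_erase, Finset.mem_erase] at hj
    rw [setPair_of_ne _ _ _ hj.2.1 hj.1, setPair_of_ne _ _ _ hj.2.1 hj.1]
  rw [Finset.sum_congr rfl this, e1, e2]
  split_ifs <;> omega

theorem notMem_expWord_setPair (a : Fin m → ℕ) (i : Letter m) :
    i.1 ∉ expWord (setPair a i 0 0) ∧ i.1 + 1 ∉ expWord (setPair a i 0 0) := by
  have h := i.2
  rw [← List.count_eq_zero, ← List.count_eq_zero, count_expWord, count_expWord]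
  constructor <;>
  · refine Finset.sum_eq_zero fun j _ => ?_
    split_ifs with h'
    · first
        | rw [show j = i.lo from Fin.ext (by simp only [Letter.lo]; omega), setPair_lo]
        | rw [show j = i.hi from Fin.ext (by simp only [Letter.hi]; omega), setPair_hi]
    · rfl

namespace OddPoly

variable {k : Type*} [Field k] {n : ℕ}

theorem xs_replicate (p i : ℕ) : xs k n (List.replicate p i) = x i ^ p := by
  rw [xs, List.map_replicate, List.prod_replicate]

theorem mono_eq_xs (a : Fin m → ℕ) : mono k n a = xs k n (expWord a) := by
  rw [mono, expWord, xs, List.map_flatten, List.map_ofFn, List.prod_flatten, List.map_ofFn]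
  congr 2
  ext j
  simp [List.map_replicate, List.prod_replicate]

theorem mono_setPair (a : Fin m → ℕ) (i : Letter m) (p q : ℕ) :
    EqSign (mono k n (setPair a i p q))
      (xs k n (expWord (setPair a i 0 0)) * (x i.1 ^ p * x (i.1 + 1) ^ q)) := by
  rw [mono_eq_xs, ← xs_replicate p, ← xs_replicate q, ← xs_append, ← xs_append]
  exact xs_eqSign (expWord_setPair_perm a i p q)

/-- The span of the monomials in `x_i, x_{i+1}` that are smaller than `x_i^p x_{i+1}^q`. -/
def smallerSpan (k : Type*) [Field k] (n i p q : ℕ) : Submodule k (OddPoly k n) :=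
  Submodule.span k {f | ∃ p' q', p' + q' = p + q ∧ p ≤ q' ∧ q' < q ∧ f = x i ^ p' * x (i + 1) ^ q'}

theorem x_mul_x_eqSign (i j : ℕ) : EqSign (x i * x j : OddPoly k n) (x j * x i) := by
  by_cases h : i = j
  · rw [h]; exact .refl _
  · exact Or.inr (x_mul_x h)

theorem x_mul_x_pow_eqSign (i j p : ℕ) :
    EqSign ((x j : OddPoly k n) * x i ^ p) (x i ^ p * x j) := by
  induction p with
  | zero => rw [pow_zero, one_mul, mul_one]; exact .refl _
  | succ p ih =>
    rw [pow_succ, ← mul_assoc]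
    refine (ih.mul_right _).trans ?_
    rw [mul_assoc, mul_assoc]
    exact (x_mul_x_eqSign j i).mul_left _

theorem x_mul_x_mul_pow (i p q : ℕ) :
    EqSign ((x i : OddPoly k n) * x (i + 1) * (x i ^ p * x (i + 1) ^ q))
      (x i ^ (p + 1) * x (i + 1) ^ (q + 1)) := by
  rw [mul_assoc, ← mul_assoc (x (i + 1)), pow_succ', pow_succ', mul_assoc (x i)]
  refine EqSign.mul_left _ (((x_mul_x_pow_eqSign i (i + 1) p).mul_right _).trans ?_)
  rw [mul_assoc]
  exact .refl _

/-- The leading term of a divided difference. -/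
theorem dd_pow_mul_pow (i : ℕ) {p q : ℕ} (h : p ≤ q) :
    ∃ u, EqSign u (x i ^ p * x (i + 1) ^ q : OddPoly k n) ∧
      dd i (x i ^ p * x (i + 1) ^ (q + 1)) - u ∈ smallerSpan k n i p q := by
  induction p generalizing q with
  | zero =>
    refine ⟨_, .refl _, ?_⟩
    -- The leading term comes from `∂_i(x_{i+1} x_{i+1}^q) = x_{i+1}^q - x_i ∂_i(x_{i+1}^q)`; the
    -- second summand has only smaller powers of `x_{i+1}`.
    rw [pow_zero, one_mul, one_mul, pow_succ', dd_x_succ_mul, sub_sub_cancel_left]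
    refine neg_mem ?_
    clear h
    induction q with
    | zero => rw [pow_zero, dd_one, mul_zero]; exact zero_mem _
    | succ q ih =>
      rw [pow_succ', dd_x_succ_mul, mul_sub]
      refine sub_mem (Submodule.subset_span ⟨1, q, by omega, by omega, by omega, ?_⟩) ?_
      · rw [pow_one]
      · have h1 := Submodule.mem_map_of_mem (f := LinearMap.mulLeft k (x i : OddPoly k n)) ih
        rw [smallerSpan, Submodule.map_span] at h1
        refine Submodule.span_mono ?_ h1
        rintro _ ⟨_, ⟨p', q', h1, h2, h3, rfl⟩, rfl⟩
        exact ⟨p' + 1, q', by omega, by omega, by omega, by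
          rw [LinearMap.mulLeft_apply, pow_succ', mul_assoc]⟩
  | succ p ih =>
    obtain ⟨q, rfl⟩ : ∃ q', q = q' + 1 := ⟨q - 1, by omega⟩
    obtain ⟨u, hu, hu'⟩ := ih (q := q) (by omega)
    -- The invariant factor `x_i x_{i+1}` moves through `∂_i` and reduces both exponents by one.
    have hinv : IsInvariant i (x i * x (i + 1) : OddPoly k n) := by
      have := isInvariant_xs_of_mem (k := k) (n := n) (i := i) (L := [i, i + 1]) (by simp) (by simp)
        (by simp)
      simpa [xs] using this
    have h1 : EqSign (dd i (x i ^ (p + 1) * x (i + 1) ^ (q + 1 + 1) : OddPoly k n))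
        (x i * x (i + 1) * dd i (x i ^ p * x (i + 1) ^ (q + 1))) :=
      ((x_mul_x_mul_pow i p (q + 1)).symm.map (dd i)).trans (hinv.dd_mul _)
    have h2 : x i * x (i + 1) * dd i (x i ^ p * x (i + 1) ^ (q + 1)) - x i * x (i + 1) * u ∈
        smallerSpan k n i (p + 1) (q + 1) := by
      rw [← mul_sub]
      have h1 := Submodule.mem_map_of_mem
        (f := LinearMap.mulLeft k (x i * x (i + 1) : OddPoly k n)) hu'
      rw [smallerSpan, Submodule.map_span] at h1
      refine Submodule.span_le.2 ?_ h1
      rintro _ ⟨_, ⟨p', q', h1, h2, h3, rfl⟩, rfl⟩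
      exact (x_mul_x_mul_pow i p' q').mem (Submodule.subset_span
        ⟨p' + 1, q' + 1, by omega, by omega, by omega, rfl⟩)
    have h3 : EqSign (x i * x (i + 1) * u) (x i ^ (p + 1) * x (i + 1) ^ (q + 1)) :=
      (hu.mul_left _).trans (x_mul_x_mul_pow i p q)
    rcases h1 with h1 | h1
    · exact ⟨_, h3, by rw [h1]; exact h2⟩
    · refine ⟨-(x i * x (i + 1) * u), (EqSign.neg_left _).trans h3, ?_⟩
      rw [h1, ← neg_sub_neg, neg_neg, neg_neg, ← neg_sub]
      exact neg_mem h2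

end OddPoly

end Monomials

/-! ## Spanning sets for the left ideals of the idempotents -/

section LeftSpan

variable {k : Type*} [Field k] [NeZero (2 : k)] {n m : ℕ}
  {red : Equiv.Perm (Fin m) → List (Letter m)}

open CycQuot

/-- The right span of the `h x^a τ_w` with `a ∈ Y_{l,m}`. -/
def strictSpan (n : ℕ) (red : Equiv.Perm (Fin m) → List (Letter m)) (l : ℕ) (h : ONH k m) :
    Submodule (A k n)ᵐᵒᵖ (CycQuot k n m) :=
  Submodule.span (A k n)ᵐᵒᵖ (Set.range fun i : Y n l m × Equiv.Perm (Fin m) =>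
    ofONH k n m (h * monomial k i.1.1 * tauWord k (red i.2)))

theorem exists_le_of_notMem_Y {l : ℕ} {a : Fin m → ℕ} (ha : a ∈ X n m) (ha' : a ∉ Y n l m) :
    ∃ i : Letter m, l ≤ i.1 ∧ a i.lo ≤ a i.hi := by
  by_contra! hcon
  refine ha' ⟨ha, fun i j hi hij => ?_⟩
  obtain ⟨d, hd⟩ : ∃ d, j.1 = i.1 + d + 1 := ⟨j.1 - i.1 - 1, by rw [Fin.lt_def] at hij; omega⟩
  have hstep : ∀ i j : Fin m, l ≤ i.1 + 1 → j.1 = i.1 + 1 → a j < a i := by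
    intro i j hi hj
    have := hcon ⟨j.1, by omega⟩ (by simp only; omega)
    rwa [show Letter.lo ⟨j.1, _⟩ = i from Fin.ext (by simp only [Letter.lo]; omega)] at this
  induction d generalizing j with
  | zero => exact hstep i j hi hd
  | succ d ih =>
    have h1 := ih ⟨i.1 + d + 1, by omega⟩ (by rw [Fin.lt_def]; simp only; omega) rfl
    exact (hstep _ j (by simp only; omega) (by simp only; omega)).trans h1

theorem smul_mem_strictSpan {l : ℕ} {h : ONH k m} (r : k) {q : CycQuot k n m}
    (hq : q ∈ strictSpan n red l h) : r • q ∈ strictSpan n red l h := by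
  have : r • q = MulOpposite.op (algebraMap k (A k n) r) • q := by
    rw [op_smul_eq, AlgHom.commutes, ← Algebra.commutes, Algebra.smul_def]
  rw [this]
  exact Submodule.smul_mem _ _ hq

/-- This is `t_mul_ofPoly` multiplied on the left by the longest element, which kills the term
starting with `τ_i`. Applied to `q = τ_w`, it makes divided differences vanish modulo longer
permutations. -/
theorem tauLongest_mul_dd {l i : ℕ} (hl : 1 ≤ l) (hi : l ≤ i) (hi' : i < m) (f : OddPoly k n)
    (q : CycQuot k n m) :
    ofONH k n m (tauLongest k m l m) * (ofPoly k n m (OddPoly.dd i f) * q) =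
      -(ofONH k n m (tauLongest k m l m) * (ofPoly k n m (OddPoly.sg i f) *
        (ofONH k n m (ONH.t k m i) * q))) := by
  have h1 := congrArg (fun y => ofONH k n m (tauLongest k m l m) * y * q)
    (t_mul_ofPoly (k := k) (n := n) (m := m) ⟨hl.trans hi, hi'⟩ f)
  simp only [← mul_assoc] at h1 ⊢
  rw [← map_mul, tauLongest_mul_t k hl hi hi', map_zero, zero_mul, zero_mul, mul_add, add_mul,
    ← mul_assoc] at h1
  exact (neg_eq_of_add_eq_zero_right h1.symm).symm

/-- Straightening, by descending induction on length and, inside it, induction on the weight `∑ j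
a_j`. If `a_i ≤ a_{i+1}` for some `i ≥ l`, then `x^a` is up to sign the leading term of a divided
difference `∂_i`; that divided difference moves to longer permutations, and the other terms have
smaller weight. -/
theorem tauLongest_mul_mem {l : ℕ} (hl : 1 ≤ l) (hred : ∀ w, IsReduced w (red w)) (r : ℕ) :
    ∀ q ∈ basisSpan k n red r,
      ofONH k n m (tauLongest k m l m) * q ∈ strictSpan n red l (tauLongest k m l m) := by
  obtain ⟨d, hd⟩ : ∃ d, inv (longest m) + 1 ≤ r + d := ⟨inv (longest m) + 1, by omega⟩
  induction d generalizing r with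
  | zero =>
    intro q hq
    have : basisSpan k n red r ≤ ⊥ := by
      refine Submodule.span_le.2 ?_
      rintro _ ⟨a, _, w, hw, _⟩
      have := inv_le_longest w
      omega
    rw [(Submodule.mem_bot k).1 (this hq), mul_zero]
    exact zero_mem _
  | succ d ih =>
    have key : ∀ s a, (expWord a).sum = s → a ∈ X n m → ∀ w : Equiv.Perm (Fin m), r ≤ inv w →
        ofONH k n m (tauLongest k m l m) * (ofPoly k n m (OddPoly.mono k n a) *
          ofONH k n m (tauWord k (red w))) ∈ strictSpan n red l (tauLongest k m l m) := by
      intro s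
      induction s using Nat.strong_induction_on with | _ s ihs
      intro a has ha w hw
      by_cases haY : a ∈ Y n l m
      · rw [ofPoly_mono, ← map_mul, ← map_mul, ← mul_assoc]
        exact Submodule.subset_span ⟨(⟨a, haY⟩, w), rfl⟩
      obtain ⟨i, hi, hle⟩ := exists_le_of_notMem_Y ha haY
      obtain ⟨u, hu, hu'⟩ := OddPoly.dd_pow_mul_pow (k := k) (n := n) i.1 hle
      -- `L` collects the variables other than `x_i, x_{i+1}`, on which `∂_i` acts only by a sign.
      set L := expWord (setPair a i 0 0) with hL
      set g : OddPoly k n := OddPoly.xs k n L *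
        (OddPoly.x i.1 ^ a i.lo * OddPoly.x (i.1 + 1) ^ (a i.hi + 1)) with hg
      let V : Submodule k (OddPoly k n) :=
        { carrier := {f | ofONH k n m (tauLongest k m l m) * (ofPoly k n m f *
            ofONH k n m (tauWord k (red w))) ∈ strictSpan n red l (tauLongest k m l m)}
          add_mem' := fun {f f'} h h' => by
            simp only [Set.mem_ofPred_eq, map_add, add_mul, mul_add] at *
            exact add_mem h h'
          zero_mem' := by
            simp only [Set.mem_ofPred_eq, map_zero, zero_mul, mul_zero]
            exact zero_mem _
          smul_mem' := fun r f h => by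
            simp only [Set.mem_ofPred_eq, map_smul, smul_mul_assoc, mul_smul_comm] at *
            exact smul_mem_strictSpan r h }
      have hV : ∀ f, f ∈ V ↔ ofONH k n m (tauLongest k m l m) * (ofPoly k n m f *
        ofONH k n m (tauWord k (red w))) ∈ strictSpan n red l (tauLongest k m l m) := fun _ => Iff.rfl
      rw [← hV]
      have h1 : OddPoly.dd i.1 g ∈ V := by
        rw [hV, tauLongest_mul_dd hl hi i.2.2]
        refine neg_mem (ih (r + 1) (by omega) _ (polySpan_le_basisSpan hred _ ?_))
        refine ofPoly_mul_mem_polySpan _ ?_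
        rw [← map_mul]
        rcases t_mul_tauWord_red (k := k) hred i w with h | ⟨h1, h2⟩
        · rw [h, map_zero]; exact zero_mem _
        · have := ofPoly_mul_tauWord_mem (k := k) (n := n) (red := red) (r := r + 1) 1
            (w := simple i * w) (by omega)
          rw [map_one, one_mul] at this
          exact (h2.map (ofONH k n m)).mem this
      have h2 : OddPoly.xs k n L * OddPoly.dd i.1
          (OddPoly.x i.1 ^ a i.lo * OddPoly.x (i.1 + 1) ^ (a i.hi + 1)) ∈ V :=
        ((OddPoly.isInvariant_xs_of_notMem (notMem_expWord_setPair a i).1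
          (notMem_expWord_setPair a i).2).dd_mul _).symm.mem h1
      have h3 : OddPoly.xs k n L * (OddPoly.dd i.1
          (OddPoly.x i.1 ^ a i.lo * OddPoly.x (i.1 + 1) ^ (a i.hi + 1)) - u) ∈ V := by
        refine Submodule.span_le (p := V.comap (LinearMap.mulLeft k (OddPoly.xs k n L))).2 ?_ hu'
        rintro _ ⟨p', q', h4, h5, h6, rfl⟩
        refine (OddPoly.mono_setPair a i p' q').symm.mem ((hV _).2 (ihs _ ?_ _ rfl ?_ w hw))
        · have e1 := (expWord_setPair_perm a i p' q').sum_eq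
          have e2 := (expWord_setPair_perm a i (a i.lo) (a i.hi)).sum_eq
          rw [setPair_self, has] at e2
          rw [e1, e2]
          simp only [List.sum_append, List.sum_replicate, smul_eq_mul]
          nlinarith
        -- The new exponents at `i` and `i + 1` are both at most `a i.hi`, hence within the bounds
        -- of `X n m`, which are the stricter ones at `i + 1`.
        · intro j
          by_cases hj : j = i.hi
          · have := ha i.hi
            rw [hj, setPair_hi]
            omega
          by_cases hj' : j = i.lo
          · have := ha i.hi
            have e1 : i.hi.1 = i.1 := rfl
            have e2 : i.lo.1 = i.1 - 1 := rfl
            rw [hj', setPair_lo]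
            omega
          · rw [setPair_of_ne _ _ _ hj' hj]
            exact ha j
      rw [mul_sub] at h3
      have h4 := (Submodule.sub_mem_iff_right V h2).1 h3
      have h5 := OddPoly.mono_setPair (k := k) (n := n) a i (a i.lo) (a i.hi)
      rw [setPair_self] at h5
      exact (h5.trans (hu.symm.mul_left _)).mem h4
    intro q hq
    induction hq using Submodule.span_induction with
    | mem q hq =>
      obtain ⟨a, ha, w, hw, c, rfl⟩ := hq
      rw [← mul_assoc, ← op_smul_eq, map_mul, ← ofPoly_mono]
      exact Submodule.smul_mem _ _ (key _ a rfl ha w hw)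
    | zero => rw [mul_zero]; exact zero_mem _
    | add q q' _ _ h h' => rw [mul_add]; exact add_mem h h'
    | smul r q _ hq => rw [mul_smul_comm]; exact smul_mem_strictSpan r hq

theorem idem'_mul_mem {l : ℕ} (hl : 1 ≤ l) (hred : ∀ w, IsReduced w (red w)) (q : CycQuot k n m) :
    ofONH k n m (idem' k m l m) * q ∈ strictSpan n red l (idem' k m l m) := by
  have h1 := tauLongest_mul_mem (k := k) (n := n) hl hred 0 q (by rw [basisSpan_zero hred]; trivial)
  rw [idem', map_mul, mul_assoc]
  generalize ofONH k n m (tauLongest k m l m) * q = y at h1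
  induction h1 using Submodule.span_induction with
  | mem y hy =>
    obtain ⟨i, rfl⟩ := hy
    refine Submodule.subset_span ⟨i, ?_⟩
    simp only [map_mul, mul_assoc]
  | zero => rw [mul_zero]; exact zero_mem _
  | add q q' _ _ h h' => rw [mul_add]; exact add_mem h h'
  | smul c q _ hq =>
    induction c using MulOpposite.rec' with
    | h c =>
      rw [op_smul_eq, ← mul_assoc, ← op_smul_eq]
      exact Submodule.smul_mem _ _ hq

end LeftSpan


/-! ## The two-sided ideal of the longest element -/

section Decomposition

variable {k : Type*} [Field k] {m : ℕ}

theorem prod_t_mul_x {L : List ℕ} {l : ℕ} (hL : ∀ i ∈ L, l < i ∧ 1 ≤ i ∧ i < m) :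
    EqSign ((L.map (ONH.t k m)).prod * ONH.x k m l) (ONH.x k m l * (L.map (ONH.t k m)).prod) := by
  induction L with
  | nil => rw [List.map_nil, List.prod_nil, one_mul, mul_one]; exact .refl _
  | cons i L ih =>
    have hi := hL i List.mem_cons_self
    have h1 : ONH.t k m i * ONH.x k m l = -(ONH.x k m l * ONH.t k m i) := by
      rw [ONH.t_mul_x hi.2, if_neg (by omega), Equiv.swap_apply_of_ne_of_ne (by omega) (by omega),
        zero_sub]
    rw [List.map_cons, List.prod_cons, mul_assoc]
    refine ((ih fun j hj => hL j (List.mem_cons_of_mem _ hj)).mul_left _).trans ?_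
    rw [← mul_assoc, h1, neg_mul, mul_assoc]
    exact EqSign.neg_left _

theorem prod_t_mul_t {L : List ℕ} {i : ℕ} (hi : 1 ≤ i ∧ i < m) (hL : ∀ j ∈ L, 1 ≤ j ∧ j + 1 < i) :
    EqSign ((L.map (ONH.t k m)).prod * ONH.t k m i) (ONH.t k m i * (L.map (ONH.t k m)).prod) := by
  induction L with
  | nil => rw [List.map_nil, List.prod_nil, one_mul, mul_one]; exact .refl _
  | cons j L ih =>
    have hj := hL j List.mem_cons_self
    rw [List.map_cons, List.prod_cons, mul_assoc]
    refine ((ih fun j hj => hL j (List.mem_cons_of_mem _ hj)).mul_left _).trans ?_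
    rw [← mul_assoc, ONH.t_mul_t_far k (by omega) hi (Or.inl hj.2), neg_mul, mul_assoc]
    exact EqSign.neg_left _

variable (k m) in
/-- The product `τ_l ⋯ τ_{l+j-1}`. -/
def ascending (l j : ℕ) : ONH k m := ((List.range' l j).map (ONH.t k m)).prod

theorem ascending_zero (l : ℕ) : ascending k m l 0 = 1 := rfl

theorem ascending_succ (l j : ℕ) :
    ascending k m l (j + 1) = ascending k m l j * ONH.t k m (l + j) := by
  rw [ascending, List.range'_1_concat, List.map_append, List.prod_append, List.map_singleton,
    List.prod_singleton, ascending]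

/-- Each exchange of `x_{l+j+1}` with `τ_{l+j}` produces an extra term `1`. In that term the
following `τ_{l+j+1}` passes left through the shorter product up to sign and is killed by
`τ_{ω₀[l+1,m]}`; only the main term survives, and in the end `x_l` stands on the left. -/
theorem tauLongest_mul_ascending_mul_x {l : ℕ} (hl : 1 ≤ l) {j : ℕ} (hj : l + j < m) :
    EqSign (tauLongest k m (l + 1) m * ascending k m l j * ONH.x k m (l + j) * ONH.t k m (l + j))
      (ONH.x k m l * (tauLongest k m (l + 1) m * ascending k m l (j + 1))) := by
  induction j with
  | zero =>
    have h1 := tauLongest_eq k m (l + 1) (m - (l + 1))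
    rw [Nat.add_sub_cancel' (by omega)] at h1
    rw [ascending_succ, ascending_zero, mul_one, one_mul, ← mul_assoc, h1, add_zero]
    refine EqSign.mul_right (prod_t_mul_x fun i hi => ?_) _
    have := mem_upWord hi
    omega
  | succ j ih =>
    have h1 : ONH.t k m (l + j) * ONH.x k m (l + (j + 1)) =
        1 - ONH.x k m (l + j) * ONH.t k m (l + j) := by
      rw [← add_assoc, ONH.t_mul_x (by omega), if_pos (Or.inr rfl), Equiv.swap_apply_right]
    have h2 : tauLongest k m (l + 1) m * ascending k m l j * ONH.t k m (l + (j + 1)) = 0 := by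
      rw [mul_assoc]
      refine ((prod_t_mul_t (by omega) fun i hi => ?_).mul_left _).eq_zero ?_
      · rw [List.mem_range'_1] at hi; omega
      · rw [← mul_assoc, tauLongest_mul_t k (by omega) (by omega) hj, zero_mul]
    have h3 : tauLongest k m (l + 1) m * ascending k m l (j + 1) * ONH.x k m (l + (j + 1)) *
        ONH.t k m (l + (j + 1)) = -(tauLongest k m (l + 1) m * ascending k m l j *
          ONH.x k m (l + j) * ONH.t k m (l + j) * ONH.t k m (l + (j + 1))) := by
      rw [ascending_succ, ← mul_assoc, mul_assoc _ (ONH.t k m (l + j)), h1, mul_sub, sub_mul,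
        mul_one, h2, zero_sub, mul_assoc _ (ONH.x k m _)]
    rw [h3]
    refine (EqSign.neg_left _).trans (((ih (by omega)).mul_right _).trans ?_)
    rw [ascending_succ l (j + 1), mul_assoc, mul_assoc]
    exact .refl _

theorem tauLongest_mul_ascending {l : ℕ} (hl : 1 ≤ l) (hm : l < m) :
    EqSign (tauLongest k m (l + 1) m * ascending k m l (m - l)) (tauLongest k m l m) := by
  have h1 := tauLongest_eq k m (l + 1) (m - (l + 1))
  rw [Nat.add_sub_cancel' (by omega)] at h1
  obtain ⟨L, hL⟩ := exists_map_val_eq (m := m)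
    (L := upWord (l + 1) (m - (l + 1)) ++ List.range' l (m - l)) fun i hi => by
      rcases List.mem_append.1 hi with hi | hi
      · have := mem_upWord hi; omega
      · rw [List.mem_range'_1] at hi; omega
  have h2 : tauLongest k m (l + 1) m * ascending k m l (m - l) = tauWord k L := by
    rw [h1, ascending, ← List.prod_append, ← List.map_append, ← hL, ONH.prod_map_t]
  rw [h2]
  refine (tauLongest_eqSign k hl hm.le ?_ ?_).symm
  · ext a
    obtain ⟨s, rfl⟩ : ∃ s, l = s + 1 := ⟨l - 1, by omega⟩
    rw [wordPerm_val, hL, natPerm_append, Equiv.Perm.mul_apply, natPerm_range', natPerm_upWord,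
      revFrom_val]
    split_ifs <;> omega
  · obtain ⟨L', e1, e2, e3⟩ := exists_upWord hl hm.le
    obtain ⟨N, hN⟩ : ∃ N, m - l = N + 1 := ⟨m - l - 1, by omega⟩
    rw [e3, ← List.length_map (f := Subtype.val), hL, ← List.length_map (f := Subtype.val) (as := L'),
      e1, List.length_append, length_upWord, length_upWord, List.length_range', hN,
      show m - (l + 1) = N by omega, Nat.choose_succ_succ' (N + 1), Nat.choose_one_right, add_comm]

/-- Insert `1 = x_{l+j} τ_{l+j} + τ_{l+j} x_{l+j+1}`. Both terms lead to the longer product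
`ascending (j + 1)`, the first with an additional `x_l` on the left; hence the exponents of `x_l`
run only up to `c`. -/
theorem exists_tauLongest_mul_ascending_eq {l : ℕ} (hl : 1 ≤ l) (hm : l < m) {c j : ℕ}
    (hc : j + c = m - l) : ∃ r : ℕ → ONH k m, tauLongest k m (l + 1) m * ascending k m l j =
      ∑ e ∈ Finset.range (c + 1), ONH.x k m l ^ e * tauLongest k m l m * r e := by
  induction c generalizing j with
  | zero =>
    rw [add_zero] at hc
    rw [hc]
    rcases tauLongest_mul_ascending (k := k) hl hm with h | h
    · exact ⟨fun _ => 1, by simp [h]⟩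
    · exact ⟨fun _ => -1, by simp [h]⟩
  | succ c ih =>
    obtain ⟨r, hr⟩ := ih (j := j + 1) (by omega)
    have h1 : ONH.x k m (l + j) * ONH.t k m (l + j) +
        ONH.t k m (l + j) * ONH.x k m (l + j + 1) = 1 := by
      rw [ONH.t_mul_x (by omega), if_pos (Or.inr rfl), Equiv.swap_apply_right, add_sub_cancel]
    have h2 : tauLongest k m (l + 1) m * ascending k m l j =
        tauLongest k m (l + 1) m * ascending k m l j * ONH.x k m (l + j) * ONH.t k m (l + j) +
          tauLongest k m (l + 1) m * ascending k m l (j + 1) * ONH.x k m (l + j + 1) := by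
      rw [ascending_succ, ← mul_assoc, mul_assoc _ (ONH.x k m _), mul_assoc _ (ONH.t k m _),
        ← mul_add, h1, mul_one]
    obtain ⟨s, hs⟩ : ∃ s : ONH k m, tauLongest k m (l + 1) m * ascending k m l j *
        ONH.x k m (l + j) * ONH.t k m (l + j) = ONH.x k m l *
          (tauLongest k m (l + 1) m * ascending k m l (j + 1)) * s := by
      rcases tauLongest_mul_ascending_mul_x (k := k) (m := m) hl (j := j) (by omega) with h | h
      · exact ⟨1, by rw [h, mul_one]⟩
      · exact ⟨-1, by rw [h, mul_neg_one]⟩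
    refine ⟨fun e => (if e = 0 then 0 else r (e - 1) * s) +
      if e ≤ c then r e * ONH.x k m (l + j + 1) else 0, ?_⟩
    simp only [mul_add, Finset.sum_add_distrib]
    rw [h2, hs, hr]
    congr 1
    · rw [Finset.sum_range_succ' _ (c + 1), if_pos rfl, mul_zero, add_zero, Finset.mul_sum,
        Finset.sum_mul]
      refine Finset.sum_congr rfl fun e _ => ?_
      rw [if_neg e.succ_ne_zero, Nat.add_sub_cancel, pow_succ']
      simp only [mul_assoc]
    · rw [Finset.sum_range_succ _ (c + 1), if_neg (Nat.not_succ_le_self c), mul_zero, add_zero,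
        Finset.sum_mul]
      refine Finset.sum_congr rfl fun e he => ?_
      rw [if_pos (Nat.lt_succ_iff.1 (Finset.mem_range.1 he)), mul_assoc]

/-- Passing from `τ_{ω₀[l+1,m]}` to `τ_{ω₀[l,m]}` multiplies the number of terms by `m - l + 1`. The
resulting factorial is the one in `card_Y_le`, so the later rank count leaves no slack. -/
theorem exists_sum_mul_tauLongest_mul_eq_one {l : ℕ} (hl : 1 ≤ l) {N : ℕ} (hN : l + N = m) :
    ∃ (B : Type) (_ : Fintype B) (u v : B → ONH k m), Fintype.card B = (N + 1).factorial ∧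
      ∑ b, u b * tauLongest k m l m * v b = 1 := by
  induction N generalizing l with
  | zero =>
    refine ⟨Unit, inferInstance, fun _ => 1, fun _ => 1, rfl, ?_⟩
    have : tauLongest k m l m = 1 := by rw [← hN, tauLongest_eq]; rfl
    simp [this]
  | succ N ih =>
    obtain ⟨B, _, u, v, hB, h⟩ := ih (l := l + 1) (by omega) (by omega)
    obtain ⟨r, hr⟩ := exists_tauLongest_mul_ascending_eq (k := k) (m := m) hl (by omega) (c := N + 1)
      (j := 0) (by omega)
    rw [ascending_zero, mul_one] at hr
    refine ⟨B × Fin (N + 1 + 1), inferInstance, fun b => u b.1 * ONH.x k m l ^ b.2.1,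
      fun b => r b.2.1 * v b.1, ?_, ?_⟩
    · rw [Fintype.card_prod, hB, Fintype.card_fin, Nat.factorial_succ (N + 1), mul_comm]
    · rw [Fintype.sum_prod_type, ← h]
      refine Finset.sum_congr rfl fun b _ => ?_
      rw [hr, Finset.mul_sum, Finset.sum_mul, Finset.sum_range]
      refine Finset.sum_congr rfl fun e _ => ?_
      simp only [mul_assoc]

end Decomposition

/-! ## Bases for the idempotents -/

section IdempotentBases

variable {k : Type*} [Field k] [NeZero (2 : k)] {n m : ℕ}
  {red : Equiv.Perm (Fin m) → List (Letter m)}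

open CycQuot

/-- Left multiplication as a map of right modules. -/
def CycQuot.mulLeftOp (q : CycQuot k n m) : CycQuot k n m →ₗ[(A k n)ᵐᵒᵖ] CycQuot k n m where
  toFun y := q * y
  map_add' := mul_add q
  map_smul' c y := (mul_assoc q y (ofA k n m c.unop)).symm

/-- The translates of this family by the elements `u_b τ_{ω₀[l,m]}` generate the whole algebra and
are no more numerous than its basis, so already all translates together are independent. -/
theorem linearIndependent_idem'_mul {l : ℕ} (hl : 1 ≤ l) (hlm : l ≤ m)
    (hred : ∀ w, IsReduced w (red w)) :
    LinearIndependent (A k n)ᵐᵒᵖ fun i : Y n l m × Equiv.Perm (Fin m) =>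
      ofONH k n m (idem' k m l m * monomial k i.1.1 * tauWord k (red i.2)) := by
  obtain ⟨B, _, u, v, hB, h1⟩ :=
    exists_sum_mul_tauLongest_mul_eq_one (k := k) (m := m) hl (N := m - l) (by omega)
  let F : B × (Y n l m × Equiv.Perm (Fin m)) → CycQuot k n m := fun i =>
    mulLeftOp (ofONH k n m (u i.1 * tauLongest k m l m))
      (ofONH k n m (idem' k m l m * monomial k i.2.1.1 * tauWord k (red i.2.2)))
  have hspan : Submodule.span (A k n)ᵐᵒᵖ (Set.range F) = ⊤ := by
    refine top_unique fun q _ => ?_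
    have h2 : q = ∑ b, ofONH k n m (u b * tauLongest k m l m) * (ofONH k n m (v b) * q) := by
      have := congrArg (fun y => ofONH k n m y * q) h1
      simp only [map_sum, Finset.sum_mul, map_one, one_mul] at this
      refine this.symm.trans (Finset.sum_congr rfl fun b _ => ?_)
      rw [map_mul, mul_assoc]
    rw [h2]
    refine sum_mem fun b _ => ?_
    have h3 : ∀ y, ofONH k n m (u b * tauLongest k m l m) * (ofONH k n m (idem' k m l m) * y) ∈
        Submodule.span (A k n)ᵐᵒᵖ (Set.range F) := by
      intro y
      have h4 := Submodule.mem_map_of_mem (f := mulLeftOp (ofONH k n m (u b * tauLongest k m l m)))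
        (idem'_mul_mem (k := k) (n := n) hl hred y)
      rw [strictSpan, Submodule.map_span] at h4
      refine Submodule.span_mono ?_ h4
      rintro _ ⟨_, ⟨i, rfl⟩, rfl⟩
      exact ⟨(b, i), rfl⟩
    -- Since `τ_{ω₀[l,m]} e' = ± τ_{ω₀[l,m]}`, the idempotent can be inserted in each summand of
    -- `q`.
    have h5 := (tauLongest_mul_idem' (k := k) (n := n) hl hlm).mul_left (ofONH k n m (u b))
    rw [← mul_assoc, ← map_mul] at h5
    have h6 := h3 (ofONH k n m (v b) * q)
    rw [← mul_assoc] at h6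
    rcases h5 with h5 | h5
    · rwa [h5] at h6
    · rw [h5, neg_mul] at h6
      exact neg_mem_iff.1 h6
  have hF : LinearIndependent (A k n)ᵐᵒᵖ F := by
    refine linearIndependent_of_span_of_card_le
      (linearIndependent_monomial_tauWord (hl.trans hlm) hred)
      (SetLike.coe_injective (isSuperBasis_monomial_tauWord (hl.trans hlm) hred).right_span) hspan ?_
    obtain ⟨s, rfl⟩ : ∃ s, l = s + 1 := ⟨l - 1, by omega⟩
    obtain ⟨N, rfl⟩ : ∃ N, m = s + N := ⟨m - s, by omega⟩
    have := card_Y_le n s N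
    rw [Nat.card_eq_fintype_card, Nat.card_eq_fintype_card] at this
    rw [Fintype.card_prod, Fintype.card_prod, Fintype.card_prod, hB, ← mul_assoc,
      show s + N - (s + 1) + 1 = N by omega]
    exact Nat.mul_le_mul_right _ this
  have hne : Nonempty B := Fintype.card_pos_iff.1 (hB ▸ Nat.factorial_pos _)
  obtain ⟨b⟩ := hne
  exact LinearIndependent.of_comp (mulLeftOp (ofONH k n m (u b * tauLongest k m l m)))
    (hF.comp (fun i => (b, i)) fun i j h => (Prod.mk.inj h).2)

/-- A family is independent if a homogeneous right multiple is independent up to signs. -/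
theorem linearIndependent_of_mul {I : Type*} {u v : I → CycQuot k n m} {h : ONH k m}
    (hh : IsHomog h) (huv : ∀ i, EqSign (v i * ofONH k n m h) (u i))
    (hu : LinearIndependent (A k n)ᵐᵒᵖ u) : LinearIndependent (A k n)ᵐᵒᵖ v := by
  rw [linearIndependent_iff'] at hu ⊢
  intro s g hg i hi
  obtain ⟨t, ht⟩ := ofA_mul_ofONH' (n := n) hh
  have hε : ∀ i, ∃ ε : A k n, IsUnit ε ∧ v i * ofONH k n m h = u i * ofA k n m ε := by
    intro i
    rcases huv i with h | h
    · exact ⟨1, isUnit_one, by rw [h, map_one, mul_one]⟩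
    · exact ⟨-1, isUnit_one.neg, by rw [h, map_neg, map_one, mul_neg_one]⟩
  choose ε hε hε' using hε
  have h1 := hu s (fun i => MulOpposite.op (ε i * (A.parity k n)^[t] (g i).unop)) ?_ i hi
  · refine MulOpposite.unop_injective (A.iterate_parity_eq_zero (t := t) ?_)
    exact (hε i).mul_right_eq_zero.1 (MulOpposite.op_injective h1)
  · have h2 := congrArg (· * ofONH k n m h) hg
    simp only [zero_mul, Finset.sum_mul] at h2
    rw [← h2]
    refine Finset.sum_congr rfl fun i _ => ?_
    rw [op_smul_eq, map_mul, ← mul_assoc, ← hε', mul_assoc, ← ht, ← mul_assoc]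
    rfl

/-- For independence, multiply on the right by `τ_{ω₀[p,m]}`: up to sign the elements become `e' x^a
τ_v` with pairwise distinct pairs `(a, v)`. For spanning, multiply the generators `e' x^a τ_w` by
`e`: only permutations increasing on `p, …, m` survive, and these are the chosen representatives. -/
theorem isSuperBasis_idem'_mul_idem {l p : ℕ} (hl : 1 ≤ l) (hlm : l ≤ m) (hp : 1 ≤ p) (hpm : p ≤ m)
    (hred : ∀ w, IsReduced w (red w))
    {rep : Equiv.Perm (Fin m) ⧸ intervalSubgroup p m → Equiv.Perm (Fin m)}
    (hrep : IsMinimalSection p m rep) :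
    IsSuperBasis (k := k) (n := n) (m := m)
      (fun i : Y n l m × (Equiv.Perm (Fin m) ⧸ intervalSubgroup p m) =>
        ofONH k n m (idem' k m l m * monomial k i.1.1 * tauWord k (red (rep i.2)) * idem k m p m))
      {y | ∃ h : CycQuot k n m,
        y = ofONH k n m (idem' k m l m) * h * ofONH k n m (idem k m p m)} := by
  refine isSuperBasis_of_right (fun i => (((isHomog_idem' _ _).mul (isHomog_monomial _)).mul
    (isHomog_tauWord _)).mul (isHomog_idem _ _)) ?_ ?_
  · have hinj : Function.Injective
        fun i : Y n l m × (Equiv.Perm (Fin m) ⧸ intervalSubgroup p m) =>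
          (i.1, rep i.2 * revFrom p) := by
      rintro ⟨a, ω⟩ ⟨a', ω'⟩ h
      simp only [Prod.mk.injEq] at h
      rw [h.1, ← (hrep ω).1, mul_right_cancel h.2, (hrep ω').1]
    refine linearIndependent_of_mul (isHomog_tauLongest p m) (fun i => ?_)
      ((linearIndependent_idem'_mul (k := k) (n := n) hl hlm hred).comp _ hinj)
    have h1 := ((tauWord_red_mul_tauLongest k hred hp hpm
      (increasingFrom_of_isMinimalSection hrep i.2)).mul_left
        (idem' k m l m * monomial k i.1.1)).map (ofONH k n m)
    refine EqSign.trans ?_ h1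
    rw [map_mul, mul_assoc, ← mul_assoc (idem' k m l m * _), map_mul _ _ (tauLongest k m p m)]
    exact (idem_mul_tauLongest hp hpm).mul_left _
  · refine Set.Subset.antisymm (fun q hq => ?_) ?_
    · rw [SetLike.mem_coe] at hq
      induction hq using Submodule.span_induction with
      | mem q hq =>
        obtain ⟨i, rfl⟩ := hq
        exact ⟨ofONH k n m (monomial k i.1.1 * tauWord k (red (rep i.2))), by
          simp only [map_mul, mul_assoc]⟩
      | zero => exact ⟨0, by rw [mul_zero, zero_mul]⟩
      | add q q' _ _ h h' =>
        obtain ⟨y, rfl⟩ := h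
        obtain ⟨y', rfl⟩ := h'
        exact ⟨y + y', by rw [mul_add, add_mul]⟩
      | smul c q _ hq =>
        obtain ⟨y, rfl⟩ := hq
        obtain ⟨t, ht⟩ := isHomog_idem (k := k) (m := m) p m
        induction c using MulOpposite.rec' with
        | h c =>
          exact ⟨y * ofA k n m ((A.parity k n)^[t] c), by
            rw [op_smul_eq, mul_assoc, ofONH_mul_ofA ht]; simp only [mul_assoc]⟩
    · rintro _ ⟨y, rfl⟩
      have h1 := idem'_mul_mem (k := k) (n := n) hl hred y
      obtain ⟨t, ht⟩ := ofA_mul_ofONH' (n := n) (isHomog_idem (k := k) (m := m) p m)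
      rw [SetLike.mem_coe]
      generalize ofONH k n m (idem' k m l m) * y = z at h1
      induction h1 using Submodule.span_induction with
      | mem z hz =>
        obtain ⟨⟨a, w⟩, rfl⟩ := hz
        simp only
        rw [← map_mul]
        by_cases hw : IncreasingFrom p w
        · refine Submodule.subset_span ⟨(a, QuotientGroup.mk w), ?_⟩
          simp only
          rw [← eq_rep_of_increasingFrom hrep hw]
        · rw [mul_assoc, tauWord_red_mul_idem k hred hp hw, mul_zero, map_zero]
          exact zero_mem _
      | zero => rw [zero_mul]; exact zero_mem _
      | add q q' _ _ h h' => rw [add_mul]; exact add_mem h h'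
      | smul c q _ hq =>
        induction c using MulOpposite.rec' with
        | h c =>
          rw [op_smul_eq, mul_assoc, ht, ← mul_assoc, ← op_smul_eq]
          exact Submodule.smul_mem _ _ hq

end IdempotentBases

end OddNilHecke

end

theorem mainTheorem11 (k : Type*) [Field k] [NeZero (2 : k)] (n m : ℕ) (hm : 1 ≤ m)
    (red : Equiv.Perm (Fin m) → List (OddNilHecke.Letter m))
    (hred : ∀ w, OddNilHecke.IsReduced w (red w)) :
    (∀ l p : ℕ, 1 ≤ l → l ≤ m → 1 ≤ p → p ≤ m →
      ∀ rep : Equiv.Perm (Fin m) ⧸ OddNilHecke.intervalSubgroup p m → Equiv.Perm (Fin m),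
        OddNilHecke.IsMinimalSection p m rep →
        OddNilHecke.IsSuperBasis (k := k) (n := n) (m := m)
          (fun i : OddNilHecke.Y n l m × (Equiv.Perm (Fin m) ⧸ OddNilHecke.intervalSubgroup p m) =>
            OddNilHecke.CycQuot.ofONH k n m
              (OddNilHecke.idem' k m l m * OddNilHecke.monomial k i.1.1 *
                OddNilHecke.tauWord k (red (rep i.2)) * OddNilHecke.idem k m p m))
          {y | ∃ h : OddNilHecke.CycQuot k n m,
            y = OddNilHecke.CycQuot.ofONH k n m (OddNilHecke.idem' k m l m) * h *
              OddNilHecke.CycQuot.ofONH k n m (OddNilHecke.idem k m p m)}) ∧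
    OddNilHecke.IsSuperBasis (k := k) (n := n) (m := m)
      (fun i : OddNilHecke.X n m × Equiv.Perm (Fin m) =>
        OddNilHecke.CycQuot.ofONH k n m
          (OddNilHecke.monomial k i.1.1 * OddNilHecke.tauWord k (red i.2)))
      Set.univ := by
  exact ⟨fun l p hl hlm hp hpm rep hrep =>
    OddNilHecke.isSuperBasis_idem'_mul_idem hl hlm hp hpm hred hrep,
    OddNilHecke.isSuperBasis_monomial_tauWord hm hred⟩
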